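/- **Setting.** Work over $\mathbb C$. Let $V=U_0\oplus U_\infty$ be the 10-dimensional quadratic space with bases $e_{-1},\dots,e_{-5}$ of $U_0$ and $e_1,\dots,e_5$ of $U_\infty$ and quadratic form $Q(\sum a_ie_{-i}+\sum b_ie_i)=\sum a_ib_i$. A vector $u\in V$ acts on $\Lambda U_\infty$ by $\varphi_u$, where $\varphi_{e_i}$ is left wedging with $e_i$ and $\varphi_{e_{-i}}$ is contraction with respect to $e_i$. Let $S^+=\Lambda^{\mathrm{even}}U_\infty$, with basis $e_I=e_{i_1}\wedge\cdots\wedge e_{i_k}$ ($I=\{i_1<\dots<i_k\}\subset\{1,\dots,5\}$, $k$ even) and coordinates $x_I$ on $\mathbb P(S^+)=\mathbb P^{15}$ ($x_0$ for $I=\emptyset$). $\mathrm{OG}(5,10)\subset\mathbb P(S^+)$ is the set of $[s]$ for which there is a Lagrangian (5-dimensional, $Q|_U=0$) subspace $U\subset V$ with $\varphi_u(s)=0$ for all $u\in U$; then $s$ is called the half spinor of $U$. Let $t=t_0/t_1$. Let $G$ be the graph with vertices $0,1,2,34,5,6,7,8,9,10,11$ and edges 0-1, 0-8, 0-9, 1-2,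 1-10, 2-34, 2-11, 34-9, 34-5, 34-10, 5-6, 5-11, 6-7, 6-9, 7-8, 7-10, 8-11. For $(t_0,t_1)$ with $t_0t_1(t_0-t_1)\neq0$ let $C_t=\bigcup_{v\in G}C_t^v\subset\mathbb P^6$ (coordinates $y_0,\dots,y_6$) be the nodal curve with components - $C_t^0:\ y_5=y_4=y_3=y_2=y_1=0$; $\quad C_t^1:\ y_6=y_5=y_4=y_3=y_2=0$; $\quad C_t^2:\ y_6=y_5=y_4=y_3=y_0-y_1=0$; - $C_t^{34}:\ t_0y_2y_3-t_1y_2y_4+(t_1-t_0)y_3y_4=y_6=y_5=y_1-y_2+y_4=y_0-y_2+y_3=0$; - $C_t^5:\ y_6=y_3-y_4=y_2-y_4+y_5=y_1=y_0=0$; $\quad C_t^6:\ y_4-y_5=y_3-y_5+y_6=y_2=y_1=y_0=0$; - $C_t^7:\ y_5-y_6=y_3=y_2=y_1=y_0=0$; $\quad C_t^8:\ y_4=y_3=y_2=y_1=y_0=0$; - $C_t^9:\ y_5=y_4=y_2=y_1=y_0+y_3+y_6=0$; $\quad C_t^{10}:\ y_6=y_5=y_3=y_2=y_0=0$; $\quad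 C_t^{11}:\ y_6=y_4=y_3=y_1=y_0=0$. Its ideal is generated by the quadrics $$\begin{aligned} g_0&=-t_0y_1y_3+t_1y_0y_4,\\ g_1&=-(t_0-t_1)y_0y_3-t_1y_2y_3-(t_0-t_1)y_3^2+t_1y_2y_4+(t_0-t_1)y_3y_4-(t_0-t_1)y_3y_6,\\ g_2&=(t_0-t_1)y_1y_3+t_1y_2y_3-t_1y_2y_4,\\ g_3&=t_0y_2y_3-t_1y_2y_4-(t_0-t_1)y_3y_4+(t_0-t_1)y_3y_5,\\ g_4&=-t_1y_0y_2+t_1y_1y_2-t_1y_2y_3+t_1y_2y_4,\\ g_5&=y_2y_6,\quad g_6=y_1y_5,\quad g_7=y_0y_5+y_3y_5-y_4y_5+y_4y_6,\quad g_8=y_1y_6,\quad g_9=y_3y_5-y_4y_5+y_4y_6, \end{aligned}$$ which satisfy $\sum_{i=0}^4g_ig_{i+5}=0$. For a smooth point $p$ of $C_t$ (a point where the Jacobian matrix has rank 5), the row space of $(\partial g_j/\partial y_i(p))$ is a Lagrangian of $V$, where $g_0,\dots,g_4$ are identified with $e_{-1},\dots,e_{-5}$ and $g_5,\dots,g_9$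 with $e_1,\dots,e_5$; let $\rho(p)\in\mathbb P(S^+)$ be its half spinor. Let $X_t^v$ be the Zariski closure of $\rho(C_t^v\cap C_t^{\mathrm{sm}})$ and $X_t=\bigcup_{v\in G}X_t^v$. Let $P_t\subset\mathbb P(S^+)$ be the linear subspace $$x_{2345}=x_{1245}=x_{1234}=t_0x_{25}-t_1x_{35}-t_0x_{45}=x_{23}-x_{25}=x_{15}+x_{25}-x_{35}-x_{45}=x_{14}=x_{12}-x_{13}=x_0+t_1x_{25}-t_1x_{35}-t_1x_{45}=0 .$$ These objects depend on the representative $(t_0,t_1)$ of $[t_0:t_1]$; near $t=1$ take $(t_0,t_1)=(\tau,1)$ with $\tau\to1$, and near $t=\infty$ take $(t_0,t_1)=(1,\tau)$ with $\tau\to0$. So $P_1$ is given by $(1,1)$ and $P_\infty$ by $(1,0)$. Let $X_1$ and $X_\infty$ be the flat limits of $X_t$ as $t\to1$ and $t\to\infty$, that is, the scheme-theoretic fibres over $\tau=1$, respectively $\tau=0$, of the closure in $\mathbb P^{15}\times\mathbb A^1_\tau$ of the family over $\tau\notin\{0,1\}$; limits of components are defined in the same way. A smooth point, node, or spatial triple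 point of a curve is a point at which the tangent cone is, as a scheme, the reduced union of respectively one, two, or three linearly independent lines. Let $G_1$ be the graph with vertices $0,\dots,11$ and edges 0-1, 0-8, 0-9, 1-2, 1-10, 2-11, 2-4, 4-5, 3-4, 3-9, 3-10, 5-6, 5-11, 6-7, 6-9, 7-8, 7-10, 8-11; contracting the edge 3-4 gives $G$. **Proposition.** 1. $X_1$ is the scheme-theoretic union of the limits as $t\to1$ of the components $X_t^v$, $v\in G$. It is a graph curve with dual graph $G_1$: its irreducible components are twelve distinct lines $L_0,\dots,L_{11}$, every point of $X_1$ is a smooth point or a node, every node lies on exactly two of the lines, and for $i\ne j$ the lines $L_i,L_j$ have a common node if and only if $i$-$j$ is an edge of $G_1$. The labelling can be chosen so that the limit of $X_t^v$ is $L_v$ for $v\neq 34$ and the limit of $X_t^{34}$ is $L_3\cup L_4$. However, $P_1\cap\mathrm{OG}(5,10)\neq X_1$, even as sets. 2. $X_\infty$ is the scheme-theoretic union of the limits as $t\to\infty$ of the components $X_t^v$, $v\in G$. It is a reducible curve each of whose points is a smooth point, a node or a spatial triple point, and both nodes and spatial triple points occur. Furthermore, $P_\infty\cap\mathrm{OG}(5,10)\neq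 X_\infty$, even as sets. -/

import Mathlib

noncomputable section

namespace MukaiGenusSeven

open MvPolynomial

/-! ### Projective subschemes, flat limits and singularities

Projective space `ℙ(ℂ^σ)` has homogeneous coordinate ring `MvPolynomial σ ℂ`. A closed subset is
represented by its affine cone in `σ → ℂ`, a closed subscheme by a homogeneous ideal; a point is
represented by a nonzero vector. -/

/-- Two homogeneous ideals define the same closed subscheme of projective space: they agree in all
sufficiently large degrees. -/
def SameSubscheme {σ : Type} (I J : Ideal (MvPolynomial σ ℂ)) : Prop :=
  ∃ N : ℕ, ∀ n ≥ N, ∀ f : MvPolynomial σ ℂ, f.IsHomogeneous n → (f ∈ I ↔ f ∈ J)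

/-- The smallest Zariski closed subset containing `S`. -/
def zariskiClosure {σ : Type} (S : Set (σ → ℂ)) : Set (σ → ℂ) :=
  zeroLocus ℂ (vanishingIdeal ℂ S)

/-- Specialization of the parameter `τ` of `ℂ[τ][x]` at a complex number `c`. -/
def specialize {σ : Type} (c : ℂ) : MvPolynomial σ (Polynomial ℂ) →+* MvPolynomial σ ℂ :=
  MvPolynomial.map (Polynomial.evalRingHom c)

/-- The ideal in `ℂ[τ][x]` of the closure of the total space of a family `(X τ)`, `τ ∈ B`, of closed
subsets of projective space. -/
def totalIdeal {σ : Type} (B : Set ℂ) (X : ℂ → Set (σ → ℂ)) :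
    Ideal (MvPolynomial σ (Polynomial ℂ)) where
  carrier := {F | ∀ τ ∈ B, ∀ x ∈ X τ, eval x (specialize τ F) = 0}
  zero_mem' := by
    intro τ _ x _
    simp
  add_mem' := by
    intro F G hF hG τ hτ x hx
    rw [map_add, map_add, hF τ hτ x hx, hG τ hτ x hx, add_zero]
  smul_mem' := by
    intro F G hG τ hτ x hx
    rw [smul_eq_mul, map_mul, map_mul, hG τ hτ x hx, mul_zero]

/-- The flat limit at `τ = c` (with `c ∉ B` a limit point of `B`) of the family `(X τ)`, `τ ∈ B`: the
fibre over `c` of the closure of the total space, given by its homogeneous ideal. -/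
def flatLimit {σ : Type} (B : Set ℂ) (X : ℂ → Set (σ → ℂ)) (c : ℂ) : Ideal (MvPolynomial σ ℂ) :=
  (totalIdeal B X).map (specialize c)

/-- The polynomial `z ↦ f (a + z)`. -/
def translate {σ : Type} (a : σ → ℂ) (f : MvPolynomial σ ℂ) : MvPolynomial σ ℂ :=
  aeval (fun i => X i + C (a i)) f

/-- The ideal of the tangent cone at `a` of the affine scheme defined by `J`: it is generated by the
lowest degree forms of the `f (a + z)`, `f ∈ J`. -/
def tangentConeIdeal {σ : Type} (J : Ideal (MvPolynomial σ ℂ)) (a : σ → ℂ) :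
    Ideal (MvPolynomial σ ℂ) :=
  Ideal.span {h | ∃ f ∈ J, ∃ d : ℕ, (∀ e < d, homogeneousComponent e (translate a f) = 0) ∧
    h = homogeneousComponent d (translate a f)}

/-- In an affine chart `x_k = 1` around the point `[p]`, the tangent cone of the projective scheme
defined by `I` is, as a scheme, the reduced union of `n` linearly independent lines through the
origin. -/
def TangentConeIsLines {σ : Type} (n : ℕ) (I : Ideal (MvPolynomial σ ℂ)) (p : σ → ℂ) : Prop :=
  ∃ k : σ, p k ≠ 0 ∧ ∃ v : Fin n → (σ → ℂ), LinearIndependent ℂ v ∧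
    tangentConeIdeal (I ⊔ Ideal.span {X k - 1}) ((p k)⁻¹ • p) =
      vanishingIdeal ℂ (⋃ i, (Submodule.span ℂ {v i} : Set (σ → ℂ)))

/-- `[p]` is a smooth point of a one-dimensional scheme: the tangent cone is a reduced line. -/
def IsSmoothPoint {σ : Type} (I : Ideal (MvPolynomial σ ℂ)) (p : σ → ℂ) : Prop :=
  TangentConeIsLines 1 I p

/-- `[p]` is a node: the tangent cone is the reduced union of two distinct lines. -/
def IsNode {σ : Type} (I : Ideal (MvPolynomial σ ℂ)) (p : σ → ℂ) : Prop :=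
  TangentConeIsLines 2 I p

/-- `[p]` is a spatial triple point: the tangent cone is the reduced union of three lines that are
not coplanar. -/
def IsSpatialTriplePoint {σ : Type} (I : Ideal (MvPolynomial σ ℂ)) (p : σ → ℂ) : Prop :=
  TangentConeIsLines 3 I p

/-- The projective scheme defined by `I` is a graph curve whose components are the distinct
projective lines `ℙ(L v)`, and its dual graph is `G`. (Two distinct lines have at most one common
point, so the dual graph has no multiple edges.) -/
structure IsGraphCurve {σ V : Type} (I : Ideal (MvPolynomial σ ℂ)) (G : SimpleGraph V)
    (L : V → Submodule ℂ (σ → ℂ)) : Prop where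
  line : ∀ v, Module.finrank ℂ (L v) = 2
  injective : Function.Injective L
  components : I.minimalPrimes = Set.range fun v => vanishingIdeal ℂ (L v : Set (σ → ℂ))
  nodal : ∀ p ∈ zeroLocus ℂ I, p ≠ 0 → IsSmoothPoint I p ∨ IsNode I p
  node_on_two : ∀ p, IsNode I p → ∃ v w, v ≠ w ∧ {u | p ∈ L u} = {v, w}
  adj_iff : ∀ v w, v ≠ w → (G.Adj v w ↔ ∃ p, p ∈ L v ∧ p ∈ L w ∧ IsNode I p)

/-! ### Spinors and the orthogonal Grassmannian -/

/-- The quadratic space `V = U_0 × U_∞` of dimension ten, with the bases `e_{-1}, …, e_{-5}` of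
`U_0` and `e_1, …, e_5` of `U_∞` (indexed by `Fin 5`, so with indices shifted by one). -/
abbrev QuadSpace : Type := (Fin 5 → ℂ) × (Fin 5 → ℂ)

/-- The quadratic form on `V`. -/
def quadForm (u : QuadSpace) : ℂ := ∑ i, u.1 i * u.2 i

/-- Lagrangian subspaces of `V`. -/
def IsLagrangian (U : Submodule ℂ QuadSpace) : Prop :=
  Module.finrank ℂ U = 5 ∧ ∀ u ∈ U, quadForm u = 0

/-- The action `φ_u` on `Λ U_∞`: vectors of `U_0` act by contraction, vectors of `U_∞` by wedging
on the left. -/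
def spinAction (u : QuadSpace) (s : ExteriorAlgebra ℂ (Fin 5 → ℂ)) :
    ExteriorAlgebra ℂ (Fin 5 → ℂ) :=
  CliffordAlgebra.contractLeft (∑ i, u.1 i • (LinearMap.proj i : (Fin 5 → ℂ) →ₗ[ℂ] ℂ)) s +
    ExteriorAlgebra.ι ℂ u.2 * s

/-- The index set of the coordinates `x_I` on `S⁺ = Λ^{even} U_∞`. The indices `1, …, 5` are
`0, …, 4` here: for instance `x_{25}` has index `{1, 4}`. -/
abbrev SpinIdx : Type := {I : Finset (Fin 5) // Even I.card}

/-- The element `∑ x_I e_I` of `S⁺` with coordinates `x`. -/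
def halfSpinor (x : SpinIdx → ℂ) : ExteriorAlgebra ℂ (Fin 5 → ℂ) :=
  ∑ I : SpinIdx, x I • (Pi.basisFun ℂ (Fin 5)).ExteriorAlgebra I.1

/-- The (cone over the) orthogonal Grassmannian `OG(5,10) ⊆ ℙ(S⁺)` in its spinor embedding: half
spinors of Lagrangians. -/
def orthogonalGrassmannian : Set (SpinIdx → ℂ) :=
  {x | ∃ U : Submodule ℂ QuadSpace, IsLagrangian U ∧ ∀ u ∈ U, spinAction u (halfSpinor x) = 0}

/-! ### The family of nodal curves in `ℙ⁶` -/

/-- The vertices of the graph `G`. -/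
inductive GVertex : Type
  | v0 | v1 | v2 | v34 | v5 | v6 | v7 | v8 | v9 | v10 | v11

/-- The components of the curve with parameter `[t₀ : t₁]` (as cones): ten lines and a conic. -/
def nodComponent (t₀ t₁ : ℂ) : GVertex → Set (Fin 7 → ℂ)
  | .v0 => {y | y 5 = 0 ∧ y 4 = 0 ∧ y 3 = 0 ∧ y 2 = 0 ∧ y 1 = 0}
  | .v1 => {y | y 6 = 0 ∧ y 5 = 0 ∧ y 4 = 0 ∧ y 3 = 0 ∧ y 2 = 0}
  | .v2 => {y | y 6 = 0 ∧ y 5 = 0 ∧ y 4 = 0 ∧ y 3 = 0 ∧ y 0 - y 1 = 0}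
  | .v34 => {y | t₀ * y 2 * y 3 - t₁ * y 2 * y 4 + (-t₀ + t₁) * y 3 * y 4 = 0 ∧
      y 6 = 0 ∧ y 5 = 0 ∧ y 1 - y 2 + y 4 = 0 ∧ y 0 - y 2 + y 3 = 0}
  | .v5 => {y | y 6 = 0 ∧ y 3 - y 4 = 0 ∧ y 2 - y 4 + y 5 = 0 ∧ y 1 = 0 ∧ y 0 = 0}
  | .v6 => {y | y 4 - y 5 = 0 ∧ y 3 - y 5 + y 6 = 0 ∧ y 2 = 0 ∧ y 1 = 0 ∧ y 0 = 0}
  | .v7 => {y | y 5 - y 6 = 0 ∧ y 3 = 0 ∧ y 2 = 0 ∧ y 1 = 0 ∧ y 0 = 0}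
  | .v8 => {y | y 4 = 0 ∧ y 3 = 0 ∧ y 2 = 0 ∧ y 1 = 0 ∧ y 0 = 0}
  | .v9 => {y | y 5 = 0 ∧ y 4 = 0 ∧ y 2 = 0 ∧ y 1 = 0 ∧ y 0 + y 3 + y 6 = 0}
  | .v10 => {y | y 6 = 0 ∧ y 5 = 0 ∧ y 3 = 0 ∧ y 2 = 0 ∧ y 0 = 0}
  | .v11 => {y | y 6 = 0 ∧ y 4 = 0 ∧ y 3 = 0 ∧ y 1 = 0 ∧ y 0 = 0}

/-- The generators `g₀, …, g₄` of the ideal of the curve; `∑ gᵢ gᵢ₊₅ = 0`. -/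
def gLow (t₀ t₁ : ℂ) : Fin 5 → MvPolynomial (Fin 7) ℂ :=
  ![-C t₀ * X 1 * X 3 + C t₁ * X 0 * X 4,
    -C (t₀ - t₁) * X 0 * X 3 - C t₁ * X 2 * X 3 - C (t₀ - t₁) * X 3 ^ 2 + C t₁ * X 2 * X 4
      + C (t₀ - t₁) * X 3 * X 4 - C (t₀ - t₁) * X 3 * X 6,
    C (t₀ - t₁) * X 1 * X 3 + C t₁ * X 2 * X 3 - C t₁ * X 2 * X 4,
    C t₀ * X 2 * X 3 - C t₁ * X 2 * X 4 - C (t₀ - t₁) * X 3 * X 4 + C (t₀ - t₁) * X 3 * X 5,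
    -C t₁ * X 0 * X 2 + C t₁ * X 1 * X 2 - C t₁ * X 2 * X 3 + C t₁ * X 2 * X 4]

/-- The generators `g₅, …, g₉` of the ideal of the curve. -/
def gHigh : Fin 5 → MvPolynomial (Fin 7) ℂ :=
  ![X 2 * X 6,
    X 1 * X 5,
    X 0 * X 5 + X 3 * X 5 - X 4 * X 5 + X 4 * X 6,
    X 1 * X 6,
    X 3 * X 5 - X 4 * X 5 + X 4 * X 6]

/-- `W_y^⊥`: the row space of the Jacobian matrix `(∂ g_j / ∂ y_i)` at `y`, with `g₀, …, g₄` the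
basis of `U_0` and `g₅, …, g₉` the basis of `U_∞`. -/
def jacobianRowSpace (t₀ t₁ : ℂ) (y : Fin 7 → ℂ) : Submodule ℂ QuadSpace :=
  Submodule.span ℂ (Set.range fun i : Fin 7 =>
    ((fun j => eval y (pderiv i (gLow t₀ t₁ j)), fun j => eval y (pderiv i (gHigh j))) :
      QuadSpace))

/-- The image under `ρ` of the points of the component `v` that are smooth points of the curve
(Jacobian criterion: for a curve in `ℙ⁶` the rank is five). A point `y` is sent to the half spinor
of `W_y^⊥`. -/
def rhoImage (t₀ t₁ : ℂ) (v : GVertex) : Set (SpinIdx → ℂ) :=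
  {x | ∃ y ∈ nodComponent t₀ t₁ v, y ≠ 0 ∧ Module.finrank ℂ (jacobianRowSpace t₀ t₁ y) = 5 ∧
    ∀ u ∈ jacobianRowSpace t₀ t₁ y, spinAction u (halfSpinor x) = 0}

/-- The component `X_t^v` in `ℙ(S⁺)`. -/
def spinComponent (t₀ t₁ : ℂ) (v : GVertex) : Set (SpinIdx → ℂ) :=
  zariskiClosure (rhoImage t₀ t₁ v)

/-- The curve `X_t` in `ℙ(S⁺)`. -/
def spinCurve (t₀ t₁ : ℂ) : Set (SpinIdx → ℂ) :=
  ⋃ v, spinComponent t₀ t₁ v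

/-- The linear subspace `P_t`. -/
def linearSpace (t₀ t₁ : ℂ) : Set (SpinIdx → ℂ) :=
  {x | x ⟨{1, 2, 3, 4}, by decide⟩ = 0 ∧
    x ⟨{0, 1, 3, 4}, by decide⟩ = 0 ∧
    x ⟨{0, 1, 2, 3}, by decide⟩ = 0 ∧
    t₀ * x ⟨{1, 4}, by decide⟩ - t₁ * x ⟨{2, 4}, by decide⟩ - t₀ * x ⟨{3, 4}, by decide⟩ = 0 ∧
    x ⟨{1, 2}, by decide⟩ - x ⟨{1, 4}, by decide⟩ = 0 ∧
    x ⟨{0, 4}, by decide⟩ + x ⟨{1, 4}, by decide⟩ - x ⟨{2, 4}, by decide⟩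
      - x ⟨{3, 4}, by decide⟩ = 0 ∧
    x ⟨{0, 3}, by decide⟩ = 0 ∧
    x ⟨{0, 1}, by decide⟩ - x ⟨{0, 2}, by decide⟩ = 0 ∧
    x ⟨∅, by decide⟩ + t₁ * x ⟨{1, 4}, by decide⟩ - t₁ * x ⟨{2, 4}, by decide⟩
      - t₁ * x ⟨{3, 4}, by decide⟩ = 0}

/-! ### The limits as `t → 1` and `t → ∞`

Here `t = t₀ / t₁`. Near `t = 1` the representative `(t₀, t₁) = (τ, 1)`, `τ → 1`, is used, and near
`t = ∞` the representative `(t₀, t₁) = (1, τ)`, `τ → 0`. -/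

/-- In both charts, the parameters with `t ∉ {0, 1, ∞}`. -/
def chartBase : Set ℂ := {τ | τ ≠ 0 ∧ τ ≠ 1}

/-- The limit of the component `v` as `t → 1`. -/
def limitOneComponent (v : GVertex) : Ideal (MvPolynomial SpinIdx ℂ) :=
  flatLimit chartBase (fun τ => spinComponent τ 1 v) 1

/-- `X_1`. -/
def limitOne : Ideal (MvPolynomial SpinIdx ℂ) :=
  flatLimit chartBase (fun τ => spinCurve τ 1) 1

/-- The limit of the component `v` as `t → ∞`. -/
def limitInftyComponent (v : GVertex) : Ideal (MvPolynomial SpinIdx ℂ) :=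
  flatLimit chartBase (fun τ => spinComponent 1 τ v) 0

/-- `X_∞`. -/
def limitInfty : Ideal (MvPolynomial SpinIdx ℂ) :=
  flatLimit chartBase (fun τ => spinCurve 1 τ) 0

/-- The trivalent graph `G_1`. -/
def graphOne : SimpleGraph (Fin 12) :=
  SimpleGraph.fromEdgeSet
    {s(0, 1), s(0, 8), s(0, 9), s(1, 2), s(1, 10), s(2, 11), s(2, 4), s(4, 5), s(3, 4), s(3, 9),
      s(3, 10), s(5, 6), s(5, 11), s(6, 7), s(6, 9), s(7, 8), s(7, 10), s(8, 11)}

/-- The contraction of the edge `3 -- 4`, which maps `G_1` to `G`. -/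
def contractEdge : Fin 12 → GVertex :=
  ![.v0, .v1, .v2, .v34, .v34, .v5, .v6, .v7, .v8, .v9, .v10, .v11]

end MukaiGenusSeven

end

namespace MukaiGenusSeven

open MvPolynomial

noncomputable section

/-! ### The spin action in coordinates -/

section ExteriorBasis

variable {R M I : Type*} [CommRing R] [AddCommGroup M] [Module R M] [LinearOrder I]
  (b : Module.Basis I R M)

/-! On the curve $C_t$ the half spinor is a linear function of the point. There is a linear map
`spinVec` from $\mathbb C^7$ to $S^+$, with image in $P_t$, such that $\varphi_{g(y)}T(y)=0$
identically in $y$. Polarizing this cubic identity (`spinCoord_polar_spinVec`) and using $g(y)=0$ on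
the curve shows that the Jacobian row space at $y$ annihilates $T(y)$. Conversely, anything
annihilated by the row space at $y\neq0$ satisfies the nine equations of $P_t$ and has linear
coordinates proportional to $y$ (`linear_equations_of_annihilated`). So $X_t^v$ is a linear copy of
$C_t^v$. Dividing $y_3,y_5,y_6$ by $t_1$ gives `spinVec` a left inverse that is polynomial in $\tau$
in both charts. Hence the embeddings do not degenerate, and the flat limits can be computed in a
fixed $\mathbb P^6$ (`mem_flatLimit_of_comp_mem`).

The limit ideals are bounded from two sides. A polynomial in the total ideal, pulled back along a
parametrization that is polynomial in $\tau$ and two parameters, vanishes generically, hence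
everywhere, in particular at the limit value of $\tau$ (`eval_spinVec_eq_zero`); so the limit
contains the limits of the parametrized components. For the other inclusion, `equations` lists forms
that vanish on every member of the family: combinations of the $g_j$ from which the factors $t_1$
and $t_0-t_1$ have been removed, and a quartic. Their specializations generate the full vanishing
ideal of the limit configuration (`mem_span_equations_one`, `mem_span_equations_infty`), which is
proved by splitting off one line at a time (`mem_of_shelling`).

At $t=1$ the conic breaks into two lines and the configuration consists of twelve lines. At
$t=\infty$ the conic stays smooth, but the limits of components 5, 6, 8, 9 fall into the plane
$z_0=z_1=z_2=z_4=0$, on which all ten specialized quadrics vanish; the quartic cuts the four lines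
out of this plane. In both cases the limit ideal equals a vanishing ideal (`limitOne_eq`,
`limitInfty_eq`). The same bounds applied to components give the scheme-theoretic unions, as
equalities of ideals.

The local structure follows from a computation of tangent cones (`tangentConeIdeal_eq`): where
lines, and possibly the conic, pass through a point in linearly independent directions, the tangent
cone is the reduced union of these directions. Since $G_1$ has no triangles, no three of the twelve
lines share a point, so $X_1$ is a graph curve (`isGraphCurve_of_lines`). On $X_\infty$ three lines
meet at three points of one line of the plane, and the conic meets two lines of the plane at a
fourth point; these are the spatial triple points.

Finally, explicit Lagrangians give points of $P_1\cap\mathrm{OG}$ and $P_\infty\cap\mathrm{OG}$ at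
which some form in the limit ideal does not vanish: at $t=1$ the quadric coming from
$(g_1+g_2)/(t_0-t_1)$, at $t=\infty$ the quartic. -/

theorem exteriorBasis_empty : b.ExteriorAlgebra ∅ = 1 := by
  rw [ExteriorAlgebra.basis_apply_ofCard b (Finset.card_empty)]
  simp [ExteriorAlgebra.ιMulti_family]

/-- A new minimum comes first in the increasing enumeration, so no sign appears. All later sign
computations are inductions that peel off the minimum. -/
theorem exteriorBasis_insert {a : I} {s : Finset I} (h : ∀ x ∈ s, a < x) :
    b.ExteriorAlgebra (insert a s) = ExteriorAlgebra.ι R (b a) * b.ExteriorAlgebra s := by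
  have ha : a ∉ s := fun hs => lt_irrefl _ (h a hs)
  have hc := Finset.card_insert_of_notMem ha
  rw [ExteriorAlgebra.basis_apply_ofCard b hc, ExteriorAlgebra.basis_apply_ofCard b rfl]
  have key : (Fin.cons a (s.orderEmbOfFin rfl) : Fin (s.card + 1) → I) =
      (insert a s).orderEmbOfFin hc := by
    apply Finset.orderEmbOfFin_unique
    · intro x
      refine Fin.cases ?_ (fun i => ?_) x
      · simp
      · simp
    · intro x y hxy
      induction x using Fin.cases with
      | zero =>
        induction y using Fin.cases with
        | zero => exact absurd hxy (lt_irrefl _)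
        | succ j => simpa using h _ (Finset.orderEmbOfFin_mem s rfl j)
      | succ i =>
        induction y using Fin.cases with
        | zero => exact absurd hxy (by simp)
        | succ j => simpa using hxy
  simp only [ExteriorAlgebra.ιMulti_family, Set.powersetCard.ofFinEmbEquiv_symm_apply,
    Set.powersetCard.val_ofCard]
  rw [← key, ExteriorAlgebra.ιMulti_succ_apply]
  congr 2

/-- The sign `(-1)^k`, where `k` is the number of elements of `s` below `i`. -/
def wedgeSign (R : Type*) [CommRing R] (s : Finset I) (i : I) : R :=
  (-1) ^ (s.filter (· < i)).card

theorem wedgeSign_insert_of_lt {a i : I} {s : Finset I} (ha : a ∉ s) (h : a < i) :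
    wedgeSign R (insert a s) i = -wedgeSign R s i := by
  unfold wedgeSign
  rw [Finset.filter_insert, if_pos h, Finset.card_insert_of_notMem (by simp [ha]), pow_succ]
  ring

theorem wedgeSign_eq_one {i : I} {s : Finset I} (h : ∀ x ∈ s, i ≤ x) :
    wedgeSign R s i = 1 := by
  unfold wedgeSign
  rw [Finset.filter_eq_empty_iff.2 fun x hx => not_lt.2 (h x hx)]
  simp

/-- Compare $i$ with the minimum $a$: a smaller $i$ is prepended, an equal one squares to zero, and
a larger one anticommutes past $e_a$, which contributes exactly one sign. -/
theorem ι_mul_exteriorBasis (i : I) (s : Finset I) :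
    ExteriorAlgebra.ι R (b i) * b.ExteriorAlgebra s =
      if i ∈ s then 0 else wedgeSign R s i • b.ExteriorAlgebra (insert i s) := by
  induction s using Finset.induction_on_min with
  | empty => rw [if_neg (Finset.notMem_empty i), exteriorBasis_insert b (by simp),
      wedgeSign_eq_one (by simp), one_smul]
  | insert a s h ih =>
    have ha : a ∉ s := fun hs => lt_irrefl _ (h a hs)
    rcases lt_trichotomy i a with hia | rfl | hia
    · have hlt : ∀ x ∈ insert a s, i < x := by
        intro x hx
        rcases Finset.mem_insert.1 hx with rfl | hx
        · exact hia
        · exact hia.trans (h x hx)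
      rw [if_neg fun hi => lt_irrefl _ (hlt i hi), exteriorBasis_insert b hlt,
        wedgeSign_eq_one fun x hx => (hlt x hx).le, one_smul]
    · rw [exteriorBasis_insert b h, ← mul_assoc, ExteriorAlgebra.ι_sq_zero, zero_mul,
        if_pos (Finset.mem_insert_self _ _)]
    · rw [exteriorBasis_insert b h, ← mul_assoc,
        eq_neg_of_add_eq_zero_left (ExteriorAlgebra.ι_add_mul_swap (b i) (b a)), neg_mul,
        mul_assoc, ih]
      by_cases his : i ∈ s
      · simp [his]
      · have hlt : ∀ x ∈ insert i s, a < x := by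
          intro x hx
          rcases Finset.mem_insert.1 hx with rfl | hx
          · exact hia
          · exact h x hx
        rw [if_neg his, if_neg (by simp [his, hia.ne']), wedgeSign_insert_of_lt ha hia,
          Finset.insert_comm, exteriorBasis_insert b hlt, mul_smul_comm, neg_smul]

theorem contractLeft_exteriorBasis (i : I) (s : Finset I) :
    CliffordAlgebra.contractLeft (b.coord i) (b.ExteriorAlgebra s) =
      if i ∈ s then wedgeSign R s i • b.ExteriorAlgebra (s.erase i) else 0 := by
  induction s using Finset.induction_on_min with
  | empty =>
    rw [exteriorBasis_empty]
    exact CliffordAlgebra.contractLeft_one (Q := (0 : QuadraticForm R M)) _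
  | insert a s h ih =>
    have ha : a ∉ s := fun hs => lt_irrefl _ (h a hs)
    rw [exteriorBasis_insert b h]
    refine (CliffordAlgebra.contractLeft_ι_mul _ _ _).trans ?_
    rw [ih]
    by_cases hia : i = a
    · subst hia
      rw [if_neg ha, mul_zero, sub_zero, if_pos (Finset.mem_insert_self _ _),
        Finset.erase_insert ha, wedgeSign_eq_one]
      · simp
      · intro x hx
        rcases Finset.mem_insert.1 hx with rfl | hx
        · exact le_rfl
        · exact (h x hx).le
    · rw [Module.Basis.coord_apply, Module.Basis.repr_self,
        Finsupp.single_eq_of_ne hia, zero_smul, zero_sub]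
      by_cases his : i ∈ s
      · rw [if_pos his, if_pos (Finset.mem_insert_of_mem his),
          wedgeSign_insert_of_lt ha (h i his), Finset.erase_insert_of_ne (Ne.symm hia),
          exteriorBasis_insert b fun x hx => h x (Finset.mem_of_mem_erase hx), neg_smul]
        congr 1
        exact mul_smul_comm _ _ _
      · rw [if_neg his, if_neg (by simp [his, hia])]
        exact neg_eq_zero.2 (mul_zero _)

end ExteriorBasis

/-- Extension of coordinates on `S⁺` to all of `Λ U_∞` by zero. -/
def extendSpin (x : SpinIdx → ℂ) (I : Finset (Fin 5)) : ℂ :=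
  if h : Even I.card then x ⟨I, h⟩ else 0

/-- The coordinate with index `J` of the spin action. -/
def spinCoord (u : QuadSpace) (x : SpinIdx → ℂ) (J : Finset (Fin 5)) : ℂ :=
  ∑ i, if i ∈ J then u.2 i * (wedgeSign ℂ (J.erase i) i * extendSpin x (J.erase i))
    else u.1 i * (wedgeSign ℂ (insert i J) i * extendSpin x (insert i J))

theorem halfSpinor_eq (x : SpinIdx → ℂ) :
    halfSpinor x = ∑ I, extendSpin x I • (Pi.basisFun ℂ (Fin 5)).ExteriorAlgebra I := by
  rw [← Fintype.sum_subtype_add_sum_subtype fun I : Finset (Fin 5) => Even I.card,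
    Finset.sum_eq_zero (s := (Finset.univ : Finset {I : Finset (Fin 5) // ¬Even I.card})),
    add_zero]
  · exact Finset.sum_congr rfl fun I _ => by rw [extendSpin, dif_pos I.2]
  · intro I _
    rw [extendSpin, dif_neg I.2, zero_smul]

theorem sum_mem_eq_sum_notMem_insert {A : Type*} [AddCommMonoid A] (i : Fin 5)
    (f : Finset (Fin 5) → A) :
    (∑ I, if i ∈ I then f I else 0) = ∑ J, if i ∈ J then 0 else f (insert i J) := by
  have h : ∀ J, (if i ∈ J then 0 else f (insert i J)) =
      if i ∉ J then f (insert i J) else 0 := fun J => (ite_not _ _ _).symm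
  simp only [h]
  simp only [← Finset.sum_filter]
  refine Finset.sum_nbij' (fun I => I.erase i) (fun I => insert i I) ?_ ?_ ?_ ?_ ?_
  · simp
  · simp
  · intro I hI
    exact Finset.insert_erase (by simpa using hI)
  · intro I hI
    exact Finset.erase_insert (by simpa using hI)
  · intro I hI
    rw [Finset.insert_erase (by simpa using hI)]

theorem sum_notMem_eq_sum_mem_erase {A : Type*} [AddCommMonoid A] (i : Fin 5)
    (f : Finset (Fin 5) → A) :
    (∑ I, if i ∈ I then 0 else f I) = ∑ J, if i ∈ J then f (Finset.erase J i) else 0 := by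
  rw [sum_mem_eq_sum_notMem_insert]
  refine Finset.sum_congr rfl fun I _ => ?_
  split_ifs with h
  · rfl
  · rw [Finset.erase_insert h]

theorem spinAction_exteriorBasis (u : QuadSpace) (I : Finset (Fin 5)) :
    spinAction u ((Pi.basisFun ℂ (Fin 5)).ExteriorAlgebra I) =
      ∑ i, ((if i ∈ I then (u.1 i * wedgeSign ℂ I i) •
          (Pi.basisFun ℂ (Fin 5)).ExteriorAlgebra (I.erase i) else 0) +
        if i ∈ I then 0 else (u.2 i * wedgeSign ℂ I i) •
          (Pi.basisFun ℂ (Fin 5)).ExteriorAlgebra (insert i I)) := by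
  have hproj : ∀ i, (LinearMap.proj i : (Fin 5 → ℂ) →ₗ[ℂ] ℂ) =
      (Pi.basisFun ℂ (Fin 5)).coord i := fun i => by ext; simp
  have hvec : u.2 = ∑ i, u.2 i • Pi.basisFun ℂ (Fin 5) i := by
    simpa using ((Pi.basisFun ℂ (Fin 5)).sum_repr u.2).symm
  unfold spinAction
  rw [Finset.sum_add_distrib]
  congr 1
  · rw [map_sum, LinearMap.sum_apply]
    refine Finset.sum_congr rfl fun i _ => ?_
    rw [map_smul, LinearMap.smul_apply, hproj, contractLeft_exteriorBasis]
    split_ifs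
    · rw [smul_smul]
    · exact smul_zero _
  · conv_lhs => rw [hvec]
    rw [map_sum, Finset.sum_mul]
    refine Finset.sum_congr rfl fun i _ => ?_
    rw [map_smul, smul_mul_assoc, ι_mul_exteriorBasis]
    split_ifs
    · exact smul_zero _
    · rw [smul_smul]

theorem spinAction_halfSpinor (u : QuadSpace) (x : SpinIdx → ℂ) :
    spinAction u (halfSpinor x) =
      ∑ J, spinCoord u x J • (Pi.basisFun ℂ (Fin 5)).ExteriorAlgebra J := by
  have hlin : spinAction u (halfSpinor x) = ∑ I, extendSpin x I •
      spinAction u ((Pi.basisFun ℂ (Fin 5)).ExteriorAlgebra I) := by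
    rw [halfSpinor_eq]
    simp only [spinAction, map_sum, map_smul, Finset.mul_sum, mul_smul_comm, smul_add,
      Finset.sum_add_distrib]
  simp only [hlin, spinAction_exteriorBasis, spinCoord, Finset.smul_sum, Finset.sum_smul]
  rw [Finset.sum_comm, Finset.sum_comm (s := Finset.univ (α := Finset (Fin 5)))]
  refine Finset.sum_congr rfl fun i _ => ?_
  simp only [smul_add, smul_ite, smul_zero, Finset.sum_add_distrib]
  rw [sum_notMem_eq_sum_mem_erase, sum_mem_eq_sum_notMem_insert, ← Finset.sum_add_distrib]
  refine Finset.sum_congr rfl fun J _ => ?_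
  split_ifs with h
  · rw [zero_add, smul_smul, Finset.insert_erase h]
    congr 1
    ring
  · rw [add_zero, smul_smul, Finset.erase_insert h]
    congr 1
    ring

theorem spinAction_eq_zero_iff (u : QuadSpace) (x : SpinIdx → ℂ) :
    spinAction u (halfSpinor x) = 0 ↔ ∀ J, spinCoord u x J = 0 := by
  rw [spinAction_halfSpinor]
  refine ⟨fun h => ?_, fun h => by simp [h]⟩
  exact Fintype.linearIndependent_iff.1
    (Pi.basisFun ℂ (Fin 5)).ExteriorAlgebra.linearIndependent _ h

/-! ### The Jacobian matrix and the equations of its half spinor -/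

/-- For a concrete `J`, the neighbouring index sets, the choice between wedging and contraction, and
the signs are passed as literal data; the hypothesis relating them to `J` is then decidable. -/
theorem spinCoord_eq (u : QuadSpace) (x : SpinIdx → ℂ) (J : Finset (Fin 5))
    (a : Fin 5 → Finset (Fin 5)) (w s : Fin 5 → Bool)
    (h : ∀ i, (w i = true ↔ i ∈ J) ∧ (s i = true ↔ Odd (J.filter (· < i)).card) ∧
      (if i ∈ J then J.erase i else insert i J) = a i) :
    spinCoord u x J =
      ∑ i, (if w i then u.2 i else u.1 i) * (if s i then -1 else 1) * extendSpin x (a i) := by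
  unfold spinCoord
  refine Finset.sum_congr rfl fun i _ => ?_
  obtain ⟨hw, hs, ha⟩ := h i
  have hsign : (-1 : ℂ) ^ (J.filter (· < i)).card = if s i then -1 else 1 := by
    split_ifs with h
    · exact (hs.1 h).neg_one_pow
    · exact (Nat.not_odd_iff_even.1 fun hc => h (hs.2 hc)).neg_one_pow
  by_cases hi : i ∈ J
  · have : (J.erase i).filter (· < i) = J.filter (· < i) := by
      ext j; simp only [Finset.mem_filter, Finset.mem_erase]; grind
    rw [if_pos hi, if_pos (hw.2 hi), wedgeSign, this, hsign, ← ha, if_pos hi]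
    ring
  · have : (insert i J).filter (· < i) = J.filter (· < i) := by
      ext j; simp only [Finset.mem_filter, Finset.mem_insert]; grind
    rw [if_neg hi, if_neg (fun h => hi (hw.1 h)), wedgeSign, this, hsign, ← ha, if_neg hi]
    ring

/-! ### The sixteen odd coordinates of the spin action, written out. -/

theorem spinCoord_0 (u : QuadSpace) (x : SpinIdx → ℂ) : spinCoord u x {0} =
    u.2 0 * extendSpin x ∅ - u.1 1 * extendSpin x {0, 1} - u.1 2
      * extendSpin x {0, 2} - u.1 3 * extendSpin x {0, 3} - u.1 4 * extendSpin x {0, 4} := by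
  rw [spinCoord_eq u x _ ![∅, {0, 1}, {0, 2}, {0, 3}, {0, 4}]
    ![true, false, false, false, false] ![false, true, true, true, true] (by decide)]
  simp [Fin.sum_univ_five]; try ring

theorem spinCoord_1 (u : QuadSpace) (x : SpinIdx → ℂ) : spinCoord u x {1} =
    u.1 0 * extendSpin x {0, 1} + u.2 1 * extendSpin x ∅ - u.1 2
      * extendSpin x {1, 2} - u.1 3 * extendSpin x {1, 3} - u.1 4 * extendSpin x {1, 4} := by
  rw [spinCoord_eq u x _ ![{0, 1}, ∅, {1, 2}, {1, 3}, {1, 4}]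
    ![false, true, false, false, false] ![false, false, true, true, true] (by decide)]
  simp [Fin.sum_univ_five]; try ring

theorem spinCoord_2 (u : QuadSpace) (x : SpinIdx → ℂ) : spinCoord u x {2} =
    u.1 0 * extendSpin x {0, 2} + u.1 1 * extendSpin x {1, 2} + u.2
      2 * extendSpin x ∅ - u.1 3 * extendSpin x {2, 3} - u.1 4 * extendSpin x {2, 4} := by
  rw [spinCoord_eq u x _ ![{0, 2}, {1, 2}, ∅, {2, 3}, {2, 4}]
    ![false, false, true, false, false] ![false, false, false, true, true] (by decide)]
  simp [Fin.sum_univ_five]; try ring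

theorem spinCoord_3 (u : QuadSpace) (x : SpinIdx → ℂ) : spinCoord u x {3} =
    u.1 0 * extendSpin x {0, 3} + u.1 1 * extendSpin x {1, 3} + u.1
      2 * extendSpin x {2, 3} + u.2 3 * extendSpin x ∅ - u.1 4 * extendSpin x {3, 4} := by
  rw [spinCoord_eq u x _ ![{0, 3}, {1, 3}, {2, 3}, ∅, {3, 4}]
    ![false, false, false, true, false] ![false, false, false, false, true] (by decide)]
  simp [Fin.sum_univ_five]; try ring

theorem spinCoord_4 (u : QuadSpace) (x : SpinIdx → ℂ) : spinCoord u x {4} =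
    u.1 0 * extendSpin x {0, 4} + u.1 1 * extendSpin x {1, 4} + u.1
      2 * extendSpin x {2, 4} + u.1 3 * extendSpin x {3, 4} + u.2 4 * extendSpin x ∅ := by
  rw [spinCoord_eq u x _ ![{0, 4}, {1, 4}, {2, 4}, {3, 4}, ∅]
    ![false, false, false, false, true] ![false, false, false, false, false] (by decide)]
  simp [Fin.sum_univ_five]; try ring

theorem spinCoord_012 (u : QuadSpace) (x : SpinIdx → ℂ) : spinCoord u x {0, 1, 2} =
    u.2 0 * extendSpin x {1, 2} - u.2 1 * extendSpin x {0, 2} + u.2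
      2 * extendSpin x {0, 1} - u.1 3 * extendSpin x {0, 1, 2, 3} - u.1 4 * extendSpin x {0, 1, 2, 4} := by
  rw [spinCoord_eq u x _ ![{1, 2}, {0, 2}, {0, 1}, {0, 1, 2, 3}, {0, 1, 2, 4}]
    ![true, true, true, false, false] ![false, true, false, true, true] (by decide)]
  simp [Fin.sum_univ_five]; try ring

theorem spinCoord_013 (u : QuadSpace) (x : SpinIdx → ℂ) : spinCoord u x {0, 1, 3} =
    u.2 0 * extendSpin x {1, 3} - u.2 1 * extendSpin x {0, 3} + u.1
      2 * extendSpin x {0, 1, 2, 3} + u.2 3 * extendSpin x {0, 1} - u.1 4 * extendSpin x {0, 1, 3, 4} := by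
  rw [spinCoord_eq u x _ ![{1, 3}, {0, 3}, {0, 1, 2, 3}, {0, 1}, {0, 1, 3, 4}]
    ![true, true, false, true, false] ![false, true, false, false, true] (by decide)]
  simp [Fin.sum_univ_five]; try ring

theorem spinCoord_014 (u : QuadSpace) (x : SpinIdx → ℂ) : spinCoord u x {0, 1, 4} =
    u.2 0 * extendSpin x {1, 4} - u.2 1 * extendSpin x {0, 4} + u.1
      2 * extendSpin x {0, 1, 2, 4} + u.1 3 * extendSpin x {0, 1, 3, 4} + u.2 4 * extendSpin x {0, 1} := by
  rw [spinCoord_eq u x _ ![{1, 4}, {0, 4}, {0, 1, 2, 4}, {0, 1, 3, 4}, {0, 1}]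
    ![true, true, false, false, true] ![false, true, false, false, false] (by decide)]
  simp [Fin.sum_univ_five]; try ring

theorem spinCoord_023 (u : QuadSpace) (x : SpinIdx → ℂ) : spinCoord u x {0, 2, 3} =
    u.2 0 * extendSpin x {2, 3} - u.1 1 * extendSpin x {0, 1, 2,
      3} - u.2 2 * extendSpin x {0, 3} + u.2 3 * extendSpin x {0, 2} - u.1 4 * extendSpin x {0, 2, 3, 4} := by
  rw [spinCoord_eq u x _ ![{2, 3}, {0, 1, 2, 3}, {0, 3}, {0, 2}, {0, 2, 3, 4}]
    ![true, false, true, true, false] ![false, true, true, false, true] (by decide)]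
  simp [Fin.sum_univ_five]; try ring

theorem spinCoord_024 (u : QuadSpace) (x : SpinIdx → ℂ) : spinCoord u x {0, 2, 4} =
    u.2 0 * extendSpin x {2, 4} - u.1 1 * extendSpin x {0, 1, 2,
      4} - u.2 2 * extendSpin x {0, 4} + u.1 3 * extendSpin x {0, 2, 3, 4} + u.2 4 * extendSpin x {0, 2} := by
  rw [spinCoord_eq u x _ ![{2, 4}, {0, 1, 2, 4}, {0, 4}, {0, 2, 3, 4}, {0, 2}]
    ![true, false, true, false, true] ![false, true, true, false, false] (by decide)]
  simp [Fin.sum_univ_five]; try ring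

theorem spinCoord_034 (u : QuadSpace) (x : SpinIdx → ℂ) : spinCoord u x {0, 3, 4} =
    u.2 0 * extendSpin x {3, 4} - u.1 1 * extendSpin x {0, 1, 3,
      4} - u.1 2 * extendSpin x {0, 2, 3, 4} - u.2 3 * extendSpin x {0, 4} + u.2 4 * extendSpin x {0, 3} := by
  rw [spinCoord_eq u x _ ![{3, 4}, {0, 1, 3, 4}, {0, 2, 3, 4}, {0, 4}, {0, 3}]
    ![true, false, false, true, true] ![false, true, true, true, false] (by decide)]
  simp [Fin.sum_univ_five]; try ring

theorem spinCoord_123 (u : QuadSpace) (x : SpinIdx → ℂ) : spinCoord u x {1, 2, 3} =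
    u.1 0 * extendSpin x {0, 1, 2, 3} + u.2 1 * extendSpin x {2,
      3} - u.2 2 * extendSpin x {1, 3} + u.2 3 * extendSpin x {1, 2} - u.1 4 * extendSpin x {1, 2, 3, 4} := by
  rw [spinCoord_eq u x _ ![{0, 1, 2, 3}, {2, 3}, {1, 3}, {1, 2}, {1, 2, 3, 4}]
    ![false, true, true, true, false] ![false, false, true, false, true] (by decide)]
  simp [Fin.sum_univ_five]; try ring

theorem spinCoord_124 (u : QuadSpace) (x : SpinIdx → ℂ) : spinCoord u x {1, 2, 4} =
    u.1 0 * extendSpin x {0, 1, 2, 4} + u.2 1 * extendSpin x {2,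
      4} - u.2 2 * extendSpin x {1, 4} + u.1 3 * extendSpin x {1, 2, 3, 4} + u.2 4 * extendSpin x {1, 2} := by
  rw [spinCoord_eq u x _ ![{0, 1, 2, 4}, {2, 4}, {1, 4}, {1, 2, 3, 4}, {1, 2}]
    ![false, true, true, false, true] ![false, false, true, false, false] (by decide)]
  simp [Fin.sum_univ_five]; try ring

theorem spinCoord_134 (u : QuadSpace) (x : SpinIdx → ℂ) : spinCoord u x {1, 3, 4} =
    u.1 0 * extendSpin x {0, 1, 3, 4} + u.2 1 * extendSpin x {3,
      4} - u.1 2 * extendSpin x {1, 2, 3, 4} - u.2 3 * extendSpin x {1, 4} + u.2 4 * extendSpin x {1, 3} := by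
  rw [spinCoord_eq u x _ ![{0, 1, 3, 4}, {3, 4}, {1, 2, 3, 4}, {1, 4}, {1, 3}]
    ![false, true, false, true, true] ![false, false, true, true, false] (by decide)]
  simp [Fin.sum_univ_five]; try ring

theorem spinCoord_234 (u : QuadSpace) (x : SpinIdx → ℂ) : spinCoord u x {2, 3, 4} =
    u.1 0 * extendSpin x {0, 2, 3, 4} + u.1 1 * extendSpin x {1,
      2, 3, 4} + u.2 2 * extendSpin x {3, 4} - u.2 3 * extendSpin x {2, 4} + u.2 4 * extendSpin x {2, 3} := by
  rw [spinCoord_eq u x _ ![{0, 2, 3, 4}, {1, 2, 3, 4}, {3, 4}, {2, 4}, {2, 3}]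
    ![false, false, true, true, true] ![false, false, false, true, false] (by decide)]
  simp [Fin.sum_univ_five]; try ring

theorem spinCoord_01234 (u : QuadSpace) (x : SpinIdx → ℂ) : spinCoord u x {0, 1, 2, 3, 4} =
    u.2 0 * extendSpin x {1, 2, 3, 4} - u.2 1 * extendSpin x {0,
      2, 3, 4} + u.2 2 * extendSpin x {0, 1, 3, 4} - u.2 3 * extendSpin x {0, 1, 2, 4} + u.2 4 * extendSpin x {0, 1, 2, 3} := by
  rw [spinCoord_eq u x _ ![{1, 2, 3, 4}, {0, 2, 3, 4}, {0, 1, 3, 4}, {0, 1, 2, 4}, {0, 1, 2, 3}]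
    ![true, true, true, true, true] ![false, true, false, true, false] (by decide)]
  simp [Fin.sum_univ_five]; try ring

/-- Wedging and contraction change the parity of the degree, and the half spinor is even. -/
theorem spinCoord_of_even (u : QuadSpace) (x : SpinIdx → ℂ) {J : Finset (Fin 5)}
    (hJ : Even J.card) : spinCoord u x J = 0 := by
  refine Finset.sum_eq_zero fun i _ => ?_
  split_ifs with h
  · have hc : ¬Even (J.erase i).card := by
      have := Finset.card_erase_add_one h
      grind
    rw [extendSpin, dif_neg hc, mul_zero, mul_zero]
  · have hc : ¬Even (insert i J).card := by
      have := Finset.card_insert_of_notMem h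
      grind
    rw [extendSpin, dif_neg hc, mul_zero, mul_zero]

theorem spinCoord_eq_zero_of_odd {u : QuadSpace} {x : SpinIdx → ℂ}
    (h : ∀ J ∈ [({0} : Finset (Fin 5)), {1}, {2}, {3}, {4}, {0, 1, 2}, {0, 1, 3}, {0, 1, 4},
      {0, 2, 3}, {0, 2, 4}, {0, 3, 4}, {1, 2, 3}, {1, 2, 4}, {1, 3, 4}, {2, 3, 4}, {0, 1, 2, 3, 4}],
      spinCoord u x J = 0) (J : Finset (Fin 5)) : spinCoord u x J = 0 := by
  by_cases hJ : Even J.card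
  · exact spinCoord_of_even u x hJ
  · refine h J ?_
    revert J
    decide

/-! ### The Jacobian matrix as polarization of the quadrics. -/

/-- Twice the polarization of the quadrics `g₀, …, g₉`. -/
def polar (t₀ t₁ : ℂ) (y c : Fin 7 → ℂ) : QuadSpace :=
  (![-t₀ * (y 1 * c 3 + c 1 * y 3) + t₁ * (y 0 * c 4 + c 0 * y 4),
    -(t₀ - t₁) * (y 0 * c 3 + c 0 * y 3) - t₁ * (y 2 * c 3 + c 2 * y 3)
      - (t₀ - t₁) * (2 * y 3 * c 3) + t₁ * (y 2 * c 4 + c 2 * y 4)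
      + (t₀ - t₁) * (y 3 * c 4 + c 3 * y 4) - (t₀ - t₁) * (y 3 * c 6 + c 3 * y 6),
    (t₀ - t₁) * (y 1 * c 3 + c 1 * y 3) + t₁ * (y 2 * c 3 + c 2 * y 3)
      - t₁ * (y 2 * c 4 + c 2 * y 4),
    t₀ * (y 2 * c 3 + c 2 * y 3) - t₁ * (y 2 * c 4 + c 2 * y 4)
      - (t₀ - t₁) * (y 3 * c 4 + c 3 * y 4) + (t₀ - t₁) * (y 3 * c 5 + c 3 * y 5),
    -t₁ * (y 0 * c 2 + c 0 * y 2) + t₁ * (y 1 * c 2 + c 1 * y 2)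
      - t₁ * (y 2 * c 3 + c 2 * y 3) + t₁ * (y 2 * c 4 + c 2 * y 4)],
  ![y 2 * c 6 + c 2 * y 6,
    y 1 * c 5 + c 1 * y 5,
    y 0 * c 5 + c 0 * y 5 + (y 3 * c 5 + c 3 * y 5) - (y 4 * c 5 + c 4 * y 5)
      + (y 4 * c 6 + c 4 * y 6),
    y 1 * c 6 + c 1 * y 6,
    y 3 * c 5 + c 3 * y 5 - (y 4 * c 5 + c 4 * y 5) + (y 4 * c 6 + c 4 * y 6)])

theorem polar_add (t₀ t₁ : ℂ) (y c d : Fin 7 → ℂ) :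
    polar t₀ t₁ y (c + d) = polar t₀ t₁ y c + polar t₀ t₁ y d := by
  refine Prod.ext (funext fun i => ?_) (funext fun i => ?_) <;> fin_cases i <;>
    simp [polar] <;> ring

theorem polar_smul (t₀ t₁ : ℂ) (y : Fin 7 → ℂ) (r : ℂ) (c : Fin 7 → ℂ) :
    polar t₀ t₁ y (r • c) = r • polar t₀ t₁ y c := by
  refine Prod.ext (funext fun i => ?_) (funext fun i => ?_) <;> fin_cases i <;>
    simp [polar] <;> ring

/-- The Jacobian matrix at `y`, as a linear map. -/
def polarMap (t₀ t₁ : ℂ) (y : Fin 7 → ℂ) : (Fin 7 → ℂ) →ₗ[ℂ] QuadSpace where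
  toFun := polar t₀ t₁ y
  map_add' := polar_add t₀ t₁ y
  map_smul' := polar_smul t₀ t₁ y

theorem jacobian_row (t₀ t₁ : ℂ) (y : Fin 7 → ℂ) (k : Fin 7) :
    ((fun j => eval y (pderiv k (gLow t₀ t₁ j)), fun j => eval y (pderiv k (gHigh j))) :
      QuadSpace) = polar t₀ t₁ y (Pi.single k 1) := by
  refine Prod.ext (funext fun i => ?_) (funext fun i => ?_) <;>
    fin_cases i <;> fin_cases k <;>
    simp [polar, gLow, gHigh, pderiv_X] <;> try ring

theorem jacobianRowSpace_eq_range (t₀ t₁ : ℂ) (y : Fin 7 → ℂ) :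
    jacobianRowSpace t₀ t₁ y = LinearMap.range (polarMap t₀ t₁ y) := by
  have hbasis := (Pi.basisFun ℂ (Fin 7)).span_eq
  rw [LinearMap.range_eq_map, ← hbasis, Submodule.map_span, ← Set.range_comp]
  unfold jacobianRowSpace
  congr 2
  funext k
  rw [jacobian_row]
  simp [polarMap]

/-- Some $y_j$ is nonzero, so a form $l$ vanishes as soon as all seven products $y_jl$ do. The
constant `D` clears the denominators of the certificates. -/
theorem eq_zero_of_forall_mul_eq_zero {y : Fin 7 → ℂ} (hy : y ≠ 0) {D l : ℂ} (hD : D ≠ 0)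
    (h₀ : D * (y 0 * l) = 0) (h₁ : D * (y 1 * l) = 0) (h₂ : D * (y 2 * l) = 0)
    (h₃ : D * (y 3 * l) = 0) (h₄ : D * (y 4 * l) = 0) (h₅ : D * (y 5 * l) = 0)
    (h₆ : D * (y 6 * l) = 0) : l = 0 := by
  by_contra hl
  refine hy (funext fun j => ?_)
  simp only [mul_eq_zero, hD, hl, false_or, or_false] at h₀ h₁ h₂ h₃ h₄ h₅ h₆
  fin_cases j <;> assumption

/-- The linear coordinates on `ℙ⁶` recovered from a half spinor. -/
def spinInverse (t₁ : ℂ) (X : Finset (Fin 5) → ℂ) : Fin 7 → ℂ :=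
  ![-X {2, 3} - X {3, 4}, -X {1, 3}, X {0, 1}, X {3, 4} - X {1, 4}, -X {1, 4},
    -t₁ * X {0, 1, 2, 4}, t₁ * X {0, 2, 3, 4}]

set_option maxHeartbeats 4000000 in
/-- A half spinor of a Lagrangian spanned by the rows of the Jacobian matrix at `y` lies in the
linear space `P_t`, and its linear coordinates are proportional to `y`. -/
theorem linear_equations_of_annihilated {t₀ t₁ : ℂ} (ht₀ : t₀ ≠ 0) (ht₁ : t₁ ≠ 0)
    (hd : t₀ - t₁ ≠ 0) {y : Fin 7 → ℂ} (hy : y ≠ 0) {x : SpinIdx → ℂ} {X : Finset (Fin 5) → ℂ}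
    (hX : X = extendSpin x) (H : ∀ c J, spinCoord (polar t₀ t₁ y c) x J = 0) :
    (X {0, 1, 3, 4} = 0 ∧ X {0, 1, 2, 3} = 0 ∧ X {1, 2, 3, 4} = 0 ∧ X {0, 3} = 0 ∧
      X {0, 1} - X {0, 2} = 0 ∧ X {1, 2} - X {1, 4} = 0 ∧
      X ∅ + t₁ * X {1, 4} - t₁ * X {2, 4} - t₁ * X {3, 4} = 0 ∧
      X {0, 4} + X {1, 4} - X {2, 4} - X {3, 4} = 0 ∧
      t₀ * X {1, 4} - t₁ * X {2, 4} - t₀ * X {3, 4} = 0) ∧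
    ∀ i j, y i * spinInverse t₁ X j = y j * spinInverse t₁ X i := by
  -- The names record the coordinate with indices starting at 1: `h134` belongs to the set `{0, 2,
  -- 3}`. The seven arguments are a direction `c`; below they are always a unit vector, which
  -- selects one row of the Jacobian matrix.
  have h1 := fun c0 c1 c2 c3 c4 c5 c6 : ℂ => (spinCoord_0 _ x).symm.trans
    (H ![c0, c1, c2, c3, c4, c5, c6] _)
  have h2 := fun c0 c1 c2 c3 c4 c5 c6 : ℂ => (spinCoord_1 _ x).symm.trans
    (H ![c0, c1, c2, c3, c4, c5, c6] _)
  have h3 := fun c0 c1 c2 c3 c4 c5 c6 : ℂ => (spinCoord_2 _ x).symm.trans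
    (H ![c0, c1, c2, c3, c4, c5, c6] _)
  have h4 := fun c0 c1 c2 c3 c4 c5 c6 : ℂ => (spinCoord_3 _ x).symm.trans
    (H ![c0, c1, c2, c3, c4, c5, c6] _)
  have h5 := fun c0 c1 c2 c3 c4 c5 c6 : ℂ => (spinCoord_4 _ x).symm.trans
    (H ![c0, c1, c2, c3, c4, c5, c6] _)
  have h123 := fun c0 c1 c2 c3 c4 c5 c6 : ℂ => (spinCoord_012 _ x).symm.trans
    (H ![c0, c1, c2, c3, c4, c5, c6] _)
  have h124 := fun c0 c1 c2 c3 c4 c5 c6 : ℂ => (spinCoord_013 _ x).symm.trans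
    (H ![c0, c1, c2, c3, c4, c5, c6] _)
  have h125 := fun c0 c1 c2 c3 c4 c5 c6 : ℂ => (spinCoord_014 _ x).symm.trans
    (H ![c0, c1, c2, c3, c4, c5, c6] _)
  have h134 := fun c0 c1 c2 c3 c4 c5 c6 : ℂ => (spinCoord_023 _ x).symm.trans
    (H ![c0, c1, c2, c3, c4, c5, c6] _)
  have h135 := fun c0 c1 c2 c3 c4 c5 c6 : ℂ => (spinCoord_024 _ x).symm.trans
    (H ![c0, c1, c2, c3, c4, c5, c6] _)
  have h145 := fun c0 c1 c2 c3 c4 c5 c6 : ℂ => (spinCoord_034 _ x).symm.trans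
    (H ![c0, c1, c2, c3, c4, c5, c6] _)
  have h234 := fun c0 c1 c2 c3 c4 c5 c6 : ℂ => (spinCoord_123 _ x).symm.trans
    (H ![c0, c1, c2, c3, c4, c5, c6] _)
  have h235 := fun c0 c1 c2 c3 c4 c5 c6 : ℂ => (spinCoord_124 _ x).symm.trans
    (H ![c0, c1, c2, c3, c4, c5, c6] _)
  have h245 := fun c0 c1 c2 c3 c4 c5 c6 : ℂ => (spinCoord_134 _ x).symm.trans
    (H ![c0, c1, c2, c3, c4, c5, c6] _)
  have h345 := fun c0 c1 c2 c3 c4 c5 c6 : ℂ => (spinCoord_234 _ x).symm.trans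
    (H ![c0, c1, c2, c3, c4, c5, c6] _)
  have h12345 := fun c0 c1 c2 c3 c4 c5 c6 : ℂ => (spinCoord_01234 _ x).symm.trans
    (H ![c0, c1, c2, c3, c4, c5, c6] _)
  simp only [polar, ← hX, Matrix.cons_val]
    at h1 h2 h3 h4 h5 h123 h124 h125 h134 h135 h145 h234 h235 h245 h345 h12345
  clear H hX
  -- Each certificate writes $D\,y_jl$ as a combination of the annihilation equations and of
  -- multiples of the forms already shown to vanish, so the order of the nine forms matters.
  have k1245 : X {0, 1, 3, 4} = 0 := by
    apply eq_zero_of_forall_mul_eq_zero hy (mul_ne_zero hd ht₁)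
    · linear_combination (-t₁ ^ 2 + t₀ * t₁) * h12345 0 0 0 1 0 0 0 + (-t₁ + t₀) * h234 0 0 0 0 1
        0 0 + (-t₁ ^ 2 + t₀ * t₁) * h12345 0 0 0 0 1 0 0 + (-t₁ + t₀) * h245 0 0 0 0 1 0 0 + (-t₁) *
        h134 0 0 0 0 1 0 0 + (-t₁) * h145 0 0 0 0 1 0 0 + (-t₁ ^ 2 + t₀ * t₁) * h12345 0 0 0 0 0 1 0 +
        (-t₁) * h134 0 0 0 1 0 0 0 + (-t₁) * h145 0 0 0 1 0 0 0
    · linear_combination (t₁ - t₀) * h245 1 0 0 0 0 0 0 + t₁ * h124 0 0 0 0 1 0 0 + (t₁ - t₀) *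
        h234 1 0 0 0 0 0 0 + (-t₁ + t₀) * h245 0 0 0 0 1 0 0 + (-t₁) * h145 0 0 0 0 1 0 0 + (-t₁) *
        h134 0 0 0 0 1 0 0 + (t₁ - t₀) * h124 0 0 1 0 0 0 0
    · linear_combination (-t₁ + t₀) * h124 1 0 0 0 0 0 0
    · linear_combination t₁ * h145 1 0 0 0 0 0 0
    · linear_combination (-t₁ + t₀) * h245 1 0 0 0 0 0 0
    · linear_combination (-t₁ ^ 2 + t₀ * t₁) * h12345 1 0 0 0 0 0 0
    · linear_combination (-t₁) * h124 1 0 0 0 0 0 0 + (-t₁) * h145 1 0 0 0 0 0 0 + t₀ * h124 0 0 0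
        0 1 0 0 + t₁ * h134 1 0 0 0 0 0 0 + (t₁ - t₀) * h234 1 0 0 0 0 0 0 + t₀ * h124 0 0 0 1 0 0 0 +
        (-t₁ + t₀) * h234 0 0 0 1 0 0 0 + (t₁ ^ 2 - t₀ * t₁) * h12345 0 0 0 0 0 1 0 + t₁ * h145 0 0 0
        1 0 0 0
  have k1234 : X {0, 1, 2, 3} = 0 := by
    apply eq_zero_of_forall_mul_eq_zero hy (mul_ne_zero hd ht₁)
    · linear_combination (t₁ ^ 2 - t₀ * t₁) * y 0 * k1245 + (-t₁ + t₀) * h245 0 0 0 0 1 0 0 + (-t₁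
        + t₀) * h234 0 0 0 0 1 0 0
    · linear_combination t₁ * h124 0 0 0 0 1 0 0 + t₁ * h124 0 0 0 1 0 0 0
    · linear_combination (t₁ ^ 2 - t₀ * t₁) * y 2 * k1245 + (t₁ - t₀) * h124 0 0 0 0 1 0 0
    · linear_combination (t₁ ^ 2 - t₀ * t₁) * y 3 * k1245 + t₁ * h124 0 0 0 0 1 0 0 + (-t₁) * h145
        0 0 0 0 1 0 0 + (-t₁) * h134 0 0 0 0 1 0 0
    · linear_combination (-t₀) * h124 0 0 0 0 1 0 0 + (t₁ - t₀) * h234 0 0 0 1 0 0 0 + (-t₀) *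
        h124 0 0 0 1 0 0 0 + (-t₁ + t₀) * h234 1 0 0 0 0 0 0
    · linear_combination (t₁ ^ 2 - t₀ * t₁) * y 5 * k1245 + (-t₁ ^ 2 + t₀ * t₁) * h12345 0 0 0 1 0
        0 0
    · linear_combination (t₁ ^ 2 - t₀ * t₁) * y 6 * k1245 + (-t₁ ^ 2 + t₀ * t₁) * h12345 0 0 0 1 0
        0 0 + (-t₁ ^ 2 + t₀ * t₁) * h12345 0 0 0 0 1 0 0
  have k2345 : X {1, 2, 3, 4} = 0 := by
    apply eq_zero_of_forall_mul_eq_zero hy (mul_ne_zero hd ht₁)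
    · linear_combination (-t₀ * t₁) * y 1 * k1245 + (-t₀ * t₁) * y 1 * k1234 + (-t₁ + t₀) * h245 0
        0 1 0 0 0 0 + (-t₁) * h234 0 0 0 1 0 0 0 + (-t₁ + t₀) * h234 0 0 1 0 0 0 0 + (-t₁) * h245 0 0
        0 1 0 0 0
    · linear_combination (-t₀ * t₁) * y 1 * k1245 + (-t₀ * t₁) * y 1 * k1234 + (-t₁) * h234 0 0 0
        1 0 0 0 + (-t₁) * h245 0 0 0 1 0 0 0
    · linear_combination (-t₀ * t₁) * y 2 * k1245 + (t₁ ^ 2 - t₀ * t₁) * y 5 * k1245 + (t₁ ^ 2 -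
        t₀ * t₁) * y 4 * k1234 + (-t₁) * h123 1 0 0 0 0 0 0 + (-t₁ ^ 2 + t₀ * t₁) * h12345 0 0 0 0 0 0
        1 + t₁ * h125 0 0 0 1 0 0 0
    · linear_combination t₁ * h235 0 0 1 0 0 0 0 + t₁ * h245 0 0 1 0 0 0 0
    · linear_combination t₁ * h235 0 0 1 0 0 0 0 + t₀ * h245 0 0 1 0 0 0 0
    · linear_combination (-t₀ * t₁) * y 3 * k1245 + t₀ * t₁ * y 4 * k1245 + (-t₀ * t₁) * y 3 *
        k1234 + t₀ * t₁ * y 4 * k1234 + 2 * t₁ * h235 0 0 1 0 0 0 0 + (t₁ + t₀) * h245 0 0 1 0 0 0 0 +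
        (t₁ ^ 2 - t₀ * t₁) * h12345 0 0 0 0 0 0 1 + t₁ * h125 0 0 1 0 0 0 0 + t₁ * h235 0 0 0 1 0 0 0
        + t₁ * h235 0 0 0 0 1 0 0 + (-t₁) * h123 0 0 1 0 0 0 0
    · linear_combination (-t₁ ^ 2 + t₀ * t₁) * h12345 0 0 1 0 0 0 0
  have k14 : X {0, 3} = 0 := by
    apply eq_zero_of_forall_mul_eq_zero hy hd
    · linear_combination (t₁ - t₀) * h145 0 0 0 0 0 1 0 + (t₁ - t₀) * h134 0 0 0 0 0 1 0
    · linear_combination (t₁ - t₀) * h124 0 0 0 0 0 1 0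
    · linear_combination (-t₁ ^ 2 + t₀ * t₁) * y 2 * k1245 + (-2) * h1 0 0 0 0 0 1 0 + (t₁ - t₀) *
        h145 0 0 0 0 0 1 0 + (-t₁ + t₀) * h124 0 1 0 0 0 0 0 + (-t₁ + t₀) * h123 0 0 0 0 0 1 0 + (-1)
        * h1 0 0 0 0 1 0 0 + (-1) * h1 0 0 0 1 0 0 0
    · linear_combination (-1) * h1 0 0 0 0 0 1 0
    · linear_combination (-1) * h1 0 0 0 0 0 1 0 + (t₁ - t₀) * h145 0 0 0 0 0 1 0
    · linear_combination (t₁ ^ 2 - t₀ * t₁) * y 2 * k1245 + (t₁ ^ 2 - t₀ * t₁) * y 2 * k1234 +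
        (-t₁ + t₀) * h123 1 0 0 0 0 0 0 + (t₁ - t₀) * h124 0 1 0 0 0 0 0 + (-t₁ + t₀) * h123 0 0 0 0 1
        0 0
    · linear_combination (t₁ ^ 2 - t₀ * t₁) * y 2 * k1234 + (t₁ - t₀) * h134 1 0 0 0 0 0 0 + (t₁ -
        t₀) * h134 0 0 0 0 1 0 0
  have k12 : X {0, 1} - X {0, 2} = 0 := by
    apply eq_zero_of_forall_mul_eq_zero hy (mul_ne_zero hd ht₁)
    · linear_combination (-t₁ ^ 2 + t₀ * t₁) * y 0 * k14 + (-t₀ * t₁ + t₀ ^ 2) * y 3 * k14 + (-t₀)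
        * h1 0 1 0 0 0 0 0 + (-t₁ + t₀) * h3 0 1 0 0 0 0 0 + (-t₀) * h1 1 0 0 0 0 0 0 + (-t₁ + t₀) *
        h4 0 1 0 0 0 0 0 + (t₁ - t₀) * h2 0 1 0 0 0 0 0 + (-t₁ + t₀) * h2 0 0 0 0 1 0 0 + (t₁ - t₀) *
        h4 0 0 0 0 1 0 0 + (t₁ - t₀) * h3 0 0 0 0 1 0 0
    · linear_combination (t₁ ^ 3 - 2 * t₀ * t₁ ^ 2 + t₀ ^ 2 * t₁) * y 3 * k1234 + (-t₁ ^ 2 + t₀ *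
        t₁) * y 0 * k14 + (-t₁ ^ 2 + t₀ * t₁) * h124 0 0 0 0 0 0 1 + (t₁ - t₀) * h4 1 0 0 0 0 0 0 +
        (t₁ ^ 2 - t₀ * t₁) * h134 0 0 0 0 0 0 1 + (t₁ - t₀) * h4 0 0 0 0 1 0 0
    · linear_combination (-t₁ ^ 2 + t₀ * t₁) * y 2 * k14 + (t₁ ^ 2 - 2 * t₀ * t₁ + t₀ ^ 2) * y 3 *
        k14 + (t₁ - t₀) * h1 1 0 0 0 0 0 0 + (t₁ - t₀) * h1 0 0 0 0 1 0 0
    · linear_combination t₁ * h1 1 0 0 0 0 0 0 + t₁ * h1 0 1 0 0 0 0 0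
    · linear_combination t₀ * h1 1 0 0 0 0 0 0 + (-t₁ ^ 2 + t₀ * t₁) * h125 0 0 0 0 0 0 1 + t₀ *
        h1 0 1 0 0 0 0 0 + (t₁ - t₀) * h3 0 1 0 0 0 0 0 + (-t₁ + t₀) * h2 0 1 0 0 0 0 0 + (t₁ - t₀) *
        h3 1 0 0 0 0 0 0
    · linear_combination (-t₁ ^ 2 + t₀ * t₁) * h123 0 1 0 0 0 0 0 + (-t₁ ^ 2 + t₀ * t₁) * h123 1 0
        0 0 0 0 0
    · linear_combination (-t₁ ^ 3 + t₀ * t₁ ^ 2) * y 2 * k1245 + (t₁ ^ 2 - t₀ * t₁) * h134 0 1 0 0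
        0 0 0 + (t₁ ^ 2 - t₀ * t₁) * h134 1 0 0 0 0 0 0 + (-t₁ ^ 2 + t₀ * t₁) * h124 0 1 0 0 0 0 0
  have k23 : X {1, 2} - X {1, 4} = 0 := by
    apply eq_zero_of_forall_mul_eq_zero hy hd
    · linear_combination (t₁ ^ 2 - t₀ * t₁) * y 2 * k2345 + (-t₁) * h123 0 0 0 0 0 0 1 + (-t₁ +
        t₀) * h235 0 0 0 0 0 0 1 + t₁ * h125 0 0 0 0 0 0 1 + 2 * h3 0 0 0 0 0 0 1 + (-2) * h5 0 0 0 0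
        0 0 1 + (t₁ - t₀) * h245 0 1 0 0 0 0 0 + (-t₀) * h134 0 0 0 0 0 0 1 + (-t₁ + t₀) * h345 0 0 0
        0 0 0 1 + (-t₀) * h145 0 0 0 0 0 0 1 + (t₁ - t₀) * h234 0 1 0 0 0 0 0 + (-1) * h3 0 0 0 1 0 0
        0 + h5 0 0 0 1 0 0 0
    · linear_combination (-t₁ + t₀) * h245 0 0 0 0 0 0 1 + (-t₁ + t₀) * h234 0 0 0 0 0 0 1
    · linear_combination (-t₁ + t₀) * h123 0 0 0 0 0 0 1 + (t₁ - t₀) * h125 0 0 0 0 0 0 1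
    · linear_combination (-1) * h3 0 0 0 0 0 0 1 + h5 0 0 0 0 0 0 1
    · linear_combination (-t₁ + t₀) * h235 0 0 0 0 0 0 1
    · linear_combination (-t₀ * t₁ + t₀ ^ 2) * y 4 * k1245 + (-t₀ * t₁ + t₀ ^ 2) * y 4 * k1234 +
        (t₁ ^ 2 - 2 * t₀ * t₁ + t₀ ^ 2) * y 4 * k2345 + (-t₁ ^ 2 + 2 * t₀ * t₁ - t₀ ^ 2) * y 5 * k2345
        + (t₀ * t₁ - t₀ ^ 2) * h12345 0 0 0 0 0 0 1 + (-t₁ + t₀) * h235 0 0 0 1 0 0 0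
    · linear_combination (t₁ ^ 2 - t₀ * t₁) * y 0 * k1245 + (-t₀ * t₁ + t₀ ^ 2) * y 3 * k1245 +
        (-t₀ * t₁ + t₀ ^ 2) * y 3 * k1234 + (-t₁ + t₀) * h245 0 1 0 0 0 0 0 + (-t₁ + t₀) * h234 0 1 0
        0 0 0 0 + (t₁ - t₀) * h145 0 0 1 0 0 0 0 + (-t₁ ^ 2 + t₀ * t₁) * h12345 0 0 0 0 0 1 0 + (t₁ -
        t₀) * h134 0 0 1 0 0 0 0 + (-t₁ + t₀) * h345 0 0 0 0 1 0 0
  have k0 : X ∅ + t₁ * X {1, 4} - t₁ * X {2, 4} - t₁ * X {3, 4} = 0 := by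
    apply eq_zero_of_forall_mul_eq_zero hy hd
    · linear_combination (t₁ ^ 3 - 2 * t₀ * t₁ ^ 2 + t₀ ^ 2 * t₁) * y 3 * k2345 + (t₁ - t₀) * h5 0
        0 0 0 0 1 0 + (-t₁ + t₀) * h3 0 0 0 0 0 1 0 + (t₁ ^ 2 - t₀ * t₁) * h345 0 0 0 0 0 1 0 + (-t₁ +
        t₀) * h5 0 0 1 0 0 0 0 + (t₁ ^ 2 - t₀ * t₁) * h235 0 0 0 0 0 1 0 + (t₁ - t₀) * h3 0 0 1 0 0 0
        0
    · linear_combination (t₁ ^ 3 - 2 * t₀ * t₁ ^ 2 + t₀ ^ 2 * t₁) * y 3 * k2345 + (-t₁ + t₀) * h4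
        0 0 0 0 0 0 1 + (t₁ ^ 2 - t₀ * t₁) * h245 0 0 0 0 0 1 0 + (t₁ ^ 2 - t₀ * t₁) * h235 0 0 0 0 0
        1 0 + (t₁ - t₀) * h2 0 0 1 0 0 0 0
    · linear_combination (-t₁ ^ 2 + t₀ * t₁) * y 4 * k14 + (t₀ * t₁ - t₀ ^ 2) * y 3 * k12 + (-t₁ +
        t₀) * h1 0 0 0 0 0 0 1 + (-t₁ + t₀) * h2 1 0 0 0 0 0 0 + (-t₁ + t₀) * h3 0 1 0 0 0 0 0 + (-t₁
        ^ 2 + t₀ * t₁) * h125 0 0 0 0 0 1 0 + (t₁ ^ 2 - t₀ * t₁) * h145 0 0 0 0 0 0 1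
    · linear_combination (t₀ * t₁ ^ 2 - t₀ ^ 2 * t₁) * y 3 * k1245 + (-t₀ ^ 2) * y 3 * k14 + t₀ *
        t₁ * y 3 * k12 + (t₁ ^ 2 - 3 * t₀ * t₁ + 2 * t₀ ^ 2) * y 3 * k23 + (-t₀) * h5 1 0 0 0 0 0 0 +
        (-t₁) * h5 0 1 0 0 0 0 0 + (-t₀) * h2 1 0 0 0 0 0 0 + (-t₁ + t₀) * h3 0 0 0 0 0 0 1 + (-t₁ +
        t₀) * h5 0 0 0 0 0 1 0 + t₀ * t₁ * h145 0 0 0 0 0 0 1 + t₀ * h3 1 0 0 0 0 0 0 + t₀ * h5 0 0 0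
        0 1 0 0 + (-t₀) * h1 0 0 1 0 0 0 0
    · linear_combination (t₀ * t₁ ^ 2 - t₀ ^ 2 * t₁) * y 3 * k1245 + (-t₀ ^ 2) * y 3 * k14 + t₀ *
        t₁ * y 3 * k12 + (t₁ ^ 2 - 3 * t₀ * t₁ + 2 * t₀ ^ 2) * y 3 * k23 + (-t₀) * h5 1 0 0 0 0 0 0 +
        (-t₁) * h5 0 1 0 0 0 0 0 + (-t₀) * h2 1 0 0 0 0 0 0 + (-t₁ + t₀) * h3 0 0 0 0 0 0 1 + t₀ * t₁
        * h145 0 0 0 0 0 0 1 + t₀ * h3 1 0 0 0 0 0 0 + (-t₁ + t₀) * h5 0 0 1 0 0 0 0 + t₀ * h5 0 0 0 0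
        1 0 0 + (-t₀) * h1 0 0 1 0 0 0 0
    · linear_combination (t₁ ^ 3 - t₀ * t₁ ^ 2) * y 4 * k1245 + (-t₁ ^ 3 + 2 * t₀ * t₁ ^ 2 - t₀ ^
        2 * t₁) * y 3 * k2345 + (t₁ ^ 2 - 2 * t₀ * t₁ + t₀ ^ 2) * y 3 * k23 + (t₁ ^ 2 - t₀ * t₁) *
        h235 1 0 0 0 0 0 0 + (t₁ ^ 2 - t₀ * t₁) * h235 0 1 0 0 0 0 0 + (t₁ - t₀) * h5 1 0 0 0 0 0 0 +
        (-t₁ + t₀) * h3 1 0 0 0 0 0 0 + (t₁ ^ 2 - t₀ * t₁) * h135 0 0 0 0 0 0 1 + (t₁ ^ 2 - t₀ * t₁) *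
        h245 0 1 0 0 0 0 0 + (t₁ ^ 2 - t₀ * t₁) * h125 0 0 1 0 0 0 0
    · linear_combination (-t₀ * t₁ + t₀ ^ 2) * y 3 * k14 + (t₁ ^ 2 - t₀ * t₁) * y 4 * k14 + (t₁ ^
        2 - t₀ * t₁) * h125 0 0 0 0 0 1 0 + (t₁ ^ 2 - t₀ * t₁) * h135 0 0 1 0 0 0 0 + (-t₁ ^ 2 + t₀ *
        t₁) * h125 0 0 1 0 0 0 0 + (-t₁ ^ 2 + t₀ * t₁) * h135 0 0 0 0 0 1 0 + (t₁ ^ 2 - t₀ * t₁) *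
        h145 0 0 1 0 0 0 0 + (-t₁ + t₀) * h1 0 0 1 0 0 0 0
  have k15 : X {0, 4} + X {1, 4} - X {2, 4} - X {3, 4} = 0 := by
    apply eq_zero_of_forall_mul_eq_zero hy (mul_ne_zero ht₀ ht₁)
    · linear_combination (-t₀ ^ 2) * y 3 * k14 + t₀ * t₁ * y 4 * k12 + (-t₀ * t₁ + t₀ ^ 2) * y 3 *
        k23 + t₀ * y 0 * k0 + (-t₀ * t₁) * h125 0 0 0 0 0 0 1 + t₀ * h5 0 0 0 0 0 1 0 + (-t₀) * h4 0 1
        0 0 0 0 0 + t₀ * h3 1 0 0 0 0 0 0 + (-t₀) * h3 0 0 0 0 0 1 0 + t₀ * h5 0 0 0 0 1 0 0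
    · linear_combination (-t₀ * t₁ ^ 2 + t₀ ^ 2 * t₁) * y 3 * k1245 + t₀ * y 1 * k0 + (-t₀) * h4 0
        0 0 0 0 0 1 + t₀ * h4 1 0 0 0 0 0 0 + (-t₀ * t₁) * h145 0 0 0 0 0 0 1
    · linear_combination t₀ * y 2 * k0 + t₀ * h1 1 0 0 0 0 0 0 + (-t₀) * h1 0 0 0 0 0 0 1
    · linear_combination t₁ * y 3 * k0 + (-t₁) * h5 0 0 0 0 0 0 1 + (-t₁) * h5 0 1 0 0 0 0 0 +
        (-t₁) * h5 0 0 0 0 0 1 0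
    · linear_combination t₀ * y 4 * k0 + t₀ * h5 1 0 0 0 0 0 0 + (-t₀) * h5 0 0 0 0 0 0 1
    · linear_combination (t₀ * t₁ - t₀ ^ 2) * y 3 * k23 + t₀ * y 5 * k0 + t₀ * h5 1 0 0 0 0 0 0 +
        (-t₀ * t₁) * h125 0 1 0 0 0 0 0 + (-t₀) * h3 1 0 0 0 0 0 0 + t₀ * t₁ * h135 0 0 0 0 0 0 1
    · linear_combination (t₀ * t₁ ^ 2 - t₀ ^ 2 * t₁) * y 3 * k1245 + (-t₀ * t₁) * h145 0 1 0 0 0 0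
        0 + (-t₀ * t₁) * h135 0 0 1 0 0 0 0 + t₀ * t₁ * h125 0 0 1 0 0 0 0 + (-t₀ * t₁) * h145 0 0 1 0
        0 0 0
  have k35 : t₀ * X {1, 4} - t₁ * X {2, 4} - t₀ * X {3, 4} = 0 := by
    apply eq_zero_of_forall_mul_eq_zero hy ht₁
    · linear_combination (-t₁ ^ 2 + t₀ * t₁) * y 3 * k23 + (t₁ ^ 2 - t₀ * t₁) * y 4 * k23 + t₁ * y
        0 * k0 + t₁ * h5 0 0 0 0 0 1 0 + (-t₁) * h3 0 0 0 0 0 1 0 + (t₁ ^ 2 - t₀ * t₁) * h345 0 0 0 0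
        0 0 1 + (t₁ ^ 2 - t₀ * t₁) * h345 0 0 0 0 0 1 0 + (t₁ ^ 2 - t₀ * t₁) * h235 0 0 0 0 0 1 0
    · linear_combination t₁ * y 1 * k0 + (t₁ ^ 2 - t₀ * t₁) * h245 0 0 0 0 0 0 1 + (-t₁) * h4 0 0
        0 0 0 0 1 + (t₁ ^ 2 - t₀ * t₁) * h245 0 0 0 0 0 1 0
    · linear_combination t₀ * t₁ * y 2 * k15 + (t₁ - t₀) * h3 0 1 0 0 0 0 0 + t₀ * h1 0 1 0 0 0 0
        0
    · linear_combination t₀ * t₁ * y 3 * k15 + t₁ * h5 0 1 0 0 0 0 0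
    · linear_combination t₀ * t₁ * y 4 * k14 + (-t₁ ^ 2) * y 4 * k12 + (t₁ ^ 2 - t₀ * t₁) * y 4 *
        k23 + t₁ * y 4 * k0 + t₁ ^ 2 * h125 0 0 0 0 0 0 1 + (-t₀ * t₁) * h145 0 0 0 0 0 0 1 + (-t₁) *
        h5 0 0 0 0 0 0 1 + (-t₁) * h3 1 0 0 0 0 0 0 + (t₁ ^ 2 - t₀ * t₁) * h245 0 1 0 0 0 0 0 + (t₁ ^
        2 - t₀ * t₁) * h235 0 0 0 0 0 1 0 + t₁ * h5 0 0 0 1 0 0 0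
    · linear_combination t₀ * t₁ * y 5 * k15 + t₀ * t₁ * h125 0 1 0 0 0 0 0 + (-t₁ ^ 2 + t₀ * t₁)
        * h235 0 1 0 0 0 0 0
    · linear_combination t₀ * t₁ * y 6 * k15 + t₀ * t₁ * h145 0 1 0 0 0 0 0 + (t₁ ^ 2 - t₀ * t₁) *
        h345 0 1 0 0 0 0 0
  refine ⟨⟨k1245, k1234, k2345, k14, k12, k23, k0, k15, k35⟩, ?_⟩
  -- Proportionality means that the $2\times2$ minors of the two rows vanish; by antisymmetry one
  -- ordering of the indices suffices.
  have key : ∀ i j, j < i → y i * spinInverse t₁ X j = y j * spinInverse t₁ X i := by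
    intro i j hij
    fin_cases i <;> fin_cases j <;> first | exact absurd hij (by decide) | skip
    all_goals simp only [spinInverse, Fin.reduceFinMk, Fin.zero_eta, Fin.mk_one, Matrix.cons_val]
    · linear_combination (-1) * h245 0 0 0 0 0 1 0 + (-1) * h234 0 0 0 0 0 1 0
    · refine mul_left_cancel₀ ht₁ ?_
      linear_combination (-t₁) * y 0 * k14 + t₁ * y 2 * k23 + (-1) * h2 0 0 0 0 1 0 0 + h4 0 0 0 0
          1 0 0
    · linear_combination (-1) * h124 0 0 0 0 0 0 1
    · refine mul_left_cancel₀ hd ?_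
      linear_combination (-1) * y 0 * k0 + y 0 * k35 + (-1) * h5 0 0 0 0 0 1 0 + h3 0 0 0 0 0 1 0
    · linear_combination (-1) * h245 0 0 0 0 0 0 1 + (-1) * h245 0 0 0 0 0 1 0
    · refine mul_left_cancel₀ hd ?_
      linear_combination (-t₁) * y 2 * k15 + y 2 * k35 + h1 1 0 0 0 0 0 0
    · linear_combination y 3 * k23 + (-1) * y 4 * k23 + (-1) * h345 0 0 0 0 0 0 1 + (-1) * h235 0
        0 0 0 0 1 0
    · linear_combination (-1) * h245 0 0 0 0 0 0 1
    · refine mul_left_cancel₀ ht₁ ?_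
      linear_combination h2 1 0 0 0 0 0 0
    · refine mul_left_cancel₀ hd ?_
      linear_combination y 4 * k0 + (-1) * y 4 * k35 + (-1) * h5 0 0 0 0 0 0 1
    · linear_combination (-t₀) * y 3 * k1245 + (-t₀) * y 3 * k1234 + y 5 * k23 + (-1) * h245 0 1 0
        0 0 0 0 + (-1) * h234 0 1 0 0 0 0 0 + h235 0 0 0 0 1 0 0
    · linear_combination t₁ * y 4 * k1245 + h234 1 0 0 0 0 0 0 + (-t₁) * h12345 0 0 0 0 0 0 1
    · linear_combination h123 1 0 0 0 0 0 0
    · refine mul_left_cancel₀ ht₀ ?_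
      linear_combination (-1) * y 5 * k35 + (-t₁) * h235 0 1 0 0 0 0 0
    · linear_combination h235 1 0 0 0 0 0 0
    · linear_combination (-t₁) * y 0 * k1245 + (-1) * h145 0 0 1 0 0 0 0 + t₁ * h12345 0 0 0 0 0 1
        0 + (-1) * h134 0 0 1 0 0 0 0
    · linear_combination (-t₁) * y 1 * k1245 + (-1) * h124 0 0 1 0 0 0 0 + t₁ * h12345 0 0 0 0 0 1
        0
    · linear_combination y 6 * k12 + h134 0 1 0 0 0 0 0
    · refine mul_left_cancel₀ ht₀ ?_
      linear_combination (-1) * y 6 * k35 + t₁ * h345 0 1 0 0 0 0 0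
    · linear_combination t₀ * y 3 * k1245 + (-1) * h345 1 0 0 0 0 0 0 + h245 0 1 0 0 0 0 0
    · linear_combination t₁ * h12345 0 1 0 0 0 0 0
  intro i j
  rcases lt_trichotomy i j with h | rfl | h
  · exact (key j i h).symm
  · rfl
  · exact key i j h

/-! ### The parametrized curves `X_t` -/

/-- The linear embedding of `ℙ⁶` onto `P_t` that maps (rescaled) points of the curve to their half
spinors. -/
def spinVec {R : Type*} [CommRing R] (t₀ t₁ : R) (z : Fin 7 → R) (I : SpinIdx) : R :=
  if I.1 = ∅ then -(t₀ - t₁) * t₁ * z 3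
  else if I.1 = {0, 1} then z 2
  else if I.1 = {0, 2} then z 2
  else if I.1 = {0, 4} then -(t₀ - t₁) * z 3
  else if I.1 = {1, 2} then -z 4
  else if I.1 = {1, 4} then -z 4
  else if I.1 = {1, 3} then -z 1
  else if I.1 = {2, 3} then -z 0 - t₁ * z 3 + z 4
  else if I.1 = {2, 4} then -t₀ * z 3
  else if I.1 = {3, 4} then t₁ * z 3 - z 4
  else if I.1 = {0, 1, 2, 4} then -z 5
  else if I.1 = {0, 2, 3, 4} then z 6
  else 0

theorem map_spinVec {R S : Type*} [CommRing R] [CommRing S] (f : R →+* S) (t₀ t₁ : R)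
    (z : Fin 7 → R) (I : SpinIdx) :
    f (spinVec t₀ t₁ z I) = spinVec (f t₀) (f t₁) (fun i => f (z i)) I := by
  unfold spinVec
  simp only [apply_ite f, map_mul, map_neg, map_sub, map_add, map_zero]

theorem spinIdx_mem : ∀ I : SpinIdx, I.1 ∈ [∅, {0, 1}, {0, 2}, {0, 3}, {0, 4}, {1, 2}, {1, 3},
    {1, 4}, {2, 3}, {2, 4}, {3, 4}, {0, 1, 2, 3}, {0, 1, 2, 4}, {0, 1, 3, 4}, {0, 2, 3, 4},
    ({1, 2, 3, 4} : Finset (Fin 5))] := by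
  decide

theorem spin_ext {x x' : SpinIdx → ℂ} (h : ∀ I ∈ [∅, {0, 1}, {0, 2}, {0, 3}, {0, 4}, {1, 2},
    {1, 3}, {1, 4}, {2, 3}, {2, 4}, {3, 4}, {0, 1, 2, 3}, {0, 1, 2, 4}, {0, 1, 3, 4},
    {0, 2, 3, 4}, ({1, 2, 3, 4} : Finset (Fin 5))], extendSpin x I = extendSpin x' I) :
    x = x' := by
  funext I
  simpa [extendSpin, I.2] using h I.1 (spinIdx_mem I)

theorem extendSpin_spinVec (t₀ t₁ : ℂ) (z : Fin 7 → ℂ) :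
    extendSpin (spinVec t₀ t₁ z) ∅ = -(t₀ - t₁) * t₁ * z 3 ∧
    extendSpin (spinVec t₀ t₁ z) {0, 1} = z 2 ∧
    extendSpin (spinVec t₀ t₁ z) {0, 2} = z 2 ∧
    extendSpin (spinVec t₀ t₁ z) {0, 3} = 0 ∧
    extendSpin (spinVec t₀ t₁ z) {0, 4} = -(t₀ - t₁) * z 3 ∧
    extendSpin (spinVec t₀ t₁ z) {1, 2} = -z 4 ∧
    extendSpin (spinVec t₀ t₁ z) {1, 3} = -z 1 ∧
    extendSpin (spinVec t₀ t₁ z) {1, 4} = -z 4 ∧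
    extendSpin (spinVec t₀ t₁ z) {2, 3} = -z 0 - t₁ * z 3 + z 4 ∧
    extendSpin (spinVec t₀ t₁ z) {2, 4} = -t₀ * z 3 ∧
    extendSpin (spinVec t₀ t₁ z) {3, 4} = t₁ * z 3 - z 4 ∧
    extendSpin (spinVec t₀ t₁ z) {0, 1, 2, 3} = 0 ∧
    extendSpin (spinVec t₀ t₁ z) {0, 1, 2, 4} = -z 5 ∧
    extendSpin (spinVec t₀ t₁ z) {0, 1, 3, 4} = 0 ∧
    extendSpin (spinVec t₀ t₁ z) {0, 2, 3, 4} = z 6 ∧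
    extendSpin (spinVec t₀ t₁ z) {1, 2, 3, 4} = 0 := by
  refine ⟨?_, ?_, ?_, ?_, ?_, ?_, ?_, ?_, ?_, ?_, ?_, ?_, ?_, ?_, ?_, ?_⟩ <;> rfl

/-- The rescaling of coordinates on `ℙ⁶` used in `spinVec`. -/
def unscale {R : Type*} [CommRing R] (t₁ : R) (z : Fin 7 → R) : Fin 7 → R :=
  ![z 0, z 1, z 2, t₁ * z 3, z 4, t₁ * z 5, t₁ * z 6]

/-- The component `v` of the curve in rescaled coordinates. -/
def scaledComponent (t₀ t₁ : ℂ) (v : GVertex) : Set (Fin 7 → ℂ) :=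
  {z | unscale t₁ z ∈ nodComponent t₀ t₁ v}

theorem nodComponent_smul {t₀ t₁ : ℂ} {v : GVertex} {y : Fin 7 → ℂ} (r : ℂ)
    (hy : y ∈ nodComponent t₀ t₁ v) : r • y ∈ nodComponent t₀ t₁ v := by
  cases v <;> simp only [nodComponent, Set.mem_ofPred_eq, Pi.smul_apply, smul_eq_mul] at hy ⊢ <;>
    grind

/-- Nine equations leave seven of the sixteen coordinates free, and `spinInverse` reads these off.
Only $t_1$ has to be inverted, because of the rescaling. -/
theorem eq_spinVec_of_linear_equations {t₀ t₁ : ℂ} (ht₁ : t₁ ≠ 0) {x : SpinIdx → ℂ}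
    {X : Finset (Fin 5) → ℂ} (hX : extendSpin x = X) {z : Fin 7 → ℂ}
    (h1245 : X {0, 1, 3, 4} = 0) (h1234 : X {0, 1, 2, 3} = 0) (h2345 : X {1, 2, 3, 4} = 0)
    (h14 : X {0, 3} = 0) (h12 : X {0, 1} - X {0, 2} = 0) (h23 : X {1, 2} - X {1, 4} = 0)
    (h0 : X ∅ + t₁ * X {1, 4} - t₁ * X {2, 4} - t₁ * X {3, 4} = 0)
    (h15 : X {0, 4} + X {1, 4} - X {2, 4} - X {3, 4} = 0)
    (h35 : t₀ * X {1, 4} - t₁ * X {2, 4} - t₀ * X {3, 4} = 0)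
    (hz : unscale t₁ z = spinInverse t₁ X) : x = spinVec t₀ t₁ z := by
  obtain ⟨e0, e1, e2, e3, e4, e5, e6, e7, e8, e9, e10, e11, e12, e13, e14, e15⟩ :=
    extendSpin_spinVec t₀ t₁ z
  have z0 := congrFun hz 0
  have z1 := congrFun hz 1
  have z2 := congrFun hz 2
  have z3 := congrFun hz 3
  have z4 := congrFun hz 4
  have z5 := congrFun hz 5
  have z6 := congrFun hz 6
  simp only [unscale, spinInverse, Matrix.cons_val] at z0 z1 z2 z3 z4 z5 z6
  apply spin_ext
  rw [hX]
  simp only [List.forall_mem_cons, List.not_mem_nil, false_imp_iff, implies_true, and_true,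
    e0, e1, e2, e3, e4, e5, e6, e7, e8, e9, e10, e11, e12, e13, e14, e15]
  clear e0 e1 e2 e3 e4 e5 e6 e7 e8 e9 e10 e11 e12 e13 e14 e15 hX
  refine ⟨?_, z2.symm, ?_, h14, ?_, ?_, ?_, ?_, ?_, ?_, ?_, h1234, ?_, h1245, ?_, h2345⟩
  · linear_combination h0 - h35 + (t₀ - t₁) * z3
  · linear_combination -h12 - z2
  · refine mul_left_cancel₀ ht₁ ?_
    linear_combination t₁ * h15 - h35 + (t₀ - t₁) * z3
  · linear_combination h23 + z4
  · linear_combination z1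
  · linear_combination z4
  · linear_combination z0 + z3 - z4
  · refine mul_left_cancel₀ ht₁ ?_
    linear_combination -h35 + t₀ * z3
  · linear_combination -z3 + z4
  · refine mul_left_cancel₀ ht₁ ?_
    linear_combination z5
  · refine mul_left_cancel₀ ht₁ ?_
    linear_combination -z6

theorem polar_annihilates_of_mem_rhoImage {t₀ t₁ : ℂ} {v : GVertex} {x : SpinIdx → ℂ}
    (hx : x ∈ rhoImage t₀ t₁ v) :
    ∃ y ∈ nodComponent t₀ t₁ v, y ≠ 0 ∧ ∀ c J, spinCoord (polar t₀ t₁ y c) x J = 0 := by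
  obtain ⟨y, hy, hy0, -, hann⟩ := hx
  refine ⟨y, hy, hy0, fun c => (spinAction_eq_zero_iff _ _).1 (hann _ ?_)⟩
  rw [jacobianRowSpace_eq_range]
  exact ⟨c, rfl⟩

theorem mem_nodComponent_of_proportional {t₀ t₁ : ℂ} {v : GVertex} {y Y : Fin 7 → ℂ}
    (hy0 : y ≠ 0) (hy : y ∈ nodComponent t₀ t₁ v) (hprop : ∀ i j, y i * Y j = y j * Y i) :
    Y ∈ nodComponent t₀ t₁ v := by
  obtain ⟨j, hj⟩ : ∃ j, y j ≠ 0 := by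
    by_contra h
    push Not at h
    exact hy0 (funext h)
  have hYy : Y = (Y j / y j) • y := by
    funext i
    rw [Pi.smul_apply, smul_eq_mul, div_mul_eq_mul_div, eq_div_iff hj]
    linear_combination -hprop i j
  rw [hYy]
  exact nodComponent_smul _ hy

theorem exists_unscale_eq {t₁ : ℂ} (ht₁ : t₁ ≠ 0) (Y : Fin 7 → ℂ) : ∃ z, unscale t₁ z = Y := by
  refine ⟨![Y 0, Y 1, Y 2, Y 3 / t₁, Y 4, Y 5 / t₁, Y 6 / t₁], ?_⟩
  simp only [unscale, Matrix.cons_val, mul_div_cancel₀ _ ht₁]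
  exact FinVec.etaExpand_eq Y

/-- The coordinates recovered from the half spinor are a multiple of $y$, and the components are
cones, so they lie on the same component. This is the inclusion of $\rho(C_t^v)$ in the linear copy
of $C_t^v$. -/
theorem exists_spinVec_of_mem_rhoImage {t₀ t₁ : ℂ} (ht₀ : t₀ ≠ 0) (ht₁ : t₁ ≠ 0)
    (hd : t₀ - t₁ ≠ 0) {v : GVertex} {x : SpinIdx → ℂ} (hx : x ∈ rhoImage t₀ t₁ v) :
    ∃ z ∈ scaledComponent t₀ t₁ v, x = spinVec t₀ t₁ z := by
  obtain ⟨y, hy, hy0, hann⟩ := polar_annihilates_of_mem_rhoImage hx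
  obtain ⟨⟨h1245, h1234, h2345, h14, h12, h23, h0, h15, h35⟩, hprop⟩ :=
    linear_equations_of_annihilated ht₀ ht₁ hd hy0 rfl hann
  obtain ⟨z, hz⟩ := exists_unscale_eq ht₁ (spinInverse t₁ (extendSpin x))
  refine ⟨z, ?_,
    eq_spinVec_of_linear_equations ht₁ rfl h1245 h1234 h2345 h14 h12 h23 h0 h15 h35 hz⟩
  rw [scaledComponent, Set.mem_ofPred_eq, hz]
  exact mem_nodComponent_of_proportional hy0 hy hprop

/-- The identity `φ_{g(y)} T(y) = 0`, polarized. -/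
theorem spinCoord_polar_spinVec (t₀ t₁ : ℂ) (z e : Fin 7 → ℂ) (J : Finset (Fin 5)) :
    2 * spinCoord (polar t₀ t₁ (unscale t₁ z) (unscale t₁ e)) (spinVec t₀ t₁ z) J +
      spinCoord (polar t₀ t₁ (unscale t₁ z) (unscale t₁ z)) (spinVec t₀ t₁ e) J = 0 := by
  by_cases hJ : Even J.card
  · rw [spinCoord_of_even _ _ hJ, spinCoord_of_even _ _ hJ]
    ring
  have hmem : J ∈ [({0} : Finset (Fin 5)), {1}, {2}, {3}, {4}, {0, 1, 2}, {0, 1, 3}, {0, 1, 4},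
      {0, 2, 3}, {0, 2, 4}, {0, 3, 4}, {1, 2, 3}, {1, 2, 4}, {1, 3, 4}, {2, 3, 4},
      {0, 1, 2, 3, 4}] := by
    revert J
    decide
  obtain ⟨e0, e1, e2, e3, e4, e5, e6, e7, e8, e9, e10, e11, e12, e13, e14, e15⟩ :=
    extendSpin_spinVec t₀ t₁ z
  obtain ⟨f0, f1, f2, f3, f4, f5, f6, f7, f8, f9, f10, f11, f12, f13, f14, f15⟩ :=
    extendSpin_spinVec t₀ t₁ e
  simp only [List.mem_cons, List.not_mem_nil, or_false] at hmem
  rcases hmem with rfl | rfl | rfl | rfl | rfl | rfl | rfl | rfl | rfl | rfl | rfl | rfl | rfl |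
    rfl | rfl | rfl
  all_goals
    simp only [spinCoord_0, spinCoord_1, spinCoord_2, spinCoord_3, spinCoord_4, spinCoord_012,
      spinCoord_013, spinCoord_014, spinCoord_023, spinCoord_024, spinCoord_034, spinCoord_123,
      spinCoord_124, spinCoord_134, spinCoord_234, spinCoord_01234, e0, e1, e2, e3, e4, e5, e6,
      e7, e8, e9, e10, e11, e12, e13, e14, e15, f0, f1, f2, f3, f4, f5, f6, f7, f8, f9, f10, f11,
      f12, f13, f14, f15]
    simp only [polar, unscale, Matrix.cons_val]
    ring

theorem finrank_jacobianRowSpace {t₀ t₁ : ℂ} {y u w : Fin 7 → ℂ}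
    (hli : LinearIndependent ℂ ![u, w]) (hu : polar t₀ t₁ y u = 0) (hw : polar t₀ t₁ y w = 0)
    (h : ∀ c, polar t₀ t₁ y c = 0 → ∃ α β : ℂ, c = α • u + β • w) :
    Module.finrank ℂ (jacobianRowSpace t₀ t₁ y) = 5 := by
  have hker : LinearMap.ker (polarMap t₀ t₁ y) = Submodule.span ℂ (Set.range ![u, w]) := by
    rw [Matrix.range_cons, Matrix.range_cons, Matrix.range_empty, Set.union_empty]
    change _ = Submodule.span ℂ {u, w}
    apply le_antisymm
    · intro c hc
      obtain ⟨α, β, rfl⟩ := h c hc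
      exact Submodule.mem_span_pair.2 ⟨α, β, rfl⟩
    · rw [Submodule.span_le]
      rintro c (rfl | rfl)
      · exact hu
      · exact hw
  have hrank := (polarMap t₀ t₁ y).finrank_range_add_finrank_ker
  rw [hker, finrank_span_eq_card hli, ← jacobianRowSpace_eq_range] at hrank
  simp only [Fintype.card_fin, Module.finrank_fintype_fun_eq_card] at hrank
  omega

/-- Since the quadrics vanish at the point, the second term of the polarized identity disappears and
every Jacobian row annihilates $T(z)$. The rank is five by rank-nullity, because the kernel is
spanned by the two independent vectors `u`, `w`. -/
theorem spinVec_mem_rhoImage {t₀ t₁ : ℂ} (ht₁ : t₁ ≠ 0) {v : GVertex} {z u w : Fin 7 → ℂ}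
    (hz : z ∈ scaledComponent t₀ t₁ v) (hz0 : unscale t₁ z ≠ 0)
    (hq : polar t₀ t₁ (unscale t₁ z) (unscale t₁ z) = 0)
    (hli : LinearIndependent ℂ ![unscale t₁ u, unscale t₁ w])
    (hu : polar t₀ t₁ (unscale t₁ z) (unscale t₁ u) = 0)
    (hw : polar t₀ t₁ (unscale t₁ z) (unscale t₁ w) = 0)
    (h : ∀ e, polar t₀ t₁ (unscale t₁ z) (unscale t₁ e) = 0 → ∃ α β : ℂ, e = α • u + β • w) :
    spinVec t₀ t₁ z ∈ rhoImage t₀ t₁ v := by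
  refine ⟨unscale t₁ z, hz, hz0, finrank_jacobianRowSpace hli hu hw fun c hc => ?_, ?_⟩
  · obtain ⟨e, rfl⟩ := exists_unscale_eq ht₁ c
    obtain ⟨α, β, rfl⟩ := h e hc
    refine ⟨α, β, ?_⟩
    funext i
    fin_cases i <;> simp [unscale] <;> ring
  · intro c hc
    rw [jacobianRowSpace_eq_range] at hc
    obtain ⟨c, rfl⟩ := hc
    obtain ⟨e, rfl⟩ := exists_unscale_eq ht₁ c
    refine (spinAction_eq_zero_iff _ _).2 fun J => ?_
    have := spinCoord_polar_spinVec t₀ t₁ z e J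
    rw [hq] at this
    have h0 : spinCoord (0 : QuadSpace) (spinVec t₀ t₁ e) J = 0 := by simp [spinCoord]
    rw [h0, add_zero] at this
    exact (mul_eq_zero.1 this).resolve_left two_ne_zero

/-! ### Parametrized components and their smooth points. -/

/-- Parametrizations of the components of the curve in rescaled coordinates. -/
def param {R : Type*} [CommRing R] (t₀ t₁ a b : R) : GVertex → Fin 7 → R
  | .v0 => ![a, 0, 0, 0, 0, 0, b]
  | .v1 => ![a, b, 0, 0, 0, 0, 0]
  | .v2 => ![a, a, b, 0, 0, 0, 0]
  | .v34 => ![(t₀ - t₁) * a * b - t₁ * a * (t₀ * a - b), (t₀ - t₁) * a * b - b * (t₀ * a - b),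
      (t₀ - t₁) * a * b, a * (t₀ * a - b), b * (t₀ * a - b), 0, 0]
  | .v5 => ![0, 0, t₁ * (a - b), a, t₁ * a, b, 0]
  | .v6 => ![0, 0, 0, a - b, t₁ * a, a, b]
  | .v7 => ![0, 0, 0, 0, a, b, b]
  | .v8 => ![0, 0, 0, 0, 0, a, b]
  | .v9 => ![-t₁ * (a + b), 0, 0, a, 0, 0, b]
  | .v10 => ![0, a, 0, 0, b, 0, 0]
  | .v11 => ![0, 0, a, 0, 0, b, 0]

/-- The parameters of the nodes of the curve are zeros of this polynomial. -/
def nodeLocus {R : Type*} [CommRing R] (t₀ t₁ a b : R) : GVertex → R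
  | .v0 => a * b * (a + t₁ * b)
  | .v1 => a * b * (a - b)
  | .v2 => a * b * (a - b)
  | .v34 => a * b * (t₀ * a - b) * (b - t₁ * a)
  | .v5 => a * b * (a - b)
  | .v6 => a * b * (a - b)
  | .v7 => a * b * (a - t₁ * b)
  | .v8 => a * b * (a - b)
  | .v9 => a * b * (a + b)
  | .v10 => a * b * (a + b)
  | .v11 => a * b * (a + t₁ * b)

theorem map_param {R S : Type*} [CommRing R] [CommRing S] (f : R →+* S) (t₀ t₁ a b : R)
    (v : GVertex) (i : Fin 7) :
    f (param t₀ t₁ a b v i) = param (f t₀) (f t₁) (f a) (f b) v i := by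
  cases v <;> fin_cases i <;> simp [param]

theorem map_nodeLocus {R S : Type*} [CommRing R] [CommRing S] (f : R →+* S) (t₀ t₁ a b : R)
    (v : GVertex) : f (nodeLocus t₀ t₁ a b v) = nodeLocus (f t₀) (f t₁) (f a) (f b) v := by
  cases v <;> simp [nodeLocus]

theorem param_mem_scaledComponent (t₀ t₁ a b : ℂ) (v : GVertex) :
    param t₀ t₁ a b v ∈ scaledComponent t₀ t₁ v := by
  change unscale t₁ (param t₀ t₁ a b v) ∈ nodComponent t₀ t₁ v
  obtain ⟨y, hy⟩ : ∃ y, y = unscale t₁ (param t₀ t₁ a b v) := ⟨_, rfl⟩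
  rw [← hy]
  have h0 := congrFun hy 0
  have h1 := congrFun hy 1
  have h2 := congrFun hy 2
  have h3 := congrFun hy 3
  have h4 := congrFun hy 4
  have h5 := congrFun hy 5
  have h6 := congrFun hy 6
  clear hy
  cases v <;> simp only [param, unscale, Matrix.cons_val, mul_zero] at h0 h1 h2 h3 h4 h5 h6 <;>
    simp only [nodComponent, Set.mem_ofPred_eq, h0, h1, h2, h3, h4, h5, h6] <;>
    refine ⟨?_, ?_, ?_, ?_, ?_⟩ <;> first | trivial | ring

theorem polar_param_self (t₀ t₁ a b : ℂ) (v : GVertex) :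
    polar t₀ t₁ (unscale t₁ (param t₀ t₁ a b v)) (unscale t₁ (param t₀ t₁ a b v)) = 0 := by
  cases v <;> refine Prod.ext (funext fun i => ?_) (funext fun i => ?_) <;> fin_cases i <;>
    simp [param, polar, unscale] <;> ring

theorem linearIndependent_pair_of_coord {u w : Fin 7 → ℂ} (i j : Fin 7) (hu : u i ≠ 0)
    (hw : w i = 0) (hw' : w j ≠ 0) : LinearIndependent ℂ ![u, w] := by
  rw [LinearIndependent.pair_iff]
  intro s t h
  have hi := congrFun h i
  have hj := congrFun h j
  simp only [Pi.add_apply, Pi.smul_apply, smul_eq_mul, Pi.zero_apply, hw] at hi hj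
  have hs : s = 0 := by simpa [hu] using hi
  exact ⟨hs, by simpa [hs, hw'] using hj⟩

/-- Coordinates that determine a point on the line `v`. -/
def pivots : GVertex → Fin 7 × Fin 7
  | .v0 => (0, 6)
  | .v1 => (0, 1)
  | .v2 => (0, 2)
  | .v34 => (3, 4)
  | .v5 => (3, 5)
  | .v6 => (5, 6)
  | .v7 => (4, 5)
  | .v8 => (5, 6)
  | .v9 => (3, 6)
  | .v10 => (1, 4)
  | .v11 => (2, 5)

/-- Away from the nodes the kernel of the Jacobian matrix is just the plane over the line itself.
The factors of `nodeLocus` are precisely what has to be cancelled. -/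
theorem eq_param_of_polar_eq_zero {t₀ t₁ a b : ℂ} (ht₀ : t₀ ≠ 0) (ht₁ : t₁ ≠ 0)
    (hd : t₀ - t₁ ≠ 0) {v : GVertex} (hv : v ≠ .v34) (hN : nodeLocus t₀ t₁ a b v ≠ 0)
    {e : Fin 7 → ℂ}
    (he : polar t₀ t₁ (unscale t₁ (param t₀ t₁ a b v)) (unscale t₁ e) = 0) :
    e = e (pivots v).1 • param t₀ t₁ 1 0 v + e (pivots v).2 • param t₀ t₁ 0 1 v := by
  have h0 := congrFun (congrArg Prod.fst he) 0
  have h1 := congrFun (congrArg Prod.fst he) 1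
  have h2 := congrFun (congrArg Prod.fst he) 2
  have h3 := congrFun (congrArg Prod.fst he) 3
  have h4 := congrFun (congrArg Prod.fst he) 4
  have h5 := congrFun (congrArg Prod.snd he) 0
  have h6 := congrFun (congrArg Prod.snd he) 1
  have h7 := congrFun (congrArg Prod.snd he) 2
  have h8 := congrFun (congrArg Prod.snd he) 3
  have h9 := congrFun (congrArg Prod.snd he) 4
  clear he
  cases v
  case v34 => exact absurd rfl hv
  all_goals
    simp only [nodeLocus, ne_eq, mul_eq_zero, not_or] at hN
    obtain ⟨⟨ha, hb⟩, hab⟩ := hN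
    simp only [polar, param, unscale, Matrix.cons_val, Prod.fst_zero, Prod.snd_zero, Pi.zero_apply,
      mul_zero, zero_mul, add_zero, zero_add, sub_zero, zero_sub] at h0 h1 h2 h3 h4 h5 h6 h7 h8 h9
    funext i
    fin_cases i <;>
    simp only [param, pivots, Pi.add_apply, Pi.smul_apply, smul_eq_mul, Fin.reduceFinMk,
      Fin.zero_eta, Fin.mk_one, Matrix.cons_val] <;>
    grind

/-- The first four equations cut out the plane of the conic, and the last is the differential of its
equation at the given point; together they describe the tangent plane of the cone. -/
theorem eq_of_polar_conic_eq_zero {t₀ t₁ a b : ℂ} (ht₁ : t₁ ≠ 0)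
    (hd : t₀ - t₁ ≠ 0) (ha : a ≠ 0) (hb : b ≠ 0) (hab : t₀ * a - b ≠ 0) (hba : b - t₁ * a ≠ 0)
    {e : Fin 7 → ℂ}
    (he : polar t₀ t₁ (unscale t₁ (param t₀ t₁ a b .v34)) (unscale t₁ e) = 0) :
    e 5 = 0 ∧ e 6 = 0 ∧ e 1 = e 2 - e 4 ∧ e 0 = e 2 - t₁ * e 3 ∧
      (t₀ * a - b) ^ 2 * e 2 + (t₀ - t₁) * b ^ 2 * e 3 - t₀ * (t₀ - t₁) * a ^ 2 * e 4 = 0 := by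
  have h0 := congrFun (congrArg Prod.fst he) 0
  have h1 := congrFun (congrArg Prod.fst he) 1
  have h2 := congrFun (congrArg Prod.fst he) 2
  have h3 := congrFun (congrArg Prod.fst he) 3
  have h4 := congrFun (congrArg Prod.fst he) 4
  have h5 := congrFun (congrArg Prod.snd he) 0
  have h6 := congrFun (congrArg Prod.snd he) 1
  have h7 := congrFun (congrArg Prod.snd he) 2
  have h8 := congrFun (congrArg Prod.snd he) 3
  have h9 := congrFun (congrArg Prod.snd he) 4
  clear he
  simp only [polar, param, unscale, Matrix.cons_val, Prod.fst_zero, Prod.snd_zero, Pi.zero_apply,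
    mul_zero, add_zero] at h0 h1 h2 h3 h4 h5 h6 h7 h8 h9
  have e6 : e 6 = 0 := by
    refine mul_left_cancel₀ (mul_ne_zero ht₁ (mul_ne_zero (mul_ne_zero hd ha) hb)) ?_
    linear_combination h5
  have e5 : e 5 = 0 := by
    refine mul_left_cancel₀ (mul_ne_zero ht₁ (mul_ne_zero hab hba)) ?_
    rw [e6] at h9
    linear_combination -h9
  rw [e5] at h3
  have hQ : (t₀ * a - b) ^ 2 * e 2 + (t₀ - t₁) * b ^ 2 * e 3 - t₀ * (t₀ - t₁) * a ^ 2 * e 4 = 0 :=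
    mul_left_cancel₀ ht₁ (by linear_combination h3)
  have e1 : e 1 = e 2 - e 4 := by
    refine sub_eq_zero.1 (mul_left_cancel₀
      (mul_ne_zero ht₁ (mul_ne_zero hd (mul_ne_zero ha hab))) ?_)
    linear_combination h2 - t₁ * hQ
  refine ⟨e5, e6, e1, ?_, hQ⟩
  refine sub_eq_zero.1 (mul_left_cancel₀ (mul_ne_zero ht₁ (mul_ne_zero hb hab)) ?_)
  rw [e1] at h0
  linear_combination h0 + t₁ * hQ

theorem nodeLocus_conic_ne_zero {t₀ t₁ a b : ℂ} (h : nodeLocus t₀ t₁ a b .v34 ≠ 0) :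
    a ≠ 0 ∧ b ≠ 0 ∧ t₀ * a - b ≠ 0 ∧ b - t₁ * a ≠ 0 := by
  simpa only [nodeLocus, ne_eq, mul_eq_zero, not_or, and_assoc] using h

theorem nodeLocus_ne_zero {t₀ t₁ a b : ℂ} {v : GVertex} (h : nodeLocus t₀ t₁ a b v ≠ 0) :
    a ≠ 0 ∧ b ≠ 0 := by
  constructor <;> rintro rfl <;> cases v <;> simp [nodeLocus] at h

theorem unscale_apply_ne_zero {t₁ : ℂ} (ht₁ : t₁ ≠ 0) {z : Fin 7 → ℂ} {i : Fin 7} :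
    unscale t₁ z i ≠ 0 ↔ z i ≠ 0 := by
  fin_cases i <;> simp [unscale, ht₁]

theorem param_pivots {t₀ t₁ a b : ℂ} {v : GVertex} (hv : v ≠ .v34) :
    param t₀ t₁ a b v (pivots v).1 = a ∧ param t₀ t₁ a b v (pivots v).2 = b := by
  cases v <;> simp [param, pivots] at hv ⊢

theorem polar_line_param (t₀ t₁ a b a' b' : ℂ) {v : GVertex} (hv : v ≠ .v34) :
    polar t₀ t₁ (unscale t₁ (param t₀ t₁ a b v)) (unscale t₁ (param t₀ t₁ a' b' v)) = 0 := by
  cases v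
  case v34 => exact absurd rfl hv
  all_goals
    refine Prod.ext (funext fun i => ?_) (funext fun i => ?_) <;> fin_cases i <;>
    simp [param, polar, unscale] <;> ring

/-- Two tangent vectors at a point of the conic. -/
def conicTangent (t₀ t₁ a b : ℂ) : (Fin 7 → ℂ) × (Fin 7 → ℂ) :=
  (![t₀ * (t₀ - t₁) * a ^ 2, t₀ * (t₀ - t₁) * a ^ 2 - (t₀ * a - b) ^ 2, t₀ * (t₀ - t₁) * a ^ 2, 0,
    (t₀ * a - b) ^ 2, 0, 0], ![-t₁ * t₀ * a ^ 2, -b ^ 2, 0, t₀ * a ^ 2, b ^ 2, 0, 0])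

theorem polar_conicTangent (t₀ t₁ a b : ℂ) :
    polar t₀ t₁ (unscale t₁ (param t₀ t₁ a b .v34)) (unscale t₁ (conicTangent t₀ t₁ a b).1) = 0 ∧
    polar t₀ t₁ (unscale t₁ (param t₀ t₁ a b .v34)) (unscale t₁ (conicTangent t₀ t₁ a b).2) = 0 := by
  constructor <;>
    refine Prod.ext (funext fun i => ?_) (funext fun i => ?_) <;> fin_cases i <;>
    simp [param, polar, unscale, conicTangent] <;> ring

/-- Generic parametrized points really occur in the image of $\rho$. This supplies the arcs that
bound the limit from inside. -/
theorem spinVec_param_mem_rhoImage {t₀ t₁ a b : ℂ} (ht₀ : t₀ ≠ 0) (ht₁ : t₁ ≠ 0)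
    (hd : t₀ - t₁ ≠ 0) {v : GVertex} (hN : nodeLocus t₀ t₁ a b v ≠ 0) :
    spinVec t₀ t₁ (param t₀ t₁ a b v) ∈ rhoImage t₀ t₁ v := by
  obtain ⟨ha, hb⟩ := nodeLocus_ne_zero hN
  by_cases hv : v = .v34
  · subst hv
    obtain ⟨-, -, hab, hba⟩ := nodeLocus_conic_ne_zero hN
    have hu : (conicTangent t₀ t₁ a b).1 2 ≠ 0 := mul_ne_zero (mul_ne_zero ht₀ hd) (pow_ne_zero 2 ha)
    have hw : (conicTangent t₀ t₁ a b).2 3 ≠ 0 := mul_ne_zero ht₀ (pow_ne_zero 2 ha)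
    refine spinVec_mem_rhoImage ht₁ (param_mem_scaledComponent t₀ t₁ a b _) (fun h0 => ?_)
      (polar_param_self t₀ t₁ a b _)
      (linearIndependent_pair_of_coord 2 3 ((unscale_apply_ne_zero ht₁).2 hu) rfl
        ((unscale_apply_ne_zero ht₁).2 hw))
      (polar_conicTangent t₀ t₁ a b).1 (polar_conicTangent t₀ t₁ a b).2 fun e he => ?_
    · have h2 : param t₀ t₁ a b .v34 2 ≠ 0 := mul_ne_zero (mul_ne_zero hd ha) hb
      exact (unscale_apply_ne_zero ht₁).2 h2 (congrFun h0 2)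
    · obtain ⟨e5, e6, e1, e0, hQ⟩ := eq_of_polar_conic_eq_zero ht₁ hd ha hb hab hba he
      -- The first tangent vector has third coordinate zero and the second has second coordinate
      -- zero, so these two coordinates of `e` determine the coefficients.
      refine ⟨e 2 / (t₀ * (t₀ - t₁) * a ^ 2), e 3 / (t₀ * a ^ 2), ?_⟩
      have e4 : e 4 = ((t₀ * a - b) ^ 2 * e 2 + (t₀ - t₁) * b ^ 2 * e 3) /
          (t₀ * (t₀ - t₁) * a ^ 2) := by
        rw [eq_div_iff (mul_ne_zero (mul_ne_zero ht₀ hd) (pow_ne_zero 2 ha))]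
        linear_combination -hQ
      funext i
      fin_cases i <;>
        simp only [conicTangent, Pi.add_apply, Pi.smul_apply, smul_eq_mul, Fin.reduceFinMk,
          Fin.zero_eta, Fin.mk_one, Matrix.cons_val, e0, e1, e4, e5, e6] <;>
        field_simp <;> ring
  · have hp := fun a b => param_pivots (t₀ := t₀) (t₁ := t₁) (a := a) (b := b) hv
    refine spinVec_mem_rhoImage (u := param t₀ t₁ 1 0 v) (w := param t₀ t₁ 0 1 v) ht₁
      (param_mem_scaledComponent t₀ t₁ a b _) (fun h0 => ?_) (polar_param_self t₀ t₁ a b _)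
      (linearIndependent_pair_of_coord (pivots v).1 (pivots v).2
        ((unscale_apply_ne_zero ht₁).2 ?_) ?_ ((unscale_apply_ne_zero ht₁).2 ?_))
      (polar_line_param _ _ _ _ _ _ hv) (polar_line_param _ _ _ _ _ _ hv)
      fun e he => ⟨_, _, eq_param_of_polar_eq_zero ht₀ ht₁ hd hv hN he⟩
    · refine (unscale_apply_ne_zero ht₁).2 ?_ (congrFun h0 (pivots v).1)
      rwa [(hp a b).1]
    · rw [(hp 1 0).1]
      exact one_ne_zero
    · by_contra h
      exact (unscale_apply_ne_zero ht₁).1 h (hp 0 1).1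
    · rw [(hp 0 1).2]
      exact one_ne_zero

/-! ### Flat limits -/

section FlatLimit

variable {σ ρ : Type}

theorem totalIdeal_mono {B : Set ℂ} {X Y : ℂ → Set (σ → ℂ)} (h : ∀ τ ∈ B, X τ ⊆ Y τ) :
    totalIdeal B Y ≤ totalIdeal B X :=
  fun _ hF τ hτ x hx => hF τ hτ x (h τ hτ hx)

theorem flatLimit_mono {B : Set ℂ} {X Y : ℂ → Set (σ → ℂ)} (h : ∀ τ ∈ B, X τ ⊆ Y τ) (c : ℂ) :
    flatLimit B Y c ≤ flatLimit B X c :=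
  Ideal.map_mono (totalIdeal_mono h)

theorem subset_zariskiClosure (S : Set (σ → ℂ)) : S ⊆ zariskiClosure S :=
  fun _ hx _ hf => hf _ hx

/-- The total ideal tests vanishing fibre by fibre, and a polynomial vanishing on a set vanishes on
its closure. Hence closures can be ignored from here on. -/
theorem totalIdeal_iUnion_zariskiClosure {ι : Type} (B : Set ℂ) (X : ℂ → ι → Set (σ → ℂ)) :
    totalIdeal B (fun τ => ⋃ i, zariskiClosure (X τ i)) = totalIdeal B fun τ => ⋃ i, X τ i := by
  apply le_antisymm
  · exact totalIdeal_mono fun τ _ => Set.iUnion_mono fun i => subset_zariskiClosure _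
  · intro F hF τ hτ x hx
    obtain ⟨i, hi⟩ := Set.mem_iUnion.1 hx
    exact hi _ fun y hy => hF τ hτ y (Set.mem_iUnion_of_mem i hy)

theorem totalIdeal_zariskiClosure (B : Set ℂ) (X : ℂ → Set (σ → ℂ)) :
    totalIdeal B (fun τ => zariskiClosure (X τ)) = totalIdeal B X := by
  apply le_antisymm
  · exact totalIdeal_mono fun τ _ => subset_zariskiClosure _
  · intro F hF τ hτ x hx
    exact hx _ fun y hy => hF τ hτ y hy

theorem specialize_surjective (c : ℂ) :
    Function.Surjective (specialize c : MvPolynomial σ (Polynomial ℂ) →+* MvPolynomial σ ℂ) :=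
  map_surjective _ fun a => ⟨Polynomial.C a, by simp⟩

theorem mem_flatLimit {B : Set ℂ} {X : ℂ → Set (σ → ℂ)} {c : ℂ} {f : MvPolynomial σ ℂ} :
    f ∈ flatLimit B X c ↔ ∃ F ∈ totalIdeal B X, specialize c F = f :=
  Ideal.mem_map_iff_of_surjective _ (specialize_surjective c)

/-- A polynomial arc family that generically lies in the family `X` yields zeros of the total
ideal for all parameters. -/
theorem eval_specialize_eq_zero {B : Set ℂ} {X : ℂ → Set (σ → ℂ)}
    {F : MvPolynomial σ (Polynomial ℂ)} (hF : F ∈ totalIdeal B X)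
    (x : σ → MvPolynomial (Fin 3) ℂ) {D : MvPolynomial (Fin 3) ℂ} (hD : D ≠ 0)
    (h : ∀ s, eval s D ≠ 0 → s 0 ∈ B ∧ (fun i => eval s (x i)) ∈ X (s 0)) (s : Fin 3 → ℂ) :
    eval (fun i => eval s (x i)) (specialize (s 0) F) = 0 := by
  set Φ : MvPolynomial σ (Polynomial ℂ) →+* MvPolynomial (Fin 3) ℂ :=
    eval₂Hom (Polynomial.eval₂RingHom C (MvPolynomial.X 0)) x with hΦ
  have hcomp : ∀ s, (eval s).comp Φ = (eval fun i => eval s (x i)).comp (specialize (s 0)) := by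
    intro s
    apply MvPolynomial.ringHom_ext
    · intro p
      induction p using Polynomial.induction_on' with
      | add p q hp hq => rw [map_add, map_add, map_add, hp, hq]
      | monomial n a => simp [hΦ, specialize, ← Polynomial.C_mul_X_pow_eq_monomial]
    · intro i
      simp [hΦ, specialize]
  have hval : ∀ s, eval s (Φ F) = eval (fun i => eval s (x i)) (specialize (s 0) F) :=
    fun s => RingHom.congr_fun (hcomp s) F
  -- The pullback `Φ F` vanishes wherever `D` does not. As polynomials form a domain, it is zero,
  -- and so it vanishes also over the parameter values outside `B`.
  have hprod : D * Φ F = 0 := by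
    refine MvPolynomial.funext fun s => ?_
    rw [map_mul, map_zero]
    by_cases hs : eval s D = 0
    · rw [hs, zero_mul]
    · rw [hval, hF _ (h s hs).1 _ (h s hs).2, mul_zero]
  rw [← hval, (mul_eq_zero.1 hprod).resolve_left hD, map_zero]

theorem eval_aeval_eq {R : Type*} [CommRing R] (S : σ → MvPolynomial ρ R) (z : ρ → R)
    (p : MvPolynomial σ R) : eval z (aeval S p) = eval (fun i => eval z (S i)) p := by
  induction p using MvPolynomial.induction_on with
  | C a => simp
  | add p q hp hq => rw [map_add, map_add, map_add, hp, hq]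
  | mul_X p i hp => rw [map_mul, map_mul, map_mul, hp]; simp

theorem specialize_aeval (S : σ → MvPolynomial ρ (Polynomial ℂ)) (τ : ℂ)
    (p : MvPolynomial σ (Polynomial ℂ)) :
    specialize τ (aeval S p) = aeval (fun i => specialize τ (S i)) (specialize τ p) := by
  induction p using MvPolynomial.induction_on with
  | C a => simp [specialize]
  | add p q hp hq => rw [map_add, map_add, map_add, map_add, hp, hq]
  | mul_X p i hp => rw [map_mul, map_mul, map_mul, map_mul, hp]; simp [specialize]

/-- Flat limits of families that lie in the images of a family of split embeddings. -/
theorem mem_flatLimit_of_comp_mem {B : Set ℂ} {X : ℂ → Set (σ → ℂ)} {Z : ℂ → Set (ρ → ℂ)}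
    (T : σ → MvPolynomial ρ (Polynomial ℂ)) (R : ρ → MvPolynomial σ (Polynomial ℂ))
    (hX : ∀ τ ∈ B, ∀ x ∈ X τ, ∃ z ∈ Z τ, x = fun i => eval z (specialize τ (T i)))
    (hRT : ∀ j, aeval T (R j) = MvPolynomial.X j) {c : ℂ} {f : MvPolynomial σ ℂ}
    (hf : aeval (fun i => specialize c (T i)) f ∈ flatLimit B Z c) : f ∈ flatLimit B X c := by
  obtain ⟨G, hG, hGf⟩ := mem_flatLimit.1 hf
  set f' : MvPolynomial σ (Polynomial ℂ) := map Polynomial.C f with hf'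
  have hspec : ∀ τ, specialize τ f' = f := by
    intro τ
    rw [hf', specialize, map_map]
    have : (Polynomial.evalRingHom τ).comp Polynomial.C = RingHom.id ℂ := by
      ext
      simp
    rw [this, map_id]
  -- On the image of $T$ the first summand restricts to $G$, which vanishes on `Z`, and the bracket
  -- vanishes because $R\circ T=\mathrm{id}$. At $\tau=c$ the specialization of $G$ is $f\circ T_c$,
  -- so the terms containing $R$ cancel and $f$ remains.
  refine mem_flatLimit.2 ⟨aeval R G + (f' - aeval R (aeval T f')), ?_, ?_⟩
  · intro τ hτ x hx
    obtain ⟨z, hz, rfl⟩ := hX τ hτ x hx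
    have hev : ∀ p : MvPolynomial ρ (Polynomial ℂ),
        eval (fun i => eval z (specialize τ (T i))) (specialize τ (aeval R p)) =
          eval z (specialize τ p) := by
      intro p
      rw [← eval_aeval_eq, ← specialize_aeval]
      congr 2
      induction p using MvPolynomial.induction_on with
      | C a => simp
      | add p q hp hq => rw [map_add, map_add, hp, hq]
      | mul_X p i hp => rw [map_mul, map_mul, hp, aeval_X, hRT]
    rw [map_add, map_add, map_sub, map_sub, hev, hev, hG τ hτ z hz, specialize_aeval, hspec,
      eval_aeval_eq, sub_self, zero_add]
  · rw [map_add, map_sub, specialize_aeval, specialize_aeval, specialize_aeval, hGf, hspec, add_sub_cancel]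

/-! ### Flat limits of families in `P_t` -/

/-- A linear left inverse of `spinVec t₀ t₁`, if `α (t₁ - t₀) - β t₀ = 1`. -/
def spinRetract {R : Type*} [CommRing R] (t₁ α β : R) (x : SpinIdx → R) : Fin 7 → R :=
  let z₃ := α * x ⟨{0, 4}, by decide⟩ + β * x ⟨{2, 4}, by decide⟩
  ![-x ⟨{2, 3}, by decide⟩ - t₁ * z₃ - x ⟨{1, 2}, by decide⟩, -x ⟨{1, 3}, by decide⟩,
    x ⟨{0, 1}, by decide⟩, z₃, -x ⟨{1, 2}, by decide⟩, -x ⟨{0, 1, 2, 4}, by decide⟩,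
    x ⟨{0, 2, 3, 4}, by decide⟩]

/-- Apart from $z_3$, the coordinates can be read off directly. The variable $z_3$ occurs alone in
$x_{15}$ and $x_{35}$ with coefficients $t_1-t_0$ and $-t_0$; the hypothesis combines these to $1$.
-/
theorem spinRetract_spinVec {R : Type*} [CommRing R] {t₀ t₁ α β : R}
    (h : α * (t₁ - t₀) - β * t₀ = 1) (z : Fin 7 → R) :
    spinRetract t₁ α β (spinVec t₀ t₁ z) = z := by
  have h0 : spinVec t₀ t₁ z ⟨{2, 3}, by decide⟩ = -z 0 - t₁ * z 3 + z 4 := rfl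
  have h1 : spinVec t₀ t₁ z ⟨{1, 3}, by decide⟩ = -z 1 := rfl
  have h2 : spinVec t₀ t₁ z ⟨{0, 1}, by decide⟩ = z 2 := rfl
  have h3 : spinVec t₀ t₁ z ⟨{0, 4}, by decide⟩ = -(t₀ - t₁) * z 3 := rfl
  have h3' : spinVec t₀ t₁ z ⟨{2, 4}, by decide⟩ = -t₀ * z 3 := rfl
  have h4 : spinVec t₀ t₁ z ⟨{1, 2}, by decide⟩ = -z 4 := rfl
  have h5 : spinVec t₀ t₁ z ⟨{0, 1, 2, 4}, by decide⟩ = -z 5 := rfl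
  have h6 : spinVec t₀ t₁ z ⟨{0, 2, 3, 4}, by decide⟩ = z 6 := rfl
  have hz3 : α * (-(t₀ - t₁) * z 3) + β * (-t₀ * z 3) = z 3 := by linear_combination z 3 * h
  have hz : ∀ a, a = z 0 → ![a, z 1, z 2, z 3, z 4, z 5, z 6] = z := by
    rintro a rfl
    exact FinVec.etaExpand_eq z
  simp only [spinRetract, h0, h1, h2, h3, h3', h4, h5, h6, hz3, neg_neg]
  exact hz _ (by ring)

theorem map_spinRetract {R S : Type*} [CommRing R] [CommRing S] (f : R →+* S) (t₁ α β : R)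
    (x : SpinIdx → R) (j : Fin 7) :
    f (spinRetract t₁ α β x j) = spinRetract (f t₁) (f α) (f β) (fun i => f (x i)) j := by
  fin_cases j <;> simp [spinRetract]

theorem eval_specialize_spinVec (p₀ p₁ : Polynomial ℂ) (τ : ℂ) (z : Fin 7 → ℂ) (I : SpinIdx) :
    eval z (specialize τ (spinVec (C p₀) (C p₁) X I)) = spinVec (p₀.eval τ) (p₁.eval τ) z I := by
  rw [map_spinVec, map_spinVec]
  simp [specialize]

/-- Outer bound for the limit: forms `q` over $\mathbb C[\tau]$ vanishing on the family in $\mathbb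
P^6$ specialize to elements of the limit ideal, and the split embedding transports this to $\mathbb
P(S^+)$. -/
theorem mem_flatLimit_of_mem_span {p₀ p₁ α β : Polynomial ℂ} (h : α * (p₁ - p₀) - β * p₀ = 1)
    {B : Set ℂ} {Y : ℂ → Set (SpinIdx → ℂ)} {Z : ℂ → Set (Fin 7 → ℂ)}
    (hY : ∀ τ ∈ B, ∀ x ∈ Y τ, ∃ z ∈ Z τ, x = spinVec (p₀.eval τ) (p₁.eval τ) z) {ι : Type}
    (q : ι → MvPolynomial (Fin 7) (Polynomial ℂ))
    (hq : ∀ τ ∈ B, ∀ z ∈ Z τ, ∀ j, eval z (specialize τ (q j)) = 0) {c : ℂ}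
    {f : MvPolynomial SpinIdx ℂ}
    (hf : aeval (spinVec (C (p₀.eval c)) (C (p₁.eval c)) X) f ∈
      Ideal.span (Set.range fun j => specialize c (q j))) : f ∈ flatLimit B Y c := by
  refine mem_flatLimit_of_comp_mem (Z := Z) (spinVec (C p₀) (C p₁) X)
    (spinRetract (C p₁) (C α) (C β) X) ?_ ?_ ?_
  · intro τ hτ x hx
    obtain ⟨z, hz, rfl⟩ := hY τ hτ x hx
    exact ⟨z, hz, funext fun I => (eval_specialize_spinVec p₀ p₁ τ z I).symm⟩
  · intro j
    have h1 := map_spinRetract (aeval (R := Polynomial ℂ) (spinVec (C p₀) (C p₁)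
      (X : Fin 7 → MvPolynomial (Fin 7) (Polynomial ℂ)))).toRingHom (C p₁) (C α) (C β) X j
    simp only [AlgHom.toRingHom_eq_coe, RingHom.coe_coe, aeval_X, aeval_C,
      MvPolynomial.algebraMap_eq] at h1
    rw [h1, spinRetract_spinVec]
    rw [← C_sub, ← C_mul, ← C_mul, ← C_sub, h, C_1]
  · have hT : (fun i => specialize c (spinVec (C p₀) (C p₁) X i)) =
        (spinVec (C (p₀.eval c)) (C (p₁.eval c)) X : SpinIdx → MvPolynomial (Fin 7) ℂ) := by
      funext I
      rw [map_spinVec]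
      simp [specialize]
    rw [hT]
    refine Ideal.span_le.2 ?_ hf
    rintro _ ⟨j, rfl⟩
    exact Ideal.mem_map_of_mem _ fun τ hτ z hz => hq τ hτ z hz j

theorem eval_aeval_X (s : Fin 3 → ℂ) (p : Polynomial ℂ) :
    eval s (Polynomial.aeval (X 0 : MvPolynomial (Fin 3) ℂ) p) = p.eval (s 0) := by
  rw [Polynomial.aeval_def, Polynomial.hom_eval₂, eval_X]
  have : (eval s).comp (algebraMap ℂ (MvPolynomial (Fin 3) ℂ)) = RingHom.id ℂ := by
    ext
    simp
  rw [this, Polynomial.eval₂_id]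

/-- Inner bound for the limit. The variable $s_0$ is the parameter of the family, and $s_1,s_2$
parametrize a component. -/
theorem eval_spinVec_eq_zero {p₀ p₁ : Polynomial ℂ} {B : Set ℂ} {Y : ℂ → Set (SpinIdx → ℂ)}
    (z : Fin 7 → MvPolynomial (Fin 3) ℂ) {D : MvPolynomial (Fin 3) ℂ} (hD : D ≠ 0)
    (h : ∀ s, eval s D ≠ 0 → s 0 ∈ B ∧
      spinVec (p₀.eval (s 0)) (p₁.eval (s 0)) (fun i => eval s (z i)) ∈ Y (s 0))
    {f : MvPolynomial SpinIdx ℂ} (s : Fin 3 → ℂ) (hf : f ∈ flatLimit B Y (s 0)) :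
    eval (spinVec (p₀.eval (s 0)) (p₁.eval (s 0)) fun i => eval s (z i)) f = 0 := by
  obtain ⟨F, hF, rfl⟩ := mem_flatLimit.1 hf
  have hx : ∀ s, (fun I => eval s (spinVec (Polynomial.aeval (X 0) p₀) (Polynomial.aeval (X 0) p₁)
      z I)) = spinVec (p₀.eval (s 0)) (p₁.eval (s 0)) fun i => eval s (z i) := by
    intro s
    funext I
    rw [map_spinVec]
    rw [eval_aeval_X, eval_aeval_X]
  have := eval_specialize_eq_zero hF _ hD (fun s hs => by rw [hx]; exact h s hs) s
  rwa [hx] at this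

end FlatLimit

theorem spinVec_smul {R : Type*} [CommRing R] (t₀ t₁ r : R) (z : Fin 7 → R) :
    spinVec t₀ t₁ (r • z) = r • spinVec t₀ t₁ z := by
  funext I
  unfold spinVec
  simp only [Pi.smul_apply, smul_eq_mul, mul_ite]
  refine if_congr Iff.rfl ?_ (if_congr Iff.rfl ?_ (if_congr Iff.rfl ?_ (if_congr Iff.rfl ?_
    (if_congr Iff.rfl ?_ (if_congr Iff.rfl ?_ (if_congr Iff.rfl ?_ (if_congr Iff.rfl ?_
    (if_congr Iff.rfl ?_ (if_congr Iff.rfl ?_ (if_congr Iff.rfl ?_ (if_congr Iff.rfl ?_ ?_)))))))))))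
    <;> ring

theorem spinVec_add {R : Type*} [CommRing R] (t₀ t₁ : R) (z w : Fin 7 → R) :
    spinVec t₀ t₁ (z + w) = spinVec t₀ t₁ z + spinVec t₀ t₁ w := by
  funext I
  unfold spinVec
  simp only [Pi.add_apply, ite_add_ite]
  refine if_congr Iff.rfl ?_ (if_congr Iff.rfl ?_ (if_congr Iff.rfl ?_ (if_congr Iff.rfl ?_
    (if_congr Iff.rfl ?_ (if_congr Iff.rfl ?_ (if_congr Iff.rfl ?_ (if_congr Iff.rfl ?_
    (if_congr Iff.rfl ?_ (if_congr Iff.rfl ?_ (if_congr Iff.rfl ?_ (if_congr Iff.rfl ?_ ?_)))))))))))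
    <;> ring

theorem spinAction_halfSpinor_smul (u : QuadSpace) (r : ℂ) (x : SpinIdx → ℂ) :
    spinAction u (halfSpinor (r • x)) = r • spinAction u (halfSpinor x) := by
  have h : halfSpinor (r • x) = r • halfSpinor x := by
    simp [halfSpinor, Finset.smul_sum, smul_smul]
  rw [h, spinAction, spinAction, map_smul, mul_smul_comm, smul_add]

theorem smul_mem_rhoImage {t₀ t₁ : ℂ} {v : GVertex} {x : SpinIdx → ℂ} (r : ℂ)
    (hx : x ∈ rhoImage t₀ t₁ v) : r • x ∈ rhoImage t₀ t₁ v := by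
  obtain ⟨y, hy, hy0, hrank, hann⟩ := hx
  refine ⟨y, hy, hy0, hrank, fun u hu => ?_⟩
  rw [spinAction_halfSpinor_smul, hann u hu, smul_zero]

/-! ### Equations and arcs of the family that survive the passage to the limit. -/

/-- Coefficients of the equations of the curves in rescaled coordinates: quadrics that generate the
ideals of the curves and of their limits as `t → 1`, and a quartic that has to be added for the
limit as `t → ∞`. -/
def equations {R : Type*} [CommRing R] (t₀ t₁ : R) (z : Fin 7 → R) : Fin 11 → R :=
  ![z 0 * z 4 - t₀ * z 1 * z 3,
    z 3 * (-z 0 - t₁ * z 3 + z 4 - t₁ * z 6 + z 1),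
    (t₀ - t₁) * z 1 * z 3 + t₁ * z 2 * z 3 - z 2 * z 4,
    z 3 * (z 2 - z 4 + t₁ * z 5 - z 1),
    z 2 * (-z 0 + z 1 - t₁ * z 3 + z 4),
    z 2 * z 6, z 1 * z 5, z 0 * z 5, z 1 * z 6,
    t₁ * z 3 * z 5 - z 4 * z 5 + z 4 * z 6,
    z 3 * z 5 * z 6 * (z 5 - z 3 - z 6)]

theorem map_equations {R S : Type*} [CommRing R] [CommRing S] (f : R →+* S) (t₀ t₁ : R)
    (z : Fin 7 → R) (j : Fin 11) :
    f (equations t₀ t₁ z j) = equations (f t₀) (f t₁) (fun i => f (z i)) j := by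
  fin_cases j <;> simp [equations]

/-- The quadrics come from the $g_j$ by removing factors. For instance, $g_1+g_2$ and $g_3-g_2$ are
$t_1(t_0-t_1)$ times entries 1 and 3, and $g_7-g_9$ is $t_1$ times entry 7. -/
theorem equations_eq_zero_of_mem_scaledComponent {t₀ t₁ : ℂ} (ht₁ : t₁ ≠ 0)
    {v : GVertex} {z : Fin 7 → ℂ} (hz : z ∈ scaledComponent t₀ t₁ v) (j : Fin 11) :
    equations t₀ t₁ z j = 0 := by
  cases v <;> simp only [scaledComponent, nodComponent, unscale, Set.mem_ofPred_eq,
    Matrix.cons_val] at hz <;> obtain ⟨h1, h2, h3, h4, h5⟩ := hz <;>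
  fin_cases j <;> simp only [equations, Fin.reduceFinMk, Fin.zero_eta, Fin.mk_one,
    Matrix.cons_val] <;> grind

theorem eval_param_eq_zero {p₀ p₁ : Polynomial ℂ}
    (hp : ∀ τ ∈ chartBase, p₀.eval τ ≠ 0 ∧ p₁.eval τ ≠ 0 ∧ p₀.eval τ - p₁.eval τ ≠ 0)
    {v : GVertex} (hN : nodeLocus (p₀.eval 2) (p₁.eval 2) 1 3 v ≠ 0) {c : ℂ}
    {f : MvPolynomial SpinIdx ℂ}
    (hf : f ∈ flatLimit chartBase (fun τ => rhoImage (p₀.eval τ) (p₁.eval τ) v) c) (a b : ℂ) :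
    eval (spinVec (p₀.eval c) (p₁.eval c) (param (p₀.eval c) (p₁.eval c) a b v)) f = 0 := by
  have hev : ∀ (s : Fin 3 → ℂ) (p : Polynomial ℂ),
      eval s (Polynomial.aeval (X 0 : MvPolynomial (Fin 3) ℂ) p) = p.eval (s 0) := eval_aeval_X
  have hz : ∀ s : Fin 3 → ℂ, (fun i => eval s (param (Polynomial.aeval (X 0) p₀)
      (Polynomial.aeval (X 0) p₁) (X 1) (X 2) v i)) =
      param (p₀.eval (s 0)) (p₁.eval (s 0)) (s 1) (s 2) v := by
    intro s
    funext i
    rw [map_param, hev, hev, eval_X, eval_X]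
  have hD : ∀ s : Fin 3 → ℂ, eval s (nodeLocus (Polynomial.aeval (X 0) p₀)
      (Polynomial.aeval (X 0) p₁) (X 1) (X 2) v * (X 0 * (X 0 - 1))) =
      nodeLocus (p₀.eval (s 0)) (p₁.eval (s 0)) (s 1) (s 2) v * (s 0 * (s 0 - 1)) := by
    intro s
    rw [map_mul, map_nodeLocus, hev, hev]
    simp
  have := eval_spinVec_eq_zero (p₀ := p₀) (p₁ := p₁) (B := chartBase)
    (Y := fun τ => rhoImage (p₀.eval τ) (p₁.eval τ) v)
    (param (Polynomial.aeval (X 0) p₀) (Polynomial.aeval (X 0) p₁) (X 1) (X 2) v)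
    (D := nodeLocus (Polynomial.aeval (X 0) p₀)
      (Polynomial.aeval (X 0) p₁) (X 1) (X 2) v * (X 0 * (X 0 - 1))) (fun h0 => ?_)
    (fun s hs => ?_) ![c, a, b] hf
  · rwa [hz] at this
  · have h := hD ![2, 1, 3]
    rw [h0, map_zero] at h
    simp only [Matrix.cons_val] at h
    refine mul_ne_zero hN ?_ h.symm
    norm_num
  · rw [hD] at hs
    rw [hz]
    have hs0 : s 0 ∈ chartBase := ⟨fun h => hs (by rw [h]; ring), fun h => hs (by rw [h]; ring)⟩
    obtain ⟨h0, h1, hd⟩ := hp _ hs0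
    exact ⟨hs0, spinVec_param_mem_rhoImage h0 h1 hd (left_ne_zero_of_mul hs)⟩

/-- A second parametrization of the conic, which stays nonconstant on the other component of its
limit as `t → 1`. -/
def conicParam {R : Type*} [CommRing R] (t m k : R) : Fin 7 → R :=
  ![m * (m + (t - 1) * k) - m * (m - k), m * (m + (t - 1) * k) - (m + (t - 1) * k) * (m - k),
    m * (m + (t - 1) * k), m * (m - k), (m + (t - 1) * k) * (m - k), 0, 0]

theorem map_conicParam {R S : Type*} [CommRing R] [CommRing S] (f : R →+* S) (t m k : R)
    (i : Fin 7) : f (conicParam t m k i) = conicParam (f t) (f m) (f k) i := by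
  fin_cases i <;> simp [conicParam]

/-- With $b=a+(t-1)k$ the parameters concentrate near $a=b$, where the first parametrization
vanishes at $t=1$. Dividing out $t-1$ before specializing reveals the second line of the degenerate
conic. -/
theorem param_eq_smul_conicParam (t m k : ℂ) :
    param t 1 m (m + (t - 1) * k) .v34 = (t - 1) • conicParam t m k := by
  funext i
  fin_cases i <;> simp [param, conicParam] <;> ring

theorem eval_conicParam_eq_zero {f : MvPolynomial SpinIdx ℂ} {c : ℂ}
    (hf : f ∈ flatLimit chartBase (fun τ => rhoImage τ 1 .v34) c) (m k : ℂ) :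
    eval (spinVec c 1 (conicParam c m k)) f = 0 := by
  have hz : ∀ s : Fin 3 → ℂ, (fun i => eval s (conicParam (X 0) (X 1) (X 2) i)) =
      conicParam (s 0) (s 1) (s 2) := by
    intro s
    funext i
    rw [map_conicParam, eval_X, eval_X, eval_X]
  have hD : ∀ s : Fin 3 → ℂ, eval s (nodeLocus (X 0) 1 (X 1) (X 1 + (X 0 - 1) * X 2) .v34 *
      (X 0 * (X 0 - 1))) =
      nodeLocus (s 0) 1 (s 1) (s 1 + (s 0 - 1) * s 2) .v34 * (s 0 * (s 0 - 1)) := by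
    intro s
    rw [map_mul, map_nodeLocus]
    simp
  have := eval_spinVec_eq_zero (p₀ := Polynomial.X) (p₁ := 1) (B := chartBase)
    (Y := fun τ => rhoImage τ 1 .v34) (conicParam (X 0) (X 1) (X 2))
    (D := nodeLocus (X 0) 1 (X 1) (X 1 + (X 0 - 1) * X 2) .v34 * (X 0 * (X 0 - 1)))
    (fun h0 => ?_) (fun s hs => ?_) ![c, m, k] hf
  · rw [hz] at this
    simpa using this
  · have h := hD ![2, 1, 2]
    rw [h0, map_zero] at h
    simp only [nodeLocus, Matrix.cons_val] at h
    norm_num at h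
  · rw [hD] at hs
    rw [hz]
    have hs0 : s 0 ∈ chartBase := ⟨fun h => hs (by rw [h]; ring), fun h => hs (by rw [h]; ring)⟩
    have hd : s 0 - 1 ≠ 0 := sub_ne_zero.2 hs0.2
    refine ⟨hs0, ?_⟩
    have hmem := smul_mem_rhoImage (s 0 - 1)⁻¹
      (spinVec_param_mem_rhoImage hs0.1 one_ne_zero hd (left_ne_zero_of_mul hs))
    rw [param_eq_smul_conicParam, spinVec_smul, smul_smul, inv_mul_cancel₀ hd, one_smul] at hmem
    simpa using hmem

/-! ### Ideals of unions of lines -/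

/-- Think of $P_i$ as the ideal of a component, and of $g_i$ as a function vanishing on all later
components but not on the $i$-th. The generators $g_i$ are dropped from $I+(g_0,\dots,g_{n-1})$
starting with the last: if $f=a+rg_i$ with $a\in I+(g_k)_{k<i}$, then $rg_i\in P_i$. Primality gives
$r\in P_i$, whence $rg_i$ already lies in the smaller ideal. -/
theorem mem_of_shelling {A : Type*} [CommRing A] {n : ℕ} {I : Ideal A} {P : Fin n → Ideal A}
    {g : Fin n → A} (hP : ∀ i, (P i).IsPrime) (hI : ∀ i, I ≤ P i) (hg : ∀ i, g i ∉ P i)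
    (hgk : ∀ i k, k < i → g k ∈ P i)
    (hmul : ∀ i, ∀ p ∈ P i, g i * p ∈ I ⊔ Ideal.span {x | ∃ k, k < i ∧ x = g k}) {f : A}
    (hf : f ∈ I ⊔ Ideal.span (Set.range g)) (hfP : ∀ i, f ∈ P i) : f ∈ I := by
  have key : ∀ m ≤ n, f ∈ I ⊔ Ideal.span {x | ∃ k : Fin n, (k : ℕ) < m ∧ x = g k} → f ∈ I := by
    intro m
    induction m with
    | zero =>
      intro _ h
      simpa using h
    | succ m ih =>
      intro hm h
      refine ih (by omega) ?_
      set i : Fin n := ⟨m, hm⟩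
      set K := I ⊔ Ideal.span {x | ∃ k : Fin n, (k : ℕ) < m ∧ x = g k} with hK
      have hKP : K ≤ P i := by
        refine sup_le (hI i) (Ideal.span_le.2 ?_)
        rintro _ ⟨k, hk, rfl⟩
        exact hgk i k (Fin.lt_def.2 hk)
      have h' : f ∈ K ⊔ Ideal.span {g i} := by
        refine SetLike.le_def.1 (sup_le (le_sup_of_le_left le_sup_left)
          (Ideal.span_le.2 ?_)) h
        rintro _ ⟨k, hk, rfl⟩
        rcases (Nat.lt_succ_iff.1 hk).eq_or_lt with hk | hk
        · have : k = i := Fin.ext hk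
          rw [this]
          exact Ideal.mem_sup_right (Ideal.subset_span rfl)
        · exact Ideal.mem_sup_left (Ideal.mem_sup_right (Ideal.subset_span ⟨k, hk, rfl⟩))
      obtain ⟨a, ha, b, hb, rfl⟩ := Submodule.mem_sup.1 h'
      obtain ⟨r, rfl⟩ := Ideal.mem_span_singleton.1 hb
      have hr : r ∈ P i := by
        have h1 := (P i).sub_mem (hfP i) (hKP ha)
        rw [add_sub_cancel_left] at h1
        exact ((hP i).mem_or_mem h1).resolve_left (hg i)
      exact K.add_mem ha (hmul i r hr)
  refine key n le_rfl ?_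
  convert hf using 3
  ext x
  simp [eq_comm]

/-- A set with a polynomial retraction `r` onto it: its ideal is generated by the `X j - r j`. -/
theorem vanishingIdeal_le_span_of_retract {n : ℕ} {W : Set (Fin n → ℂ)}
    (r : Fin n → MvPolynomial (Fin n) ℂ) (hr : ∀ z, (fun j => eval z (r j)) ∈ W) :
    vanishingIdeal ℂ W ≤ Ideal.span (Set.range fun j => X j - r j) := by
  intro f hf
  have h0 : aeval r f = 0 := by
    refine MvPolynomial.funext fun z => ?_
    rw [eval_aeval_eq, map_zero]
    exact hf _ (hr z)
  -- Modulo the $X_j-r_j$ every polynomial equals its composition with the retraction, and for `f`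
  -- this composition is zero.
  have h1 : ∀ p : MvPolynomial (Fin n) ℂ,
      p - aeval r p ∈ Ideal.span (Set.range fun j => X j - r j) := by
    intro p
    induction p using MvPolynomial.induction_on with
    | C a => simp
    | add p q hp hq =>
      rw [map_add, add_sub_add_comm]
      exact Ideal.add_mem _ hp hq
    | mul_X p j hp =>
      rw [map_mul, aeval_X, show p * X j - aeval r p * r j =
        X j * (p - aeval r p) + aeval r p * (X j - r j) by ring]
      exact Ideal.add_mem _ (Ideal.mul_mem_left _ _ hp)
        (Ideal.mul_mem_left _ _ (Ideal.subset_span ⟨j, rfl⟩))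
  have := h1 f
  rwa [h0, sub_zero] at this

/-- The vanishing ideal of a parametrized set is the kernel of the pullback to a polynomial ring,
which is a domain. -/
theorem isPrime_vanishingIdeal_of_param {σ ι : Type} {W : Set (σ → ℂ)}
    (r : σ → MvPolynomial ι ℂ) (hr : W = Set.range fun s => fun j => eval s (r j)) :
    (vanishingIdeal ℂ W).IsPrime := by
  have : vanishingIdeal ℂ W = RingHom.ker (aeval r : MvPolynomial (σ) ℂ →ₐ[ℂ] _) := by
    ext f
    rw [RingHom.mem_ker]
    constructor
    · intro hf
      refine MvPolynomial.funext fun s => ?_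
      rw [eval_aeval_eq, map_zero]
      exact hf _ (hr ▸ ⟨s, rfl⟩)
    · rintro hf x hx
      rw [hr] at hx
      obtain ⟨s, rfl⟩ := hx
      change eval _ f = 0
      rw [← eval_aeval_eq, hf, map_zero]
  rw [this]
  exact RingHom.ker_isPrime _

/-! ### Equations of the limit curves -/

/-- The twelve lines in the limit as `t → 1`. -/
def lineOne {R : Type*} [CommRing R] (a b : R) : Fin 12 → Fin 7 → R :=
  ![![a, 0, 0, 0, 0, 0, b], ![a, b, 0, 0, 0, 0, 0], ![a, a, b, 0, 0, 0, 0],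
    ![-a, -b, 0, a, b, 0, 0], ![a - b, a - b, a, b, b, 0, 0], ![0, 0, a - b, a, a, b, 0],
    ![0, 0, 0, a - b, a, a, b], ![0, 0, 0, 0, a, b, b], ![0, 0, 0, 0, 0, a, b],
    ![-(a + b), 0, 0, a, 0, 0, b], ![0, a, 0, 0, b, 0, 0], ![0, 0, a, 0, 0, b, 0]]

/-- Coordinates on the lines `lineOne`. -/
def pivotsOne : Fin 12 → Fin 7 × Fin 7 :=
  ![(0, 6), (0, 1), (0, 2), (3, 4), (2, 3), (3, 5), (5, 6), (4, 5), (5, 6), (3, 6), (1, 4), (2, 5)]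

/-- The order in which the lines are removed from the limit as `t → 1`. -/
def orderOne : Fin 12 → Fin 12 := ![0, 1, 10, 2, 11, 3, 4, 5, 9, 6, 7, 8]

/-- Equations that cut out the lines that remain at each step. -/
def shellOne {R : Type*} [CommRing R] (z : Fin 7 → R) : Fin 12 → R :=
  ![z 0 * z 6 * (z 0 + z 3 + z 6), z 0 * (-z 0 + z 4 + z 1 - z 3 - z 6),
    z 1 * (-z 0 + z 4 + z 1 - z 3 - z 6), z 0 * (z 1 - z 2 + z 4), z 2 * (z 2 - z 4 - z 1 + z 5),
    z 1 * (z 0 - z 1), z 1, z 2, z 0, z 3, z 4, 1]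

/-- The ring is arbitrary so that the statement can be applied to the residue classes of the
variables modulo the ideal reached at stage `i`; membership in that ideal becomes an equation. -/
theorem lineOne_shelling {A : Type*} [CommRing A] {z : Fin 7 → A}
    (hz : ∀ j, equations 1 1 z j = 0) (i : Fin 12) (hs : ∀ k, k < i → shellOne z k = 0)
    (j : Fin 7) : shellOne z i * (z j - lineOne (z (pivotsOne (orderOne i)).1)
      (z (pivotsOne (orderOne i)).2) (orderOne i) j) = 0 := by
  have h0 := hz 0
  have h1 := hz 1
  have h2 := hz 2
  have h3 := hz 3
  have h4 := hz 4
  have h5 := hz 5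
  have h6 := hz 6
  have h7 := hz 7
  have h8 := hz 8
  have h9 := hz 9
  have s0 := hs 0
  have s1 := hs 1
  have s2 := hs 2
  have s3 := hs 3
  have s4 := hs 4
  have s5 := hs 5
  have s6 := hs 6
  have s7 := hs 7
  have s8 := hs 8
  have s9 := hs 9
  have s10 := hs 10
  clear hs hz
  simp only [equations, Matrix.cons_val, one_mul, sub_self, zero_mul, zero_add] at h0 h1 h2 h3 h4 h5 h6 h7 h8 h9
  simp only [shellOne, Matrix.cons_val] at s0 s1 s2 s3 s4 s5 s6 s7 s8 s9 s10
  fin_cases i <;> fin_cases j <;>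
    simp only [shellOne, lineOne, pivotsOne, orderOne, Fin.reduceFinMk, Fin.zero_eta, Fin.mk_one,
      Matrix.cons_val, sub_self, mul_zero] <;>
    simp only [Fin.reduceFinMk, Fin.zero_eta, Fin.mk_one, Fin.reduceLT, forall_const] at * <;>
    grind

/-- The lines in the limit as `t → ∞`. -/
def lineInfty {R : Type*} [CommRing R] (a b : R) : Fin 10 → Fin 7 → R :=
  ![![a, 0, 0, 0, 0, 0, b], ![a, b, 0, 0, 0, 0, 0], ![0, a, 0, 0, b, 0, 0],
    ![0, 0, 0, 0, a, b, b], ![0, 0, a, 0, 0, b, 0], ![a, a, b, 0, 0, 0, 0],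
    ![0, 0, 0, a, 0, b, 0], ![0, 0, 0, a - b, 0, a, b], ![0, 0, 0, 0, 0, a, b],
    ![0, 0, 0, a, 0, 0, b]]

/-- Coordinates on the lines `lineInfty`. -/
def pivotsInfty : Fin 10 → Fin 7 × Fin 7 :=
  ![(0, 6), (0, 1), (1, 4), (4, 5), (2, 5), (0, 2), (3, 5), (5, 6), (5, 6), (3, 6)]

/-- Equations that cut out the lines that remain at each step, and the conic. -/
def shellInfty {R : Type*} [CommRing R] (z : Fin 7 → R) : Fin 10 → R :=
  ![z 0 * z 6, z 0 * (-z 0 + z 4 + z 1), z 1 * (-z 0 + z 4 + z 1), -z 0 + z 4 + z 1, z 2 * z 5,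
    z 2 - z 4 - z 1, z 3 * z 5 * (z 3 - z 5 + z 6), z 3 * z 5, z 5, z 6]

/-- The last four lines are coplanar and the quadrics do not distinguish them. The quartic is, up to
sign, $z_6$ times the shelling form with index 6, and this splits off the first of the four. -/
theorem lineInfty_shelling {A : Type*} [CommRing A] {z : Fin 7 → A}
    (hz : ∀ j, equations 1 0 z j = 0) (i : Fin 10) (hs : ∀ k, k < i → shellInfty z k = 0)
    (j : Fin 7) : shellInfty z i * (z j - lineInfty (z (pivotsInfty i).1)
      (z (pivotsInfty i).2) i j) = 0 := by
  have h0 := hz 0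
  have h1 := hz 1
  have h2 := hz 2
  have h3 := hz 3
  have h4 := hz 4
  have h5 := hz 5
  have h6 := hz 6
  have h7 := hz 7
  have h8 := hz 8
  have h9 := hz 9
  have h10 := hz 10
  have s0 := hs 0
  have s1 := hs 1
  have s2 := hs 2
  have s3 := hs 3
  have s4 := hs 4
  have s5 := hs 5
  have s6 := hs 6
  have s7 := hs 7
  have s8 := hs 8
  clear hs hz
  simp only [equations, Matrix.cons_val, one_mul, sub_zero, zero_mul, add_zero, zero_sub]
    at h0 h1 h2 h3 h4 h5 h6 h7 h8 h9 h10
  simp only [shellInfty, Matrix.cons_val] at s0 s1 s2 s3 s4 s5 s6 s7 s8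
  fin_cases i <;> fin_cases j <;>
    simp only [shellInfty, lineInfty, pivotsInfty, Fin.reduceFinMk, Fin.zero_eta, Fin.mk_one,
      Matrix.cons_val, sub_self, mul_zero] <;>
    simp only [Fin.reduceFinMk, Fin.zero_eta, Fin.mk_one, Fin.reduceLT, forall_const] at * <;>
    grind

/-- After all ten lines have been removed, only the conic is left; it is treated by a normal form
argument instead of a further shelling step. -/
theorem shellInfty_conic {A : Type*} [CommRing A] {z : Fin 7 → A}
    (hz : ∀ j, equations 1 0 z j = 0) (hs : ∀ k, shellInfty z k = 0) :
    z 5 = 0 ∧ z 6 = 0 ∧ z 1 = z 2 - z 4 ∧ z 0 = z 2 ∧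
      (z 2 - z 4) * (z 3 - z 4) = z 4 * z 4 := by
  have h2 := hz 2
  have s3 := hs 3
  have s5 := hs 5
  have s8 := hs 8
  have s9 := hs 9
  clear hs hz
  simp only [equations, shellInfty, Matrix.cons_val] at h2 s3 s5 s8 s9
  refine ⟨s8, s9, ?_, ?_, ?_⟩ <;> grind

section Maps

variable {R S : Type*} [CommRing R] [CommRing S] (f : R →+* S)

theorem map_lineOne (a b : R) (i : Fin 12) (j : Fin 7) :
    f (lineOne a b i j) = lineOne (f a) (f b) i j := by
  fin_cases i <;> simp only [lineOne, Fin.reduceFinMk, Fin.zero_eta, Fin.mk_one,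
    Matrix.cons_val] <;>
    fin_cases j <;> simp

theorem map_lineInfty (a b : R) (i : Fin 10) (j : Fin 7) :
    f (lineInfty a b i j) = lineInfty (f a) (f b) i j := by
  fin_cases i <;> simp only [lineInfty, Fin.reduceFinMk, Fin.zero_eta, Fin.mk_one,
    Matrix.cons_val] <;>
    fin_cases j <;> simp

theorem map_shellOne (z : Fin 7 → R) (i : Fin 12) :
    f (shellOne z i) = shellOne (fun j => f (z j)) i := by
  fin_cases i <;> simp [shellOne]

theorem map_shellInfty (z : Fin 7 → R) (i : Fin 10) :
    f (shellInfty z i) = shellInfty (fun j => f (z j)) i := by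
  fin_cases i <;> simp [shellInfty]

end Maps

theorem equations_lineOne (a b : ℂ) (i : Fin 12) (j : Fin 11) :
    equations 1 1 (lineOne a b i) j = 0 := by
  fin_cases i <;> simp only [equations, lineOne, Fin.reduceFinMk, Fin.zero_eta, Fin.mk_one,
    Matrix.cons_val] <;> fin_cases j <;> simp only [Fin.reduceFinMk, Fin.zero_eta, Fin.mk_one,
    Matrix.cons_val] <;> ring

theorem equations_lineInfty (a b : ℂ) (i : Fin 10) (j : Fin 11) :
    equations 1 0 (lineInfty a b i) j = 0 := by
  fin_cases i <;> simp only [equations, lineInfty, Fin.reduceFinMk, Fin.zero_eta, Fin.mk_one,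
    Matrix.cons_val] <;> fin_cases j <;> simp only [Fin.reduceFinMk, Fin.zero_eta, Fin.mk_one,
    Matrix.cons_val] <;> ring

theorem shellOne_lineOne_of_lt (a b : ℂ) (i k : Fin 12) (h : k < i) :
    shellOne (lineOne a b (orderOne i)) k = 0 := by
  fin_cases i <;> simp only [shellOne, lineOne, orderOne, Fin.reduceFinMk, Fin.zero_eta, Fin.mk_one,
    Matrix.cons_val] <;>
    fin_cases k <;> first | (exact absurd h (by decide)) | (simp only [Fin.reduceFinMk, Fin.zero_eta, Fin.mk_one,
    Matrix.cons_val] <;> ring)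

theorem shellInfty_lineInfty_of_lt (a b : ℂ) (i k : Fin 10) (h : k < i) :
    shellInfty (lineInfty a b i) k = 0 := by
  fin_cases i <;> simp only [shellInfty, lineInfty, Fin.reduceFinMk, Fin.zero_eta, Fin.mk_one,
    Matrix.cons_val] <;>
    fin_cases k <;> first | (exact absurd h (by decide)) | (simp only [Fin.reduceFinMk, Fin.zero_eta, Fin.mk_one,
    Matrix.cons_val] <;> ring)

theorem shellOne_lineOne_ne_zero (i : Fin 12) :
    shellOne (lineOne (1 : ℂ) 3 (orderOne i)) i ≠ 0 := by
  fin_cases i <;> simp only [shellOne, lineOne, orderOne, Fin.reduceFinMk, Fin.zero_eta, Fin.mk_one,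
    Matrix.cons_val] <;> norm_num

theorem shellInfty_lineInfty_ne_zero (i : Fin 10) :
    shellInfty (lineInfty (1 : ℂ) 3 i) i ≠ 0 := by
  fin_cases i <;> simp only [shellInfty, lineInfty, Fin.reduceFinMk, Fin.zero_eta, Fin.mk_one,
    Matrix.cons_val] <;> norm_num

theorem isPrime_vanishingIdeal_line {n : ℕ}
    (ℓ : ∀ {R : Type} [CommRing R], R → R → Fin n → R)
    (hℓ : ∀ {R S : Type} [CommRing R] [CommRing S] (f : R →+* S) (a b : R) (j : Fin n),
      f (ℓ a b j) = ℓ (f a) (f b) j) :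
    (vanishingIdeal ℂ {z : Fin n → ℂ | ∃ a b, z = ℓ a b}).IsPrime := by
  refine isPrime_vanishingIdeal_of_param (ι := Fin 2) (ℓ (X 0) (X 1)) ?_
  ext z
  constructor
  · rintro ⟨a, b, rfl⟩
    refine ⟨![a, b], funext fun j => ?_⟩
    simp only [hℓ, eval_X, Matrix.cons_val]
  · rintro ⟨s, rfl⟩
    refine ⟨s 0, s 1, funext fun j => ?_⟩
    simp only [hℓ, eval_X]

/-- The map $z\mapsto\ell(z_p,z_q)$ retracts onto the line, so its ideal is generated by the
$X_j-\ell_j$, and it suffices to multiply these by $g$. -/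
theorem mul_mem_of_line {n : ℕ} (ℓ : ∀ {R : Type} [CommRing R], R → R → Fin n → R)
    (hℓ : ∀ {R S : Type} [CommRing R] [CommRing S] (f : R →+* S) (a b : R) (j : Fin n),
      f (ℓ a b j) = ℓ (f a) (f b) j) {K : Ideal (MvPolynomial (Fin n) ℂ)}
    {g : MvPolynomial (Fin n) ℂ} (p q : Fin n)
    (hK : ∀ j, g * (X j - ℓ (X p) (X q) j) ∈ K) {f : MvPolynomial (Fin n) ℂ}
    (hf : f ∈ vanishingIdeal ℂ {z : Fin n → ℂ | ∃ a b, z = ℓ a b}) : g * f ∈ K := by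
  have h := vanishingIdeal_le_span_of_retract (W := {z | ∃ a b, z = ℓ a b}) (ℓ (X p) (X q))
    (fun z => ⟨z p, z q, funext fun j => by simp only [hℓ, eval_X]⟩) hf
  refine Submodule.span_induction (p := fun f _ => g * f ∈ K) ?_ (by simp) ?_ ?_ h
  · rintro _ ⟨j, rfl⟩
    exact hK j
  · intro x y _ _ hx hy
    rw [mul_add]
    exact K.add_mem hx hy
  · intro a x _ hx
    rw [smul_eq_mul, mul_left_comm]
    exact K.mul_mem_left a hx

/-- At $t=1$ the equations generate the whole vanishing ideal of the twelve lines, so that no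
radical or saturation is needed. -/
theorem mem_span_equations_one {f : MvPolynomial (Fin 7) ℂ}
    (h : ∀ i a b, eval (lineOne a b i) f = 0) :
    f ∈ Ideal.span (Set.range (equations 1 1 (X : Fin 7 → MvPolynomial (Fin 7) ℂ))) := by
  have hev : ∀ (z : Fin 7 → ℂ) j, eval z (equations 1 1 X j) = equations 1 1 z j := by
    intro z j
    rw [map_equations]
    simp
  have hevs : ∀ (z : Fin 7 → ℂ) j, eval z (shellOne X j) = shellOne z j := by
    intro z j
    rw [map_shellOne]
    simp
  refine mem_of_shelling (P := fun i => vanishingIdeal ℂ {z | ∃ a b, z = lineOne a b (orderOne i)})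
    (g := shellOne X) (fun i => isPrime_vanishingIdeal_line (fun a b => lineOne a b (orderOne i))
      fun f a b j => map_lineOne f a b _ j) ?_ ?_ ?_ ?_ ?_ ?_
  · intro i
    rw [Ideal.span_le]
    rintro _ ⟨j, rfl⟩ _ ⟨a, b, rfl⟩
    exact (hev _ j).trans (equations_lineOne a b _ j)
  · intro i hi
    exact shellOne_lineOne_ne_zero i ((hevs _ i).symm.trans (hi _ ⟨1, 3, rfl⟩))
  · rintro i k hk _ ⟨a, b, rfl⟩
    exact (hevs _ k).trans (shellOne_lineOne_of_lt a b i k hk)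
  · intro i p hp
    refine mul_mem_of_line (fun a b => lineOne a b (orderOne i))
      (fun f a b j => map_lineOne f a b _ j) (pivotsOne (orderOne i)).1
      (pivotsOne (orderOne i)).2 (fun j => ?_) hp
    refine Ideal.Quotient.eq_zero_iff_mem.1 ?_
    rw [map_mul, map_sub, map_shellOne, map_lineOne]
    refine lineOne_shelling (fun j => ?_) i (fun k hk => ?_) j
    · have : equations (1 : MvPolynomial (Fin 7) ℂ) 1 X j ∈ Ideal.span (Set.range (equations 1 1 X))
          ⊔ Ideal.span {x | ∃ k, k < i ∧ x = shellOne (X : Fin 7 → MvPolynomial (Fin 7) ℂ) k} :=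
        Ideal.mem_sup_left (Ideal.subset_span ⟨j, rfl⟩)
      rw [← Ideal.Quotient.eq_zero_iff_mem, map_equations, map_one] at this
      exact this
    · rw [← map_shellOne]
      exact Ideal.Quotient.eq_zero_iff_mem.2
        (Ideal.mem_sup_right (Ideal.subset_span ⟨k, hk, rfl⟩))
  -- The last shelling form is $1$, since nothing remains to be cut out after the last line. Thus
  -- the starting ideal of the descent is the unit ideal.
  · have : (1 : MvPolynomial (Fin 7) ℂ) ∈ Ideal.span (Set.range (shellOne
        (X : Fin 7 → MvPolynomial (Fin 7) ℂ))) := Ideal.subset_span ⟨11, rfl⟩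
    rw [(Ideal.eq_top_iff_one _).2 this, sup_top_eq]
    trivial
  · rintro i _ ⟨a, b, rfl⟩
    exact h _ a b

/-! ### The degeneration of the conic as $t\to1$, and the limit conic as $t\to\infty$. -/

/-- The defining equations of the conic in rescaled coordinates. -/
def conicEquations {R : Type*} [CommRing R] (t₀ t₁ : R) (z : Fin 7 → R) : Fin 5 → R :=
  ![t₀ * z 2 * z 3 - z 2 * z 4 - (t₀ - t₁) * z 3 * z 4, z 5, z 6, z 1 - z 2 + z 4,
    z 0 - z 2 + t₁ * z 3]

theorem map_conicEquations {R S : Type*} [CommRing R] [CommRing S] (f : R →+* S) (t₀ t₁ : R)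
    (z : Fin 7 → R) (j : Fin 5) :
    f (conicEquations t₀ t₁ z j) = conicEquations (f t₀) (f t₁) (fun i => f (z i)) j := by
  fin_cases j <;> simp [conicEquations]

theorem conicEquations_eq_zero {t₀ t₁ : ℂ} (ht₁ : t₁ ≠ 0) {z : Fin 7 → ℂ}
    (hz : z ∈ scaledComponent t₀ t₁ .v34) (j : Fin 5) : conicEquations t₀ t₁ z j = 0 := by
  simp only [scaledComponent, nodComponent, unscale, Set.mem_ofPred_eq, Matrix.cons_val] at hz
  obtain ⟨h1, h2, h3, h4, h5⟩ := hz
  fin_cases j <;> simp only [conicEquations, Fin.reduceFinMk, Fin.zero_eta, Fin.mk_one,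
    Matrix.cons_val] <;> grind

/-- The two lines into which the conic degenerates as `t → 1`. -/
def edgeLines : Fin 2 → Fin 12 := ![3, 4]

/-- Equations that cut out one of the lines `edgeLines`. -/
def shellEdge {R : Type*} [CommRing R] (z : Fin 7 → R) : Fin 2 → R := ![z 3 - z 4, 1]

theorem map_shellEdge {R S : Type*} [CommRing R] [CommRing S] (f : R →+* S) (z : Fin 7 → R)
    (i : Fin 2) : f (shellEdge z i) = shellEdge (fun j => f (z j)) i := by
  fin_cases i <;> simp [shellEdge]

theorem edgeLines_shelling {A : Type*} [CommRing A] {z : Fin 7 → A}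
    (hz : ∀ j, conicEquations 1 1 z j = 0) (i : Fin 2) (hs : ∀ k, k < i → shellEdge z k = 0)
    (j : Fin 7) : shellEdge z i * (z j - lineOne (z (pivotsOne (edgeLines i)).1)
      (z (pivotsOne (edgeLines i)).2) (edgeLines i) j) = 0 := by
  have h0 := hz 0
  have h1 := hz 1
  have h2 := hz 2
  have h3 := hz 3
  have h4 := hz 4
  have s0 := hs 0
  clear hs hz
  simp only [conicEquations, Matrix.cons_val, one_mul, sub_self, zero_mul, sub_zero]
    at h0 h1 h2 h3 h4
  simp only [shellEdge, Matrix.cons_val] at s0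
  fin_cases i <;> fin_cases j <;>
    simp only [shellEdge, lineOne, pivotsOne, edgeLines, Fin.reduceFinMk, Fin.zero_eta, Fin.mk_one,
      Matrix.cons_val, sub_self, mul_zero] <;>
    simp only [Fin.zero_eta, Fin.mk_one, Fin.reduceLT, forall_const] at * <;>
    grind

theorem mem_span_conicEquations_one {f : MvPolynomial (Fin 7) ℂ}
    (h : ∀ i a b, eval (lineOne a b (edgeLines i)) f = 0) :
    f ∈ Ideal.span (Set.range (conicEquations 1 1 (X : Fin 7 → MvPolynomial (Fin 7) ℂ))) := by
  have hev : ∀ (z : Fin 7 → ℂ) j, eval z (conicEquations 1 1 X j) = conicEquations 1 1 z j := by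
    intro z j
    rw [map_conicEquations]
    simp
  have hevs : ∀ (z : Fin 7 → ℂ) j, eval z (shellEdge X j) = shellEdge z j := by
    intro z j
    rw [map_shellEdge]
    simp
  refine mem_of_shelling (P := fun i => vanishingIdeal ℂ {z | ∃ a b, z = lineOne a b (edgeLines i)})
    (g := shellEdge X) (fun i => isPrime_vanishingIdeal_line (fun a b => lineOne a b (edgeLines i))
      fun f a b j => map_lineOne f a b _ j) ?_ ?_ ?_ ?_ ?_ ?_
  · intro i
    rw [Ideal.span_le]
    rintro _ ⟨j, rfl⟩ _ ⟨a, b, rfl⟩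
    refine (hev _ j).trans ?_
    fin_cases i <;> fin_cases j <;> simp [conicEquations, lineOne, edgeLines]
  · intro i hi
    have := (hevs _ i).symm.trans (hi _ ⟨1, 3, rfl⟩)
    fin_cases i <;> simp only [shellEdge, lineOne, edgeLines, Fin.zero_eta, Fin.mk_one,
      Matrix.cons_val] at this <;> norm_num at this
  · rintro i k hk _ ⟨a, b, rfl⟩
    refine (hevs _ k).trans ?_
    fin_cases i <;> fin_cases k <;>
      first | (exact absurd hk (by decide)) | (simp [shellEdge, lineOne, edgeLines])
  · intro i p hp
    refine mul_mem_of_line (fun a b => lineOne a b (edgeLines i))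
      (fun f a b j => map_lineOne f a b _ j) (pivotsOne (edgeLines i)).1
      (pivotsOne (edgeLines i)).2 (fun j => ?_) hp
    refine Ideal.Quotient.eq_zero_iff_mem.1 ?_
    rw [map_mul, map_sub, map_shellEdge, map_lineOne]
    refine edgeLines_shelling (fun j => ?_) i (fun k hk => ?_) j
    · have : conicEquations (1 : MvPolynomial (Fin 7) ℂ) 1 X j ∈
          Ideal.span (Set.range (conicEquations 1 1 X)) ⊔
          Ideal.span {x | ∃ k, k < i ∧ x = shellEdge (X : Fin 7 → MvPolynomial (Fin 7) ℂ) k} :=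
        Ideal.mem_sup_left (Ideal.subset_span ⟨j, rfl⟩)
      rw [← Ideal.Quotient.eq_zero_iff_mem, map_conicEquations, map_one] at this
      exact this
    · rw [← map_shellEdge]
      exact Ideal.Quotient.eq_zero_iff_mem.2
        (Ideal.mem_sup_right (Ideal.subset_span ⟨k, hk, rfl⟩))
  · have : (1 : MvPolynomial (Fin 7) ℂ) ∈ Ideal.span (Set.range (shellEdge
        (X : Fin 7 → MvPolynomial (Fin 7) ℂ))) := Ideal.subset_span ⟨1, rfl⟩
    rw [(Ideal.eq_top_iff_one _).2 this, sup_top_eq]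
    trivial
  · rintro i _ ⟨a, b, rfl⟩
    exact h _ a b

/-- The conic in the limit as `t → ∞`. -/
def conicInfty {R : Type*} [CommRing R] (b c : R) : Fin 7 → R :=
  ![b ^ 2 + b * c, b ^ 2, b ^ 2 + b * c, c ^ 2 + b * c, b * c, 0, 0]

/-- Put $u=z_2-z_4$ and $w=z_3-z_4$. As $z_4^2=uw$ in the quotient, every polynomial has a normal
form $A(u,w)+z_4B(u,w)$. At the point with parameters $(b,c)$ this evaluates to
$A(b^2,c^2)+bc\,B(b^2,c^2)$, so vanishing on the conic forces $A=B=0$. -/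
theorem mem_of_vanish_on_conic {K : Ideal (MvPolynomial (Fin 7) ℂ)} {z : Fin 7 → _}
    (hz : z = fun i => Ideal.Quotient.mk K (X i)) (h5 : z 5 = 0) (h6 : z 6 = 0)
    (h1 : z 1 = z 2 - z 4) (h0 : z 0 = z 2) (hq : (z 2 - z 4) * (z 3 - z 4) = z 4 * z 4)
    {f : MvPolynomial (Fin 7) ℂ} (hf : ∀ b c, eval (conicInfty b c) f = 0) : f ∈ K := by
  have key : ∀ f : MvPolynomial (Fin 7) ℂ, ∃ A B : MvPolynomial (Fin 2) ℂ,
      Ideal.Quotient.mk K f = aeval ![z 2 - z 4, z 3 - z 4] A +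
        z 4 * aeval ![z 2 - z 4, z 3 - z 4] B ∧
      ∀ b c, eval (conicInfty b c) f =
        eval ![b ^ 2, c ^ 2] A + b * c * eval ![b ^ 2, c ^ 2] B := by
    intro f
    induction f using MvPolynomial.induction_on with
    | C a =>
      refine ⟨C a, 0, ?_, fun b c => by simp⟩
      rw [map_zero, mul_zero, add_zero, aeval_C]
      rfl
    | add f g hf hg =>
      obtain ⟨A, B, h, h'⟩ := hf
      obtain ⟨A', B', k, k'⟩ := hg
      refine ⟨A + A', B + B', ?_, fun b c => ?_⟩
      · rw [map_add, h, k, map_add, map_add]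
        ring
      · rw [map_add, h', k', map_add, map_add]
        ring
    | mul_X f i hf =>
      obtain ⟨A, B, h, h'⟩ := hf
      have step : ∀ (l γ : MvPolynomial (Fin 2) ℂ),
          z i = aeval ![z 2 - z 4, z 3 - z 4] l + aeval ![z 2 - z 4, z 3 - z 4] γ * z 4 →
          (∀ b c : ℂ, conicInfty b c i =
            eval ![b ^ 2, c ^ 2] l + b * c * eval ![b ^ 2, c ^ 2] γ) →
          ∃ A B : MvPolynomial (Fin 2) ℂ,
            Ideal.Quotient.mk K (f * X i) = aeval ![z 2 - z 4, z 3 - z 4] A +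
              z 4 * aeval ![z 2 - z 4, z 3 - z 4] B ∧
            ∀ b c, eval (conicInfty b c) (f * X i) =
              eval ![b ^ 2, c ^ 2] A + b * c * eval ![b ^ 2, c ^ 2] B := by
        intro l γ hl hl'
        have hzi : Ideal.Quotient.mk K (X i) = z i := by rw [hz]
        refine ⟨A * l + γ * B * X 0 * X 1, B * l + γ * A, ?_, fun b c => ?_⟩
        · rw [map_mul, h, hzi, hl]
          simp only [map_add, map_mul, aeval_X, Matrix.cons_val]
          linear_combination (-aeval ![z 2 - z 4, z 3 - z 4] γ *
            aeval ![z 2 - z 4, z 3 - z 4] B) * hq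
        · rw [map_mul, h', eval_X, hl']
          simp only [map_add, map_mul, eval_X, Matrix.cons_val]
          ring
      fin_cases i
      · refine step (X 0) 1 ?_ fun b c => ?_
        · simp [h0]
        · simp [conicInfty]
      · refine step (X 0) 0 ?_ fun b c => ?_
        · simp [h1]
        · simp [conicInfty]
      · refine step (X 0) 1 ?_ fun b c => ?_
        · simp
        · simp [conicInfty]
      · refine step (X 1) 1 ?_ fun b c => ?_
        · simp
        · simp [conicInfty]
      · refine step 0 1 ?_ fun b c => ?_
        · simp
        · simp [conicInfty]
      · refine step 0 0 ?_ fun b c => ?_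
        · simp [h5]
        · simp [conicInfty]
      · refine step 0 0 ?_ fun b c => ?_
        · simp [h6]
        · simp [conicInfty]
  obtain ⟨A, B, h, h'⟩ := key f
  have hsq : ∀ s : Fin 2 → ℂ, ∃ b c : ℂ, s = ![b ^ 2, c ^ 2] := by
    intro s
    obtain ⟨b, hb⟩ := IsAlgClosed.exists_pow_nat_eq (s 0) (n := 2) (by norm_num)
    obtain ⟨c, hc⟩ := IsAlgClosed.exists_pow_nat_eq (s 1) (n := 2) (by norm_num)
    refine ⟨b, c, ?_⟩
    rw [hb, hc]
    exact (FinVec.etaExpand_eq s).symm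
  -- Replacing $b$ by $-b$ changes the sign of the second term only, which separates the two parts.
  have hAB : ∀ b c : ℂ, eval ![b ^ 2, c ^ 2] A = 0 ∧ b * c * eval ![b ^ 2, c ^ 2] B = 0 := by
    intro b c
    have e1 := h' b c
    have e2 := h' (-b) c
    rw [hf] at e1 e2
    rw [neg_sq] at e2
    constructor
    · linear_combination (-1 / 2) * e1 - (1 / 2) * e2
    · linear_combination (-1 / 2) * e1 + (1 / 2) * e2
  have hA : A = 0 := by
    refine MvPolynomial.funext fun s => ?_
    obtain ⟨b, c, rfl⟩ := hsq s
    rw [(hAB b c).1, map_zero]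
  have hB : X 0 * X 1 * B = 0 := by
    refine MvPolynomial.funext fun s => ?_
    obtain ⟨b, c, rfl⟩ := hsq s
    simp only [map_mul, eval_X, Matrix.cons_val, map_zero]
    linear_combination b * c * (hAB b c).2
  have hB' : B = 0 := (mul_eq_zero.1 hB).resolve_left (mul_ne_zero (X_ne_zero 0) (X_ne_zero 1))
  rw [hA, hB', map_zero, mul_zero, add_zero] at h
  exact Ideal.Quotient.eq_zero_iff_mem.1 h

theorem equations_conicInfty (b c : ℂ) (j : Fin 11) : equations 1 0 (conicInfty b c) j = 0 := by
  simp only [equations, conicInfty, Matrix.cons_val]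
  fin_cases j <;> simp only [Fin.reduceFinMk, Fin.zero_eta, Fin.mk_one, Matrix.cons_val] <;> ring

theorem mem_span_equations_infty {f : MvPolynomial (Fin 7) ℂ}
    (h : ∀ i a b, eval (lineInfty a b i) f = 0) (hc : ∀ b c, eval (conicInfty b c) f = 0) :
    f ∈ Ideal.span (Set.range (equations 1 0 (X : Fin 7 → MvPolynomial (Fin 7) ℂ))) := by
  have hev : ∀ (z : Fin 7 → ℂ) j, eval z (equations 1 0 X j) = equations 1 0 z j := by
    intro z j
    rw [map_equations]
    simp
  have hevs : ∀ (z : Fin 7 → ℂ) j, eval z (shellInfty X j) = shellInfty z j := by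
    intro z j
    rw [map_shellInfty]
    simp
  have hmk : ∀ (K : Ideal (MvPolynomial (Fin 7) ℂ)),
      Ideal.span (Set.range (equations 1 0 X)) ≤ K →
      ∀ j, equations 1 0 (fun i => Ideal.Quotient.mk K (X i)) j = 0 := by
    intro K hK j
    have := Ideal.Quotient.eq_zero_iff_mem.2 (hK (Ideal.subset_span ⟨j, rfl⟩))
    rw [map_equations, map_one, map_zero] at this
    exact this
  refine mem_of_shelling (P := fun i => vanishingIdeal ℂ {z | ∃ a b, z = lineInfty a b i})
    (g := shellInfty X) (fun i => isPrime_vanishingIdeal_line (fun a b => lineInfty a b i)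
      fun f a b j => map_lineInfty f a b _ j) ?_ ?_ ?_ ?_ ?_ ?_
  · intro i
    rw [Ideal.span_le]
    rintro _ ⟨j, rfl⟩ _ ⟨a, b, rfl⟩
    exact (hev _ j).trans (equations_lineInfty a b _ j)
  · intro i hi
    exact shellInfty_lineInfty_ne_zero i ((hevs _ i).symm.trans (hi _ ⟨1, 3, rfl⟩))
  · rintro i k hk _ ⟨a, b, rfl⟩
    exact (hevs _ k).trans (shellInfty_lineInfty_of_lt a b i k hk)
  · intro i p hp
    refine mul_mem_of_line (fun a b => lineInfty a b i)
      (fun f a b j => map_lineInfty f a b _ j) (pivotsInfty i).1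
      (pivotsInfty i).2 (fun j => ?_) hp
    refine Ideal.Quotient.eq_zero_iff_mem.1 ?_
    rw [map_mul, map_sub, map_shellInfty, map_lineInfty]
    refine lineInfty_shelling (hmk _ le_sup_left) i (fun k hk => ?_) j
    rw [← map_shellInfty]
    exact Ideal.Quotient.eq_zero_iff_mem.2
      (Ideal.mem_sup_right (Ideal.subset_span ⟨k, hk, rfl⟩))
  · obtain ⟨h5, h6, h1, h0, hq⟩ := shellInfty_conic (z := fun i => Ideal.Quotient.mk
      (Ideal.span (Set.range (equations 1 0 X)) ⊔
        Ideal.span (Set.range (shellInfty (X : Fin 7 → MvPolynomial (Fin 7) ℂ)))) (X i))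
      (hmk _ le_sup_left) fun k => by
        rw [← map_shellInfty]
        exact Ideal.Quotient.eq_zero_iff_mem.2
          (Ideal.mem_sup_right (Ideal.subset_span ⟨k, rfl⟩))
    exact mem_of_vanish_on_conic rfl h5 h6 h1 h0 hq hc
  · rintro i _ ⟨a, b, rfl⟩
    exact h _ a b

/-! ### The limits -/

theorem eval_aeval_spinVec (t₀ t₁ : ℂ) (z : Fin 7 → ℂ) (f : MvPolynomial SpinIdx ℂ) :
    eval z (aeval (spinVec (C t₀) (C t₁) X) f) = eval (spinVec t₀ t₁ z) f := by
  rw [eval_aeval_eq]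
  congr 2
  funext I
  rw [map_spinVec]
  simp

/-- The span of the images of two vectors. -/
def spinSpan (t₀ t₁ : ℂ) (u w : Fin 7 → ℂ) : Submodule ℂ (SpinIdx → ℂ) :=
  Submodule.span ℂ {spinVec t₀ t₁ u, spinVec t₀ t₁ w}

theorem mem_spinSpan {t₀ t₁ : ℂ} {u w : Fin 7 → ℂ} {x : SpinIdx → ℂ} :
    x ∈ spinSpan t₀ t₁ u w ↔ ∃ a b : ℂ, x = spinVec t₀ t₁ (a • u + b • w) := by
  rw [spinSpan, Submodule.mem_span_pair]
  simp only [spinVec_add, spinVec_smul, eq_comm]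

/-- The lines in `X_1`. -/
def spinLineOne (i : Fin 12) : Submodule ℂ (SpinIdx → ℂ) :=
  spinSpan 1 1 (lineOne 1 0 i) (lineOne 0 1 i)

/-- The lines in `X_∞`. -/
def spinLineInfty (i : Fin 10) : Submodule ℂ (SpinIdx → ℂ) :=
  spinSpan 1 0 (lineInfty 1 0 i) (lineInfty 0 1 i)

/-- The conic in `X_∞`. -/
def spinConicInfty : Set (SpinIdx → ℂ) := {x | ∃ b c, x = spinVec 1 0 (conicInfty b c)}

theorem lineOne_eq (a b : ℂ) (i : Fin 12) :
    lineOne a b i = a • lineOne 1 0 i + b • lineOne 0 1 i := by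
  fin_cases i <;> simp only [lineOne, Fin.reduceFinMk, Fin.zero_eta, Fin.mk_one,
    Matrix.cons_val] <;> funext j <;> fin_cases j <;> simp [sub_eq_add_neg, add_comm]

theorem lineInfty_eq (a b : ℂ) (i : Fin 10) :
    lineInfty a b i = a • lineInfty 1 0 i + b • lineInfty 0 1 i := by
  fin_cases i <;> simp only [lineInfty, Fin.reduceFinMk, Fin.zero_eta, Fin.mk_one,
    Matrix.cons_val] <;> funext j <;> fin_cases j <;> simp [sub_eq_add_neg]

theorem mem_spinLineOne {i : Fin 12} {x : SpinIdx → ℂ} :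
    x ∈ spinLineOne i ↔ ∃ a b, x = spinVec 1 1 (lineOne a b i) := by
  simp only [spinLineOne, mem_spinSpan, ← lineOne_eq]

theorem mem_spinLineInfty {i : Fin 10} {x : SpinIdx → ℂ} :
    x ∈ spinLineInfty i ↔ ∃ a b, x = spinVec 1 0 (lineInfty a b i) := by
  simp only [spinLineInfty, mem_spinSpan, ← lineInfty_eq]

/-- If $l(s)\neq0$ and $r^2=l(s)^{-1}$, then $l(rs)\,rs=r^2l(s)\,s=s$, so vanishing at all points
$l(s)s$ gives vanishing wherever $l$ is nonzero. No homogeneity of $g$ is required. -/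
theorem eq_zero_of_eval_smul {g l : MvPolynomial (Fin 2) ℂ} (hl0 : l ≠ 0)
    (hl : ∀ (r : ℂ) s, eval (r • s) l = r * eval s l)
    (h : ∀ s : Fin 2 → ℂ, eval ((eval s l) • s) g = 0) : g = 0 := by
  have : l * g = 0 := by
    refine MvPolynomial.funext fun s => ?_
    rw [map_mul, map_zero]
    by_cases hs : eval s l = 0
    · rw [hs, zero_mul]
    obtain ⟨r, hr⟩ := IsAlgClosed.exists_pow_nat_eq (eval s l)⁻¹ (n := 2) (by norm_num)
    have := h (r • s)
    rw [hl, smul_smul, mul_right_comm, ← sq, hr, inv_mul_cancel₀ hs, one_smul] at this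
    rw [this, mul_zero]
  exact (mul_eq_zero.1 this).resolve_left hl0

theorem eval_lineOne_of_smul {f : MvPolynomial SpinIdx ℂ} {i : Fin 12} (α β : ℂ)
    (hαβ : α + 3 * β ≠ 0)
    (h : ∀ a b : ℂ, eval (spinVec 1 1 ((α * a + β * b) • lineOne a b i)) f = 0) (a b : ℂ) :
    eval (spinVec 1 1 (lineOne a b i)) f = 0 := by
  have hT : ∀ s : Fin 2 → ℂ, eval s (aeval (lineOne (X 0) (X 1) i)
      (aeval (spinVec (C 1) (C 1) X) f : MvPolynomial (Fin 7) ℂ)) =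
      eval (spinVec 1 1 (lineOne (s 0) (s 1) i)) f := by
    intro s
    rw [eval_aeval_eq, ← eval_aeval_spinVec]
    simp only [map_lineOne, eval_X]
  have hl : ∀ s : Fin 2 → ℂ, eval s (C α * X 0 + C β * X 1) = α * s 0 + β * s 1 := by
    intro s
    simp
  have h0 := eq_zero_of_eval_smul (l := C α * X 0 + C β * X 1) (fun h0 => ?_) (fun r s => ?_)
    (g := aeval (lineOne (X 0) (X 1) i) (aeval (spinVec (C 1) (C 1) X) f :
      MvPolynomial (Fin 7) ℂ)) fun s => ?_
  · have := hT ![a, b]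
    rw [h0, map_zero] at this
    exact this.symm
  -- The hypothesis on $\alpha+3\beta$ is the value of the linear form at $(1,3)$; it shows that the
  -- form is nonzero.
  · have := hl ![1, 3]
    rw [h0, map_zero] at this
    simp only [Matrix.cons_val] at this
    exact hαβ (by linear_combination -this)
  · rw [hl, hl]
    simp only [Pi.smul_apply, smul_eq_mul]
    ring
  · rw [hT, hl]
    convert h (s 0) (s 1) using 3
    rw [lineOne_eq, lineOne_eq (s 0), smul_add, smul_smul, smul_smul]
    rfl

theorem chartOne_ne_zero {τ : ℂ} (hτ : τ ∈ chartBase) : (Polynomial.X : Polynomial ℂ).eval τ ≠ 0 ∧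
    (1 : Polynomial ℂ).eval τ ≠ 0 ∧
    (Polynomial.X : Polynomial ℂ).eval τ - (1 : Polynomial ℂ).eval τ ≠ 0 := by
  simp only [Polynomial.eval_X, Polynomial.eval_one]
  exact ⟨hτ.1, one_ne_zero, sub_ne_zero.2 hτ.2⟩

theorem chartInfty_ne_zero {τ : ℂ} (hτ : τ ∈ chartBase) : (1 : Polynomial ℂ).eval τ ≠ 0 ∧
    (Polynomial.X : Polynomial ℂ).eval τ ≠ 0 ∧
    (1 : Polynomial ℂ).eval τ - (Polynomial.X : Polynomial ℂ).eval τ ≠ 0 := by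
  simp only [Polynomial.eval_X, Polynomial.eval_one]
  exact ⟨one_ne_zero, hτ.1, sub_ne_zero.2 (Ne.symm hτ.2)⟩

theorem limitOneComponent_eq (v : GVertex) :
    limitOneComponent v = flatLimit chartBase (fun τ => rhoImage τ 1 v) 1 := by
  unfold limitOneComponent flatLimit spinComponent
  rw [totalIdeal_zariskiClosure]

theorem limitInftyComponent_eq (v : GVertex) :
    limitInftyComponent v = flatLimit chartBase (fun τ => rhoImage 1 τ v) 0 := by
  unfold limitInftyComponent flatLimit spinComponent
  rw [totalIdeal_zariskiClosure]

theorem limitOne_eq_flatLimit :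
    limitOne = flatLimit chartBase (fun τ => ⋃ v, rhoImage τ 1 v) 1 := by
  unfold limitOne flatLimit spinCurve spinComponent
  rw [totalIdeal_iUnion_zariskiClosure]

theorem limitInfty_eq_flatLimit :
    limitInfty = flatLimit chartBase (fun τ => ⋃ v, rhoImage 1 τ v) 0 := by
  unfold limitInfty flatLimit spinCurve spinComponent
  rw [totalIdeal_iUnion_zariskiClosure]

theorem limitOne_le_component (v : GVertex) : limitOne ≤ limitOneComponent v := by
  rw [limitOne_eq_flatLimit, limitOneComponent_eq]
  exact flatLimit_mono (fun τ _ => Set.subset_iUnion _ v) 1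

theorem limitInfty_le_component (v : GVertex) : limitInfty ≤ limitInftyComponent v := by
  rw [limitInfty_eq_flatLimit, limitInftyComponent_eq]
  exact flatLimit_mono (fun τ _ => Set.subset_iUnion _ v) 0

theorem eval_param_of_mem_limitOneComponent {v : GVertex} {f : MvPolynomial SpinIdx ℂ}
    (hf : f ∈ limitOneComponent v) (a b : ℂ) :
    eval (spinVec 1 1 (param 1 1 a b v)) f = 0 := by
  have := eval_param_eq_zero (p₀ := Polynomial.X) (p₁ := 1) (fun τ hτ => chartOne_ne_zero hτ)
    (v := v) (c := 1) (f := f) ?_ ?_ a b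
  · simpa using this
  · simp only [Polynomial.eval_X, Polynomial.eval_one]
    cases v <;> norm_num [nodeLocus]
  · rw [limitOneComponent_eq] at hf
    simpa using hf

theorem eval_param_of_mem_limitInftyComponent {v : GVertex} {f : MvPolynomial SpinIdx ℂ}
    (hf : f ∈ limitInftyComponent v) (a b : ℂ) :
    eval (spinVec 1 0 (param 1 0 a b v)) f = 0 := by
  have := eval_param_eq_zero (p₀ := 1) (p₁ := Polynomial.X) (fun τ hτ => chartInfty_ne_zero hτ)
    (v := v) (c := 0) (f := f) ?_ ?_ a b
  · simpa using this
  · simp only [Polynomial.eval_X, Polynomial.eval_one]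
    cases v <;> norm_num [nodeLocus]
  · rw [limitInftyComponent_eq] at hf
    simpa using hf

theorem lineOne_eq_param (a b : ℂ) (i : Fin 12) (h3 : i ≠ 3) (h4 : i ≠ 4) :
    lineOne a b i = param 1 1 a b (contractEdge i) := by
  fin_cases i <;> first
    | exact absurd rfl h3
    | exact absurd rfl h4
    | simp only [lineOne, contractEdge, param, Fin.reduceFinMk, Fin.zero_eta, Fin.mk_one,
        Matrix.cons_val, one_mul, neg_mul]

/-- The components of the family that degenerate to the lines in `X_∞`. -/
def vertexInfty : Fin 10 → GVertex := ![.v0, .v1, .v10, .v7, .v11, .v2, .v5, .v6, .v8, .v9]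

theorem lineInfty_eq_param (a b : ℂ) (i : Fin 10) :
    lineInfty a b i = param 1 0 a b (vertexInfty i) := by
  fin_cases i <;> simp only [lineInfty, vertexInfty, param, Fin.reduceFinMk, Fin.zero_eta,
    Fin.mk_one, Matrix.cons_val, zero_mul, neg_zero]

theorem conicInfty_eq_param (b c : ℂ) : conicInfty b c = param 1 0 (b + c) b .v34 := by
  funext j
  fin_cases j <;> simp [conicInfty, param] <;> ring

theorem eval_lineOne_of_mem {i : Fin 12} {f : MvPolynomial SpinIdx ℂ}
    (hf : f ∈ limitOneComponent (contractEdge i)) (a b : ℂ) :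
    eval (spinVec 1 1 (lineOne a b i)) f = 0 := by
  by_cases h3 : i = 3
  · subst h3
    refine eval_lineOne_of_smul 1 (-1) (by norm_num) (fun a b => ?_) a b
    have hL : ((1 : ℂ) * a + -1 * b) • lineOne a b 3 = param 1 1 a b .v34 := by
      simp only [lineOne, param, Matrix.cons_val]
      funext j
      fin_cases j <;> simp only [Fin.reduceFinMk, Fin.zero_eta, Fin.mk_one, Pi.smul_apply,
        smul_eq_mul, Matrix.cons_val] <;> ring
    rw [hL]
    exact eval_param_of_mem_limitOneComponent hf a b
  by_cases h4 : i = 4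
  · subst h4
    refine eval_lineOne_of_smul 1 0 (by norm_num) (fun a b => ?_) a b
    rw [limitOneComponent_eq] at hf
    have hL : ((1 : ℂ) * a + 0 * b) • lineOne a b 4 = conicParam 1 a (a - b) := by
      simp only [lineOne, conicParam, Matrix.cons_val]
      funext j
      fin_cases j <;> simp only [Fin.reduceFinMk, Fin.zero_eta, Fin.mk_one, Pi.smul_apply,
        smul_eq_mul, Matrix.cons_val] <;> ring
    rw [hL]
    exact eval_conicParam_eq_zero hf a (a - b)
  · rw [lineOne_eq_param a b i h3 h4]
    exact eval_param_of_mem_limitOneComponent hf a b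

theorem limitOne_eq : limitOne = vanishingIdeal ℂ (⋃ i, (spinLineOne i : Set (SpinIdx → ℂ))) := by
  apply le_antisymm
  · intro f hf x hx
    obtain ⟨i, hi⟩ := Set.mem_iUnion.1 hx
    obtain ⟨a, b, rfl⟩ := mem_spinLineOne.1 hi
    exact eval_lineOne_of_mem (limitOne_le_component _ hf) a b
  · intro f hf
    rw [limitOne_eq_flatLimit]
    -- Here $1\cdot(1-\tau)+\tau=1$. In the chart at infinity $t_0=1$ and the choice $\alpha=0$,
    -- $\beta=-1$ works.
    refine mem_flatLimit_of_mem_span (p₀ := Polynomial.X) (p₁ := 1) (α := 1) (β := -1) (by ring)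
      (Z := fun τ => ⋃ v, scaledComponent τ 1 v) (fun τ hτ x hx => ?_)
      (equations (C Polynomial.X) (C 1) X) (fun τ _ z hz j => ?_) ?_
    · obtain ⟨v, hv⟩ := Set.mem_iUnion.1 hx
      obtain ⟨z, hz, rfl⟩ := exists_spinVec_of_mem_rhoImage hτ.1 one_ne_zero (sub_ne_zero.2 hτ.2) hv
      exact ⟨z, Set.mem_iUnion_of_mem v hz, by simp⟩
    · obtain ⟨v, hv⟩ := Set.mem_iUnion.1 hz
      rw [map_equations, map_equations]
      simpa [specialize] using equations_eq_zero_of_mem_scaledComponent one_ne_zero hv j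
    · simp only [map_equations]
      simp only [specialize, map_C, map_X, map_one, Polynomial.coe_evalRingHom, Polynomial.eval_X,
        Polynomial.eval_one]
      refine mem_span_equations_one fun i a b => ?_
      have := eval_aeval_spinVec 1 1 (lineOne a b i) f
      rw [C_1] at this
      rw [this]
      exact hf _ (Set.mem_iUnion_of_mem i (mem_spinLineOne.2 ⟨a, b, rfl⟩))

theorem limitInfty_eq : limitInfty =
    vanishingIdeal ℂ ((⋃ i, (spinLineInfty i : Set (SpinIdx → ℂ))) ∪ spinConicInfty) := by
  apply le_antisymm
  · rintro f hf x (hx | ⟨b, c, rfl⟩)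
    · obtain ⟨i, hi⟩ := Set.mem_iUnion.1 hx
      obtain ⟨a, b, rfl⟩ := mem_spinLineInfty.1 hi
      rw [lineInfty_eq_param]
      exact eval_param_of_mem_limitInftyComponent (limitInfty_le_component _ hf) a b
    · rw [conicInfty_eq_param]
      exact eval_param_of_mem_limitInftyComponent (limitInfty_le_component _ hf) _ _
  · intro f hf
    rw [limitInfty_eq_flatLimit]
    refine mem_flatLimit_of_mem_span (p₀ := 1) (p₁ := Polynomial.X) (α := 0) (β := -1) (by ring)
      (Z := fun τ => ⋃ v, scaledComponent 1 τ v) (fun τ hτ x hx => ?_)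
      (equations (C 1) (C Polynomial.X) X) (fun τ hτ z hz j => ?_) ?_
    · obtain ⟨v, hv⟩ := Set.mem_iUnion.1 hx
      obtain ⟨z, hz, rfl⟩ := exists_spinVec_of_mem_rhoImage one_ne_zero hτ.1
        (sub_ne_zero.2 (Ne.symm hτ.2)) hv
      exact ⟨z, Set.mem_iUnion_of_mem v hz, by simp⟩
    · obtain ⟨v, hv⟩ := Set.mem_iUnion.1 hz
      rw [map_equations, map_equations]
      simpa [specialize] using equations_eq_zero_of_mem_scaledComponent hτ.1 hv j
    · simp only [map_equations]
      simp only [specialize, map_C, map_X, map_one, map_zero, Polynomial.coe_evalRingHom,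
        Polynomial.eval_X, Polynomial.eval_one]
      have hT := fun z => eval_aeval_spinVec 1 0 z f
      rw [C_1, C_0] at hT
      refine mem_span_equations_infty (fun i a b => ?_) fun b c => ?_
      · rw [hT]
        exact hf _ (Or.inl (Set.mem_iUnion_of_mem i (mem_spinLineInfty.2 ⟨a, b, rfl⟩)))
      · rw [hT]
        exact hf _ (Or.inr ⟨b, c, rfl⟩)

/-- One inclusion is monotonicity of flat limits. For the other, the arcs in the individual
components already sweep out every line and the conic, whose vanishing ideal is the limit ideal. -/
theorem iInf_limitInftyComponent : ⨅ v, limitInftyComponent v = limitInfty := by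
  apply le_antisymm
  · intro f hf
    rw [Ideal.mem_iInf] at hf
    rw [limitInfty_eq]
    rintro x (hx | ⟨b, c, rfl⟩)
    · obtain ⟨i, hi⟩ := Set.mem_iUnion.1 hx
      obtain ⟨a, b, rfl⟩ := mem_spinLineInfty.1 hi
      rw [lineInfty_eq_param]
      exact eval_param_of_mem_limitInftyComponent (hf _) a b
    · rw [conicInfty_eq_param]
      exact eval_param_of_mem_limitInftyComponent (hf _) _ _
  · exact le_iInf limitInfty_le_component

theorem iInf_limitOneComponent : ⨅ v, limitOneComponent v = limitOne := by
  apply le_antisymm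
  · intro f hf
    rw [Ideal.mem_iInf] at hf
    rw [limitOne_eq]
    intro x hx
    obtain ⟨i, hi⟩ := Set.mem_iUnion.1 hx
    obtain ⟨a, b, rfl⟩ := mem_spinLineOne.1 hi
    exact eval_lineOne_of_mem (hf _) a b
  · exact le_iInf limitOne_le_component

theorem eq_param_of_mem_scaledComponent {t₀ t₁ : ℂ} (ht₁ : t₁ ≠ 0) {v : GVertex} (hv : v ≠ .v34)
    {z : Fin 7 → ℂ} (hz : z ∈ scaledComponent t₀ t₁ v) (j : Fin 7) :
    z j = param t₀ t₁ (z (pivots v).1) (z (pivots v).2) v j := by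
  cases v <;> simp only [scaledComponent, nodComponent, unscale, Set.mem_ofPred_eq,
    Matrix.cons_val] at hz <;> obtain ⟨h1, h2, h3, h4, h5⟩ := hz
  case v34 => exact absurd rfl hv
  all_goals
    simp only [param, pivots]
    fin_cases j <;> simp only [Fin.reduceFinMk, Fin.zero_eta, Fin.mk_one, Matrix.cons_val] <;> grind

/-- The same two bounds for a single component: the conic uses its own equations, which degenerate
to those of a pair of lines, and a line uses its retraction. -/
theorem limitOneComponent_eq_iInf (v : GVertex) : limitOneComponent v =
    ⨅ (i : Fin 12) (_ : contractEdge i = v),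
      vanishingIdeal ℂ (spinLineOne i : Set (SpinIdx → ℂ)) := by
  apply le_antisymm
  · refine le_iInf fun i => le_iInf fun hi => ?_
    rintro f hf x hx
    obtain ⟨a, b, rfl⟩ := mem_spinLineOne.1 hx
    subst hi
    exact eval_lineOne_of_mem hf a b
  · intro f hf
    simp only [Ideal.mem_iInf] at hf
    have hT : ∀ i, contractEdge i = v → ∀ a b, eval (lineOne a b i)
        (aeval (spinVec (C 1) (C 1) X) f : MvPolynomial (Fin 7) ℂ) = 0 := by
      intro i hi a b
      rw [eval_aeval_spinVec]
      exact hf i hi _ (mem_spinLineOne.2 ⟨a, b, rfl⟩)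
    have hY : ∀ τ ∈ chartBase, ∀ x ∈ rhoImage τ 1 v, ∃ z ∈ scaledComponent τ 1 v,
        x = spinVec ((Polynomial.X : Polynomial ℂ).eval τ) ((1 : Polynomial ℂ).eval τ) z := by
      intro τ hτ x hx
      obtain ⟨z, hz, rfl⟩ := exists_spinVec_of_mem_rhoImage hτ.1 one_ne_zero (sub_ne_zero.2 hτ.2) hx
      exact ⟨z, hz, by simp⟩
    rw [limitOneComponent_eq]
    by_cases hv : v = .v34
    · subst hv
      refine mem_flatLimit_of_mem_span (p₀ := Polynomial.X) (p₁ := 1) (α := 1) (β := -1) (by ring)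
        hY (conicEquations (C Polynomial.X) (C 1) X) (fun τ _ z hz j => ?_) ?_
      · rw [map_conicEquations, map_conicEquations]
        simpa [specialize] using conicEquations_eq_zero one_ne_zero hz j
      · simp only [map_conicEquations]
        simp only [specialize, map_C, map_X, map_one, Polynomial.coe_evalRingHom,
          Polynomial.eval_X, Polynomial.eval_one]
        rw [C_1] at hT
        refine mem_span_conicEquations_one fun i a b => hT _ ?_ a b
        fin_cases i <;> rfl
    · obtain ⟨i, hi, h3, h4⟩ : ∃ i, contractEdge i = v ∧ i ≠ 3 ∧ i ≠ 4 := by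
        cases v
        case v34 => exact absurd rfl hv
        exacts [⟨0, rfl, by decide, by decide⟩, ⟨1, rfl, by decide, by decide⟩,
          ⟨2, rfl, by decide, by decide⟩, ⟨5, rfl, by decide, by decide⟩,
          ⟨6, rfl, by decide, by decide⟩, ⟨7, rfl, by decide, by decide⟩,
          ⟨8, rfl, by decide, by decide⟩, ⟨9, rfl, by decide, by decide⟩,
          ⟨10, rfl, by decide, by decide⟩, ⟨11, rfl, by decide, by decide⟩]
      refine mem_flatLimit_of_mem_span (p₀ := Polynomial.X) (p₁ := 1) (α := 1) (β := -1) (by ring)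
        hY (fun j => X j - param (C Polynomial.X) (C 1) (X (pivots v).1) (X (pivots v).2) v j)
        (fun τ _ z hz j => ?_) ?_
      · rw [map_sub, map_sub, map_param, map_param]
        simp only [specialize, map_C, map_X, Polynomial.coe_evalRingHom, eval_X, eval_C,
          Polynomial.eval_X, Polynomial.eval_one]
        exact sub_eq_zero.2 (eq_param_of_mem_scaledComponent one_ne_zero hv hz j)
      · simp only [map_sub, map_param]
        simp only [specialize, map_C, map_X, Polynomial.coe_evalRingHom,
          Polynomial.eval_X, Polynomial.eval_one]
        refine vanishingIdeal_le_span_of_retract (W := {z | ∃ a b, z = lineOne a b i})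
          (param (C 1) (C 1) (X (pivots v).1) (X (pivots v).2) v) (fun z => ?_) ?_
        · refine ⟨z (pivots v).1, z (pivots v).2, ?_⟩
          rw [lineOne_eq_param _ _ i h3 h4, hi]
          funext j
          rw [map_param]
          simp
        · rintro _ ⟨a, b, rfl⟩
          exact hT i hi a b

/-! ### Tangent cones -/

section TangentCone

variable {σ : Type}

theorem eval_smul_of_isHomogeneous [Fintype σ] {F : MvPolynomial σ ℂ} {d : ℕ}
    (hF : F.IsHomogeneous d) (r : ℂ) (x : σ → ℂ) : eval (r • x) F = r ^ d * eval x F := by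
  rw [eval_eq', eval_eq', Finset.mul_sum]
  refine Finset.sum_congr rfl fun m hm => ?_
  have hd : ∑ i, m i = d := by
    rw [← hF (mem_support_iff.1 hm), Finsupp.weight_apply, Finsupp.sum_fintype _ _ (by simp)]
    simp
  simp only [Pi.smul_apply, smul_eq_mul, mul_pow, Finset.prod_mul_distrib, Finset.prod_pow_eq_pow_sum,
    hd]
  ring

theorem homogeneousComponent_mul_of_isHomogeneous {A : MvPolynomial σ ℂ} {d : ℕ}
    (hA : A.IsHomogeneous d) (H : MvPolynomial σ ℂ) :
    (∀ e < d, homogeneousComponent e (A * H) = 0) ∧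
      homogeneousComponent d (A * H) = C (constantCoeff H) * A := by
  have hsum : ∀ e, homogeneousComponent e (A * H) = ∑ j ∈ Finset.range (H.totalDegree + 1),
      if e = d + j then A * homogeneousComponent j H else 0 := by
    intro e
    conv_lhs => rw [← sum_homogeneousComponent H, Finset.mul_sum, map_sum]
    refine Finset.sum_congr rfl fun j _ => ?_
    exact homogeneousComponent_of_mem (hA.mul (homogeneousComponent_isHomogeneous j H))
  constructor
  · intro e he
    rw [hsum]
    exact Finset.sum_eq_zero fun j _ => if_neg (by omega)
  · rw [hsum, Finset.sum_eq_single 0]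
    · rw [add_zero, if_pos rfl, homogeneousComponent_zero, mul_comm]
      rfl
    · intro j _ hj
      exact if_neg (by omega)
    · simp

/-- If $A$ is homogeneous, $H$ has nonzero constant term and $B$ has higher order, the lowest degree
part of $AH+B$ is a unit times $A$. -/
theorem mem_tangentConeIdeal_of_mul {J : Ideal (MvPolynomial σ ℂ)} {a : σ → ℂ}
    {F A H B : MvPolynomial σ ℂ} (hF : F ∈ J) {d : ℕ} (hA : A.IsHomogeneous d)
    (hH : constantCoeff H ≠ 0) (hB : ∀ e ≤ d, homogeneousComponent e B = 0)
    (h : translate a F = A * H + B) : A ∈ tangentConeIdeal J a := by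
  obtain ⟨h1, h2⟩ := homogeneousComponent_mul_of_isHomogeneous hA H
  have : C (constantCoeff H) * A ∈ tangentConeIdeal J a := by
    refine Ideal.subset_span ⟨F, hF, d, fun e he => ?_, ?_⟩
    · rw [h, map_add, h1 e he, hB e he.le, add_zero]
    · rw [h, map_add, h2, hB d le_rfl, add_zero]
  have h3 := Ideal.mul_mem_left _ (C (constantCoeff H)⁻¹) this
  rwa [← mul_assoc, ← C_mul, inv_mul_cancel₀ hH, C_1, one_mul] at h3

theorem eval_translate (a z : σ → ℂ) (f : MvPolynomial σ ℂ) :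
    eval z (translate a f) = eval (a + z) f := by
  rw [translate, eval_aeval_eq]
  congr 2
  funext i
  simp [add_comm]

theorem translate_mul (a : σ → ℂ) (f g : MvPolynomial σ ℂ) :
    translate a (f * g) = translate a f * translate a g := map_mul _ _ _

theorem translate_sub (a : σ → ℂ) (f g : MvPolynomial σ ℂ) :
    translate a (f - g) = translate a f - translate a g := map_sub _ _ _

theorem translate_X (a : σ → ℂ) (i : σ) : translate a (X i) = X i + C (a i) := aeval_X _ _

theorem translate_C (a : σ → ℂ) (r : ℂ) : translate a (C r) = C r := aeval_C _ _

theorem constantCoeff_translate (a : σ → ℂ) (f : MvPolynomial σ ℂ) :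
    constantCoeff (translate a f) = eval a f := by
  have := eval_translate a 0 f
  rwa [add_zero, eval_zero] at this

theorem sub_aeval_mem {K : Ideal (MvPolynomial σ ℂ)} {r : σ → MvPolynomial σ ℂ}
    (h : ∀ i, X i - r i ∈ K) (p : MvPolynomial σ ℂ) : p - aeval r p ∈ K := by
  induction p using MvPolynomial.induction_on with
  | C a => simp
  | add p q hp hq =>
    rw [map_add, add_sub_add_comm]
    exact K.add_mem hp hq
  | mul_X p j hp =>
    rw [map_mul, aeval_X, show p * X j - aeval r p * r j =
      X j * (p - aeval r p) + aeval r p * (X j - r j) by ring]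
    exact K.add_mem (K.mul_mem_left _ hp) (K.mul_mem_left _ (h j))

variable [Fintype σ]

/-- The polynomial of a linear form with coefficients `c`. -/
def linearForm (c : σ → ℂ) : MvPolynomial σ ℂ := ∑ i, C (c i) * X i

theorem eval_linearForm (c x : σ → ℂ) : eval x (linearForm c) = ∑ i, c i * x i := by
  simp [linearForm]

theorem isHomogeneous_linearForm (c : σ → ℂ) : (linearForm c).IsHomogeneous 1 :=
  IsHomogeneous.sum _ _ _ fun i _ => by
    simpa using (isHomogeneous_C σ (c i)).mul (isHomogeneous_X ℂ i)

theorem translate_linearForm (a c : σ → ℂ) :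
    translate a (linearForm c) = linearForm c + C (eval a (linearForm c)) := by
  rw [eval_linearForm, translate, linearForm, map_sum, map_sum, ← Finset.sum_add_distrib]
  refine Finset.sum_congr rfl fun i _ => ?_
  rw [map_mul, aeval_C, aeval_X, C_mul, mul_add]
  rfl

/-- Every linear functional is evaluation of a linear form. -/
theorem exists_linearForm_eq (g : (σ → ℂ) →ₗ[ℂ] ℂ) : ∃ c, ∀ x, eval x (linearForm c) = g x := by
  classical
  refine ⟨fun i => g (Pi.single i 1), fun x => ?_⟩
  rw [eval_linearForm]
  conv_rhs => rw [LinearMap.pi_apply_eq_sum_univ g x]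
  refine Finset.sum_congr rfl fun i _ => ?_
  rw [smul_eq_mul, mul_comm]
  congr 2
  funext j
  simp [Pi.single_apply, eq_comm]

theorem eval_homogeneousComponent_eq_zero {V : Set (σ → ℂ)} (hV : ∀ (r : ℂ), ∀ x ∈ V, r • x ∈ V)
    {f : MvPolynomial σ ℂ} (hf : ∀ x ∈ V, eval x f = 0) (d : ℕ) :
    ∀ x ∈ V, eval x (homogeneousComponent d f) = 0 := by
  intro x hx
  by_cases hd : f.totalDegree < d
  · rw [homogeneousComponent_eq_zero _ _ hd, map_zero]
  set P : Polynomial ℂ := ∑ i ∈ Finset.range (f.totalDegree + 1),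
    Polynomial.C (eval x (homogeneousComponent i f)) * Polynomial.X ^ i with hP
  have hP0 : P = 0 := by
    refine Polynomial.funext fun r => ?_
    have := hf _ (hV r x hx)
    rw [← sum_homogeneousComponent f, map_sum] at this
    rw [hP, Polynomial.eval_finsetSum, Polynomial.eval_zero, ← this]
    refine Finset.sum_congr rfl fun i _ => ?_
    rw [eval_smul_of_isHomogeneous (homogeneousComponent_isHomogeneous i f)]
    rw [Polynomial.eval_mul, Polynomial.eval_C, Polynomial.eval_pow, Polynomial.eval_X, mul_comm]
  have := congrArg (fun p => Polynomial.coeff p d) hP0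
  simp only [hP, Polynomial.finsetSum_coeff, Polynomial.coeff_C_mul, Polynomial.coeff_X_pow,
    mul_ite, mul_one, mul_zero, Polynomial.coeff_zero] at this
  rwa [Finset.sum_ite_eq (Finset.range (f.totalDegree + 1)) d, if_pos (by simp; omega)] at this

/-- Tangent directions of arcs $a+s\,w(s)$ in the scheme lie in the tangent cone: substitute the
arc, divide by $s^d$, and let $s\to0$. -/
theorem eval_eq_zero_of_mem_tangentConeIdeal {J : Ideal (MvPolynomial σ ℂ)} {a v : σ → ℂ}
    (w : ℂ → σ → ℂ) (hw : Filter.Tendsto w (nhdsWithin 0 {0}ᶜ) (nhds v))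
    (hJ : ∀ f ∈ J, ∀ᶠ s in nhdsWithin (0 : ℂ) {0}ᶜ, eval (a + s • w s) f = 0)
    {h : MvPolynomial σ ℂ} (hh : h ∈ tangentConeIdeal J a) : eval v h = 0 := by
  have : tangentConeIdeal J a ≤ vanishingIdeal ℂ {v} := by
    refine Ideal.span_le.2 ?_
    rintro _ ⟨f, hf, d, hd, rfl⟩ x hx
    have hx : x = v := hx
    change eval x _ = 0
    rw [hx]
    set F := translate a f with hF
    by_cases hdF : F.totalDegree < d
    · rw [homogeneousComponent_eq_zero _ _ hdF, map_zero]
    set ψ : ℂ → ℂ := fun s => ∑ e ∈ Finset.range (F.totalDegree + 1),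
      if e < d then 0 else s ^ (e - d) * eval (w s) (homogeneousComponent e F) with hψ
    have hlim : Filter.Tendsto ψ (nhdsWithin 0 {0}ᶜ) (nhds (∑ e ∈ Finset.range (F.totalDegree + 1),
        if e < d then 0 else (0 : ℂ) ^ (e - d) * eval v (homogeneousComponent e F))) := by
      refine tendsto_finsetSum _ fun e _ => ?_
      split_ifs
      · exact tendsto_const_nhds
      · refine Filter.Tendsto.mul ?_ ((MvPolynomial.continuous_eval _).continuousAt.tendsto.comp hw)
        exact (((continuous_pow (e - d)).tendsto (0 : ℂ))).mono_left nhdsWithin_le_nhds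
    have hzero : ∀ᶠ s in nhdsWithin (0 : ℂ) {0}ᶜ, ψ s = 0 := by
      filter_upwards [hJ f hf, self_mem_nhdsWithin] with s hs hs0
      have hs0 : s ≠ 0 := hs0
      rw [← eval_translate, ← hF, ← sum_homogeneousComponent F, map_sum] at hs
      refine (mul_eq_zero.1 (?_ : s ^ d * ψ s = 0)).resolve_left (pow_ne_zero d hs0)
      rw [← hs, hψ, Finset.mul_sum]
      refine Finset.sum_congr rfl fun e _ => ?_
      rw [eval_smul_of_isHomogeneous (homogeneousComponent_isHomogeneous e F)]
      split_ifs with he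
      · rw [hd e he, map_zero, mul_zero, mul_zero]
      · rw [← mul_assoc, ← pow_add, Nat.add_sub_cancel' (not_lt.1 he)]
    have h0 := tendsto_nhds_unique hlim
      (tendsto_const_nhds.congr' (hzero.mono fun s hs => hs.symm))
    rw [Finset.sum_eq_single d] at h0
    · simpa using h0
    · intro e _ he
      split_ifs with h1
      · rfl
      · rw [zero_pow (by omega), zero_mul]
    · intro hd'
      exact absurd (Finset.mem_range.2 (by omega)) hd'
  exact this hh v rfl

/-- The tangent cone at `a` of (the affine part of) a cone `X`, if up to a linear change of
coordinates `X` is a union of lines near `a`. -/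
theorem tangentConeIdeal_eq {X' : Set (σ → ℂ)} {a : σ → ℂ} {k : σ} (hak : a k = 1) {n : ℕ}
    (v : Fin n → σ → ℂ) (r c : σ → ℂ) (hca : eval a (linearForm c) = 0)
    {h : MvPolynomial σ ℂ} (ha : eval a h ≠ 0)
    (hφ : ∀ x ∈ X', eval x h ≠ 0 → ∃ i, ∃ t : ℂ,
      x - x k • a - eval x (linearForm c) • r = t • v i)
    (hc : linearForm c ∈ tangentConeIdeal (vanishingIdeal ℂ X' ⊔ Ideal.span {X k - 1}) a)
    (hpath : ∀ i, ∃ w : ℂ → σ → ℂ, Filter.Tendsto w (nhdsWithin 0 {0}ᶜ) (nhds (v i)) ∧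
      ∀ᶠ s in nhdsWithin (0 : ℂ) {0}ᶜ, a + s • w s ∈ X' ∧ w s k = 0) :
    tangentConeIdeal (vanishingIdeal ℂ X' ⊔ Ideal.span {X k - 1}) a =
      vanishingIdeal ℂ (⋃ i, (Submodule.span ℂ {v i} : Set (σ → ℂ))) := by
  set J := vanishingIdeal ℂ X' ⊔ Ideal.span {X k - 1} with hJ
  have hV : ∀ (t : ℂ), ∀ x ∈ ⋃ i, (Submodule.span ℂ {v i} : Set (σ → ℂ)),
      t • x ∈ ⋃ i, (Submodule.span ℂ {v i} : Set (σ → ℂ)) := by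
    intro t x hx
    obtain ⟨i, hi⟩ := Set.mem_iUnion.1 hx
    exact Set.mem_iUnion_of_mem i ((Submodule.span ℂ {v i}).smul_mem t hi)
  apply le_antisymm
  · intro f hf x hx
    obtain ⟨i, hi⟩ := Set.mem_iUnion.1 hx
    obtain ⟨t, rfl⟩ := Submodule.mem_span_singleton.1 hi
    suffices hle : tangentConeIdeal J a ≤ vanishingIdeal ℂ {t • v i} from hle hf _ rfl
    refine Ideal.span_le.2 ?_
    rintro _ ⟨g, hg, d, hd, rfl⟩ x hx
    change eval x _ = 0
    rw [show x = t • v i from hx, eval_smul_of_isHomogeneous (homogeneousComponent_isHomogeneous d _)]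
    obtain ⟨w, hw, hw'⟩ := hpath i
    refine mul_eq_zero_of_right _ (eval_eq_zero_of_mem_tangentConeIdeal (J := J) w hw
      (fun f hf => ?_) (Ideal.subset_span ⟨g, hg, d, hd, rfl⟩))
    filter_upwards [hw'] with s hs
    refine sup_le (a := vanishingIdeal ℂ X') (c := vanishingIdeal ℂ {a + s • w s}) ?_ ?_ hf _ rfl
    · intro f hf x hx
      rw [hx]
      exact hf _ hs.1
    · rw [Ideal.span_singleton_le_iff_mem]
      rintro _ rfl
      change eval _ _ = 0
      simp [hak, hs.2]
  · intro f hf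
    rw [← sum_homogeneousComponent f]
    refine Ideal.sum_mem _ fun d _ => ?_
    have hfd : ∀ i (t : ℂ), eval (t • v i) (homogeneousComponent d f) = 0 := fun i t =>
      eval_homogeneousComponent_eq_zero hV (fun x hx => hf x hx) d _
        (Set.mem_iUnion_of_mem i (Submodule.mem_span_singleton.2 ⟨t, rfl⟩))
    have hXk : (X k : MvPolynomial σ ℂ) ∈ tangentConeIdeal J a := by
      refine mem_tangentConeIdeal_of_mul (F := X k - 1) (H := 1) (B := 0)
        (Ideal.mem_sup_right (Ideal.subset_span rfl)) (isHomogeneous_X ℂ k) (by simp) (by simp) ?_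
      simp [translate, hak]
    -- By hypothesis, this linear map sends the part of `X'` where `h` is nonzero into the union of
    -- the lines, so $f_d\circ\psi$ times `h` vanishes on `X'`.
    set ψ : σ → MvPolynomial σ ℂ := fun i => X i - X k * C (a i) - linearForm c * C (r i) with hψ
    set A := aeval ψ (homogeneousComponent d f) with hAdef
    have hA : A.IsHomogeneous d := by
      have := (homogeneousComponent_isHomogeneous d f).aeval ψ (n := 1) fun i => by
        refine ((isHomogeneous_X ℂ i).sub ?_).sub ?_
        · simpa using (isHomogeneous_X ℂ k).mul (isHomogeneous_C σ (a i))
        · simpa using (isHomogeneous_linearForm c).mul (isHomogeneous_C σ (r i))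
      rwa [one_mul] at this
    have hAmem : A ∈ tangentConeIdeal J a := by
      refine mem_tangentConeIdeal_of_mul (F := A * h) (H := translate a h) (B := 0)
        (Ideal.mem_sup_left fun x hx => ?_) hA (by rwa [constantCoeff_translate]) (by simp) ?_
      · change eval x (A * h) = 0
        rw [map_mul, mul_eq_zero]
        by_cases hx0 : eval x h = 0
        · exact Or.inr hx0
        obtain ⟨i, t, hit⟩ := hφ x hx hx0
        left
        rw [hAdef, eval_aeval_eq]
        have : (fun i => eval x (ψ i)) = t • v i := by
          rw [← hit]
          funext j
          simp [hψ]
        rw [this]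
        exact hfd i t
      · rw [translate_mul, add_zero]
        congr 1
        -- Because $a_k=1$ and $c(a)=0$, the map kills $a$. So $A$ is invariant under the
        -- translation and is, up to the constant $h(a)$, the lowest degree form.
        have hψa : ∀ i, translate a (ψ i) = ψ i := by
          intro i
          have h1 : translate a (linearForm c) = linearForm c := by
            rw [translate_linearForm, hca, C_0, add_zero]
          simp only [hψ]
          rw [translate_sub, translate_sub, translate_mul, translate_mul, h1, translate_X,
            translate_X, translate_C, translate_C, hak, C_1]
          ring
        rw [hAdef]
        unfold translate
        rw [← AlgHom.comp_apply, comp_aeval]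
        congr 2
        funext i
        exact hψa i
    -- Modulo $X_k$ and the linear form, which both lie in the tangent cone ideal, $\psi$ is the
    -- identity, so $f_d\equiv A$.
    have hsub := sub_aeval_mem (K := tangentConeIdeal J a) (r := ψ) (fun i => ?_)
      (homogeneousComponent d f)
    · have := Ideal.add_mem _ hsub hAmem
      rwa [sub_add_cancel] at this
    · rw [show X i - ψ i = C (a i) * X k + C (r i) * linearForm c by simp only [hψ]; ring]
      exact Ideal.add_mem _ (Ideal.mul_mem_left _ _ hXk) (Ideal.mul_mem_left _ _ hc)

end TangentCone

/-! ### Tangent cones of unions of lines and a conic -/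

section Configurations

variable {σ : Type}

theorem linearIndependent_sub_smul {n : ℕ} {p : σ → ℂ} {u : Fin n → σ → ℂ}
    (h : LinearIndependent ℂ (Fin.cons p u : Fin (n + 1) → σ → ℂ)) (c : Fin n → ℂ) :
    LinearIndependent ℂ fun i => u i - c i • p := by
  rw [Fintype.linearIndependent_iff] at h ⊢
  intro g hg i
  have := h (Fin.cons (-∑ i, g i * c i) g) ?_ i.succ
  · simpa using this
  · rw [Fin.sum_univ_succ]
    simp only [Fin.cons_zero, Fin.cons_succ]
    rw [← hg, neg_smul, Finset.sum_smul, ← Finset.sum_neg_distrib, ← Finset.sum_add_distrib]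
    refine Finset.sum_congr rfl fun i _ => ?_
    rw [smul_sub, smul_smul]
    abel

/-- The cone over the conic with parametrization `s² p + s t v + t² r`. -/
def conicCone (p v r : σ → ℂ) : Set (σ → ℂ) :=
  {x | ∃ s t : ℂ, x = s ^ 2 • p + (s * t) • v + t ^ 2 • r}

theorem smul_mem_conicCone {p v r x : σ → ℂ} (c : ℂ) (hx : x ∈ conicCone p v r) :
    c • x ∈ conicCone p v r := by
  obtain ⟨s, t, rfl⟩ := hx
  obtain ⟨d, rfl⟩ := IsAlgClosed.exists_pow_nat_eq c (n := 2) (by norm_num)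
  refine ⟨d * s, d * t, ?_⟩
  funext l
  simp only [Pi.add_apply, Pi.smul_apply, smul_eq_mul]
  ring

variable [Fintype σ]

theorem exists_linearForm_apply_eq {m : ℕ} {b : Fin m → σ → ℂ} (hb : LinearIndependent ℂ b)
    (y : Fin m → ℂ) : ∃ c : σ → ℂ, ∀ i, eval (b i) (linearForm c) = y i := by
  obtain ⟨g, hg⟩ := LinearMap.exists_extend ((Module.Basis.span hb).constr ℂ y)
  obtain ⟨c, hc⟩ := exists_linearForm_eq g
  refine ⟨c, fun i => ?_⟩
  rw [hc]
  have h1 := LinearMap.congr_fun hg (Module.Basis.span hb i)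
  rw [Module.Basis.constr_basis, LinearMap.comp_apply, Submodule.subtype_apply,
    Module.Basis.span_apply] at h1
  exact h1

/-- A product of linear forms, one for each subspace that misses `p`. Multiplying by it localizes at
`p`. -/
theorem exists_polynomial_separating {ι : Type} [Fintype ι] (L : ι → Submodule ℂ (σ → ℂ))
    (p : σ → ℂ) : ∃ h : MvPolynomial σ ℂ, eval p h ≠ 0 ∧
      ∀ j, p ∉ L j → ∀ x ∈ L j, eval x h = 0 := by
  have : ∀ j, ∃ h : MvPolynomial σ ℂ, eval p h ≠ 0 ∧ (p ∉ L j → ∀ x ∈ L j, eval x h = 0) := by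
    intro j
    by_cases hj : p ∈ L j
    · exact ⟨1, by simp, fun h => absurd hj h⟩
    obtain ⟨g, hg, hgL⟩ := Submodule.exists_le_ker_of_notMem hj
    obtain ⟨c, hc⟩ := exists_linearForm_eq g
    refine ⟨linearForm c, by rwa [hc], fun _ x hx => ?_⟩
    rw [hc]
    exact hgL hx
  choose h h1 h2 using this
  refine ⟨∏ j, h j, ?_, fun j hj x hx => ?_⟩
  · rw [map_prod]
    exact Finset.prod_ne_zero_iff.2 fun j _ => h1 j
  · rw [map_prod]
    exact Finset.prod_eq_zero (Finset.mem_univ j) (h2 j hj x hx)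

theorem tangentConeIdeal_lines {ι : Type} [Fintype ι] (L : ι → Submodule ℂ (σ → ℂ))
    (Y : Set (σ → ℂ)) {p : σ → ℂ} {k : σ} (hk : p k = 1) {n : ℕ} (f : Fin n → ι)
    (u : Fin n → σ → ℂ) (hL : ∀ i, L (f i) = Submodule.span ℂ {p, u i})
    (hf : ∀ j, p ∈ L j → ∃ i, f i = j)
    (hli : LinearIndependent ℂ (Fin.cons p u : Fin (n + 1) → σ → ℂ)) (q : MvPolynomial σ ℂ)
    (hq : ∀ y ∈ Y, eval y q = 0) (hqp : eval p q ≠ 0) :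
    ∃ v : Fin n → σ → ℂ, LinearIndependent ℂ v ∧
      tangentConeIdeal (vanishingIdeal ℂ ((⋃ j, (L j : Set (σ → ℂ))) ∪ Y) ⊔
        Ideal.span {X k - 1}) p =
      vanishingIdeal ℂ (⋃ i, (Submodule.span ℂ {v i} : Set (σ → ℂ))) := by
  refine ⟨fun i => u i - u i k • p, linearIndependent_sub_smul hli _, ?_⟩
  obtain ⟨h, hp, hh⟩ := exists_polynomial_separating L p
  have hlf : linearForm (0 : σ → ℂ) = 0 := by simp [linearForm]
  refine tangentConeIdeal_eq hk _ 0 0 (by rw [hlf, map_zero]) (h := h * q)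
    (by rw [map_mul]; exact mul_ne_zero hp hqp) ?_ (by rw [hlf]; exact Ideal.zero_mem _) ?_
  · rintro x (hx | hx) hxh
    · obtain ⟨j, hj⟩ := Set.mem_iUnion.1 hx
      have hpj : p ∈ L j := by
        by_contra hpj
        exact hxh (by rw [map_mul, hh j hpj x hj, zero_mul])
      obtain ⟨i, rfl⟩ := hf j hpj
      rw [SetLike.mem_coe, hL, Submodule.mem_span_pair] at hj
      obtain ⟨s, t, rfl⟩ := hj
      refine ⟨i, t, ?_⟩
      rw [smul_zero, sub_zero]
      funext l
      simp only [Pi.sub_apply, Pi.add_apply, Pi.smul_apply, smul_eq_mul, hk]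
      ring
    · exact absurd (by rw [map_mul, hq x hx, mul_zero]) hxh
  · intro i
    refine ⟨fun _ => u i - u i k • p, tendsto_const_nhds, Filter.Eventually.of_forall fun s =>
      ⟨Or.inl (Set.mem_iUnion_of_mem (f i) ?_), ?_⟩⟩
    · rw [SetLike.mem_coe, hL, Submodule.mem_span_pair]
      refine ⟨1 - s * u i k, s, ?_⟩
      funext l
      simp only [Pi.sub_apply, Pi.add_apply, Pi.smul_apply, smul_eq_mul]
      ring
    · simp [hk]

/-- The conic $s^2p+stv_0+t^2r$ passes through $p$ with direction $v_0$ and bends towards $r$.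
Projecting along $r$ straightens it to a line, and the coordinate along $r$ belongs to the tangent
cone ideal. -/
theorem tangentConeIdeal_conic {ι : Type} [Fintype ι] (L : ι → Submodule ℂ (σ → ℂ))
    {p v₀ r : σ → ℂ} {k : σ} (hk : p k = 1) {n : ℕ} (f : Fin n → ι)
    (u : Fin n → σ → ℂ) (hL : ∀ i, L (f i) = Submodule.span ℂ {p, u i})
    (hf : ∀ j, p ∈ L j → ∃ i, f i = j)
    (hli : LinearIndependent ℂ
      (Fin.cons r (Fin.cons p (Fin.cons v₀ u)) : Fin (n + 3) → σ → ℂ)) :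
    ∃ v : Fin (n + 1) → σ → ℂ, LinearIndependent ℂ v ∧
      tangentConeIdeal (vanishingIdeal ℂ ((⋃ j, (L j : Set (σ → ℂ))) ∪ conicCone p v₀ r) ⊔
        Ideal.span {X k - 1}) p =
      vanishingIdeal ℂ (⋃ i, (Submodule.span ℂ {v i} : Set (σ → ℂ))) := by
  obtain ⟨c, hc⟩ := exists_linearForm_apply_eq hli (Fin.cons 1 0)
  obtain ⟨α, hα⟩ := exists_linearForm_apply_eq hli (Fin.cons 0 (Fin.cons 1 0))
  obtain ⟨β, hβ⟩ := exists_linearForm_apply_eq hli (Fin.cons 0 (Fin.cons 0 (Fin.cons 1 0)))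
  have add_eval : ∀ (c : σ → ℂ) (x y : σ → ℂ) (s t : ℂ), eval (s • x + t • y) (linearForm c) =
      s * eval x (linearForm c) + t * eval y (linearForm c) := by
    intro c x y s t
    simp only [eval_linearForm, Finset.mul_sum, ← Finset.sum_add_distrib]
    refine Finset.sum_congr rfl fun i _ => ?_
    simp only [Pi.add_apply, Pi.smul_apply, smul_eq_mul]
    ring
  have add_eval' : ∀ (c : σ → ℂ) (x y z : σ → ℂ) (s t w : ℂ),
      eval (s • x + t • y + w • z) (linearForm c) =
      s * eval x (linearForm c) + t * eval y (linearForm c) + w * eval z (linearForm c) := by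
    intro c x y z s t w
    have := add_eval c (s • x + t • y) z 1 w
    rw [one_smul, one_mul, add_eval] at this
    exact this
  have cr : eval r (linearForm c) = 1 := hc 0
  have cp : eval p (linearForm c) = 0 := hc (Fin.succ 0)
  have cv : eval v₀ (linearForm c) = 0 := hc (Fin.succ (Fin.succ 0))
  have cu : ∀ i, eval (u i) (linearForm c) = 0 := fun i => hc i.succ.succ.succ
  have αr : eval r (linearForm α) = 0 := hα 0
  have αp : eval p (linearForm α) = 1 := hα (Fin.succ 0)
  have αv : eval v₀ (linearForm α) = 0 := hα (Fin.succ (Fin.succ 0))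
  have βr : eval r (linearForm β) = 0 := hβ 0
  have βp : eval p (linearForm β) = 0 := hβ (Fin.succ 0)
  have βv : eval v₀ (linearForm β) = 1 := hβ (Fin.succ (Fin.succ 0))
  have βu : ∀ i, eval (u i) (linearForm β) = 0 := fun i => hβ i.succ.succ.succ
  obtain ⟨h, hp, hh⟩ := exists_polynomial_separating L p
  have hline : ∀ x ∈ ⋃ j, (L j : Set (σ → ℂ)), eval x h ≠ 0 →
      ∃ i, ∃ s t : ℂ, x = s • p + t • u i := by
    intro x hx hxh
    obtain ⟨j, hj⟩ := Set.mem_iUnion.1 hx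
    have hpj : p ∈ L j := by
      by_contra hpj
      exact hxh (hh j hpj x hj)
    obtain ⟨i, rfl⟩ := hf j hpj
    rw [SetLike.mem_coe, hL, Submodule.mem_span_pair] at hj
    obtain ⟨s, t, rfl⟩ := hj
    exact ⟨i, s, t, rfl⟩
  refine ⟨fun i => (Fin.cons v₀ u : Fin (n + 1) → σ → ℂ) i -
      (Fin.cons v₀ u : Fin (n + 1) → σ → ℂ) i k • p,
    linearIndependent_sub_smul (linearIndependent_finCons.1 hli).1 _, ?_⟩
  refine tangentConeIdeal_eq hk _ (r - r k • p) c cp hp ?_ ?_ ?_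
  · rintro x (hx | ⟨s, t, rfl⟩) hxh
    · obtain ⟨i, s, t, rfl⟩ := hline x hx hxh
      refine ⟨i.succ, t, ?_⟩
      rw [add_eval, cp, cu, Fin.cons_succ]
      funext l
      simp only [Pi.sub_apply, Pi.add_apply, Pi.smul_apply, smul_eq_mul, hk]
      ring
    · refine ⟨0, s * t, ?_⟩
      rw [add_eval', cr, cp, cv, Fin.cons_zero]
      funext l
      simp only [Pi.sub_apply, Pi.add_apply, Pi.smul_apply, smul_eq_mul, hk]
      ring
  -- On the conic the coordinates along $p,v_0,r$ are $s^2,st,t^2$, so $c\alpha=\beta^2$. On the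
  -- lines through $p$ both $c$ and $\beta$ vanish, and $h$ kills the other lines. As $\alpha(p)=1$,
  -- the linear part of this element at $p$ is $h(p)c$.
  · refine mem_tangentConeIdeal_of_mul
      (F := h * (linearForm c * linearForm α - linearForm β ^ 2))
      (H := translate p h * translate p (linearForm α))
      (B := -(linearForm β ^ 2 * translate p h))
      (Ideal.mem_sup_left fun x hx => ?_) (isHomogeneous_linearForm c) ?_ (fun e he => ?_) ?_
    · change eval x _ = 0
      rw [map_mul, mul_eq_zero]
      by_cases hxh : eval x h = 0
      · exact Or.inl hxh
      right
      rw [map_sub, map_mul, map_pow]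
      rcases hx with hx | ⟨s, t, rfl⟩
      · obtain ⟨i, s, t, rfl⟩ := hline x hx hxh
        rw [add_eval, add_eval β, cp, cu, βp, βu]
        ring
      · rw [add_eval', add_eval' α, add_eval' β, cr, cp, cv, αr, αp, αv, βr, βp, βv]
        ring
    · rw [map_mul, constantCoeff_translate, constantCoeff_translate, αp, mul_one]
      exact hp
    · rw [map_neg, (homogeneousComponent_mul_of_isHomogeneous (d := 2) ?_ _).1 e (by omega),
        neg_zero]
      exact (isHomogeneous_linearForm β).pow 2
    · rw [translate_mul, translate_sub, translate_mul, sq, translate_mul, translate_linearForm p c,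
        translate_linearForm p β, cp, βp, C_0]
      ring
  · intro i
    refine Fin.cases ?_ (fun i => ?_) i
    -- The point $p+sv_0+s^2r$ of the conic is divided by its $k$-th coordinate, which brings it
    -- into the affine chart and is nonzero for small $s$.
    · set δ : ℂ → ℂ := fun s => 1 + s * v₀ k + s ^ 2 * r k with hδ
      have hδc : Continuous δ := by fun_prop
      have hδ0 : δ 0 ≠ 0 := by simp [hδ]
      refine ⟨fun s => (δ s)⁻¹ • (v₀ - v₀ k • p + s • (r - r k • p)), ?_, ?_⟩
      · have hcont : ContinuousAt
            (fun s => (δ s)⁻¹ • (v₀ - v₀ k • p + s • (r - r k • p))) 0 :=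
          (hδc.continuousAt.inv₀ hδ0).smul (by fun_prop)
        have := hcont.tendsto.mono_left (nhdsWithin_le_nhds (s := {0}ᶜ))
        simpa [hδ] using this
      · have hev : ∀ᶠ s in nhdsWithin (0 : ℂ) {0}ᶜ, δ s ≠ 0 :=
          (hδc.continuousAt.eventually_ne hδ0).filter_mono nhdsWithin_le_nhds
        filter_upwards [hev] with s hs
        constructor
        · right
          have hmem : (δ s)⁻¹ • ((1 : ℂ) ^ 2 • p + (1 * s) • v₀ + s ^ 2 • r) ∈ conicCone p v₀ r :=
            smul_mem_conicCone _ ⟨1, s, rfl⟩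
          convert hmem using 1
          funext l
          simp only [Pi.sub_apply, Pi.add_apply, Pi.smul_apply, smul_eq_mul]
          field_simp
          simp only [hδ]
          ring
        · simp [hk]
    · refine ⟨fun _ => u i - u i k • p, ?_, Filter.Eventually.of_forall fun s =>
        ⟨Or.inl (Set.mem_iUnion_of_mem (f i) ?_), ?_⟩⟩
      · simp only [Fin.cons_succ]
        exact tendsto_const_nhds
      · rw [SetLike.mem_coe, hL, Submodule.mem_span_pair]
        refine ⟨1 - s * u i k, s, ?_⟩
        funext l
        simp only [Pi.sub_apply, Pi.add_apply, Pi.smul_apply, smul_eq_mul]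
        ring
      · simp [hk]

end Configurations

/-! ### Graph curves -/

section GraphCurve

variable {σ : Type}

theorem exists_span_pair_eq [Fintype σ] {L : Submodule ℂ (σ → ℂ)} (hL : Module.finrank ℂ L = 2)
    {p : σ → ℂ} (hp : p ≠ 0) (hpL : p ∈ L) :
    ∃ u, LinearIndependent ℂ ![p, u] ∧ L = Submodule.span ℂ {p, u} := by
  have hlt : Submodule.span ℂ {p} < L := by
    refine lt_of_le_of_ne (by simpa using hpL) fun h => ?_
    rw [← h, finrank_span_singleton hp] at hL
    omega
  obtain ⟨u, hu, hup⟩ := SetLike.exists_of_lt hlt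
  have hli : LinearIndependent ℂ ![p, u] := by
    rw [LinearIndependent.pair_iff' hp]
    exact fun a ha => hup (Submodule.mem_span_singleton.2 ⟨a, ha⟩)
  refine ⟨u, hli, (Submodule.eq_of_le_of_finrank_eq ?_ ?_).symm⟩
  · rw [Submodule.span_le]
    rintro x (rfl | rfl)
    · exact hpL
    · exact hu
  · have h := finrank_span_eq_card hli
    rw [Matrix.range_cons, Matrix.range_cons, Matrix.range_empty, Set.union_empty] at h
    rw [hL]
    exact h

theorem linearIndependent_cons_pair {p u w : σ → ℂ} (hu : LinearIndependent ℂ ![p, u])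
    (hw : w ∉ Submodule.span ℂ {p, u}) :
    LinearIndependent ℂ (Fin.cons p ![u, w] : Fin 3 → σ → ℂ) := by
  rw [Fintype.linearIndependent_iff]
  intro g hg
  replace hg : g 0 • p + g 1 • u + g 2 • w = 0 := (Fin.sum_univ_three _).symm.trans hg
  have h2 : g 2 = 0 := by
    by_contra h2
    refine hw (Submodule.mem_span_pair.2 ⟨-(g 2)⁻¹ * g 0, -(g 2)⁻¹ * g 1, ?_⟩)
    funext i
    have hi := congrFun hg i
    simp only [Pi.add_apply, Pi.smul_apply, smul_eq_mul, Pi.zero_apply] at hi ⊢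
    field_simp
    linear_combination -hi
  rw [h2, zero_smul, add_zero] at hg
  obtain ⟨h0, h1⟩ := LinearIndependent.pair_iff.1 hu _ _ hg
  intro i
  fin_cases i
  exacts [h0, h1, h2]

theorem span_le_of_vanishingIdeal_le [Fintype σ] {m n : ℕ} {v : Fin m → σ → ℂ} {w : Fin n → σ → ℂ}
    (h : vanishingIdeal ℂ (⋃ i, (Submodule.span ℂ {v i} : Set (σ → ℂ))) ≤
      vanishingIdeal ℂ (⋃ i, (Submodule.span ℂ {w i} : Set (σ → ℂ)))) :
    Submodule.span ℂ (Set.range w) ≤ Submodule.span ℂ (Set.range v) := by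
  rw [Submodule.span_le]
  rintro _ ⟨j, rfl⟩
  by_contra hj
  obtain ⟨g, hg, hgv⟩ := Submodule.exists_le_ker_of_notMem hj
  obtain ⟨c, hc⟩ := exists_linearForm_eq g
  have hmem : linearForm c ∈
      vanishingIdeal ℂ (⋃ i, (Submodule.span ℂ {v i} : Set (σ → ℂ))) := by
    intro x hx
    obtain ⟨i, hi⟩ := Set.mem_iUnion.1 hx
    refine (hc x).trans (hgv ?_)
    exact Submodule.span_mono (Set.singleton_subset_iff.2 (Set.mem_range_self i)) hi
  exact hg ((hc _).symm.trans
    (h hmem _ (Set.mem_iUnion_of_mem j (Submodule.mem_span_singleton_self _))))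

/-- Linear forms in the ideal determine the span of the lines, whose dimension is their number.
Hence a node is never also a point with a different number of branches. -/
theorem card_eq_of_vanishingIdeal_eq [Fintype σ] {m n : ℕ} {v : Fin m → σ → ℂ}
    {w : Fin n → σ → ℂ} (hv : LinearIndependent ℂ v) (hw : LinearIndependent ℂ w)
    (h : vanishingIdeal ℂ (⋃ i, (Submodule.span ℂ {v i} : Set (σ → ℂ))) =
      vanishingIdeal ℂ (⋃ i, (Submodule.span ℂ {w i} : Set (σ → ℂ)))) : m = n := by
  have hspan := le_antisymm (span_le_of_vanishingIdeal_le h.ge) (span_le_of_vanishingIdeal_le h.le)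
  have h1 := finrank_span_eq_card hv
  rw [hspan, finrank_span_eq_card hw] at h1
  simpa using h1.symm

theorem isPrime_vanishingIdeal_span_pair (u w : σ → ℂ) :
    (vanishingIdeal ℂ (Submodule.span ℂ {u, w} : Set (σ → ℂ))).IsPrime := by
  refine isPrime_vanishingIdeal_of_param (ι := Fin 2)
    (fun j => X 0 * C (u j) + X 1 * C (w j)) ?_
  ext x
  rw [SetLike.mem_coe, Submodule.mem_span_pair]
  constructor
  · rintro ⟨a, b, rfl⟩
    exact ⟨![a, b], funext fun j => by simp⟩
  · rintro ⟨s, rfl⟩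
    exact ⟨s 0, s 1, funext fun j => by simp⟩

variable [Fintype σ] {V : Type} {L : V → Submodule ℂ (σ → ℂ)}

theorem mem_of_vanishingIdeal_le (hrank : ∀ v, Module.finrank ℂ (L v) = 2) {v w : V}
    (hinj : Function.Injective L)
    (h : vanishingIdeal ℂ (L v : Set (σ → ℂ)) ≤ vanishingIdeal ℂ (L w : Set (σ → ℂ))) :
    v = w := by
  refine hinj (Submodule.eq_of_le_of_finrank_eq (fun x hx => ?_) ((hrank w).trans
    (hrank v).symm)).symm
  by_contra hxv
  obtain ⟨g, hg, hgv⟩ := Submodule.exists_le_ker_of_notMem hxv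
  obtain ⟨c, hc⟩ := exists_linearForm_eq g
  have hmem : linearForm c ∈ vanishingIdeal ℂ (L v : Set (σ → ℂ)) :=
    fun y hy => (hc y).trans (hgv hy)
  exact hg ((hc x).symm.trans (h hmem x hx))

variable [Fintype V]

/-- A prime containing a finite intersection of ideals contains one of them, and the ideals of
distinct lines are incomparable. -/
theorem minimalPrimes_vanishingIdeal_iUnion (hrank : ∀ v, Module.finrank ℂ (L v) = 2)
    (hinj : Function.Injective L) :
    (vanishingIdeal ℂ (⋃ v, (L v : Set (σ → ℂ)))).minimalPrimes =
      Set.range fun v => vanishingIdeal ℂ (L v : Set (σ → ℂ)) := by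
  have hprime : ∀ v, (vanishingIdeal ℂ (L v : Set (σ → ℂ))).IsPrime := by
    intro v
    obtain ⟨p, hp, hp0⟩ := Submodule.exists_mem_ne_zero_of_ne_bot (p := L v) (fun h => by
      have := hrank v
      rw [h, finrank_bot] at this
      omega)
    obtain ⟨u, -, hu⟩ := exists_span_pair_eq (hrank v) hp0 hp
    rw [hu]
    exact isPrime_vanishingIdeal_span_pair p u
  have hle : ∀ v, vanishingIdeal ℂ (⋃ v, (L v : Set (σ → ℂ))) ≤
      vanishingIdeal ℂ (L v : Set (σ → ℂ)) :=
    fun v f hf x hx => hf x (Set.mem_iUnion_of_mem v hx)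
  have hinf : ∀ Q : Ideal (MvPolynomial σ ℂ), Q.IsPrime →
      vanishingIdeal ℂ (⋃ v, (L v : Set (σ → ℂ))) ≤ Q →
      ∃ v, vanishingIdeal ℂ (L v : Set (σ → ℂ)) ≤ Q := by
    intro Q hQ h
    have : Finset.univ.inf (fun v => vanishingIdeal ℂ (L v : Set (σ → ℂ))) ≤ Q := by
      refine le_trans ?_ h
      intro f hf x hx
      obtain ⟨v, hv⟩ := Set.mem_iUnion.1 hx
      have hle := Finset.inf_le (f := fun v => vanishingIdeal ℂ (L v : Set (σ → ℂ)))
        (Finset.mem_univ v)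
      exact hle hf x hv
    obtain ⟨v, -, hv⟩ := (Ideal.IsPrime.inf_le' hQ).1 this
    exact ⟨v, hv⟩
  ext Q
  constructor
  · rintro ⟨⟨hQ, hIQ⟩, hmin⟩
    obtain ⟨v, hv⟩ := hinf Q hQ hIQ
    exact ⟨v, le_antisymm hv (hmin ⟨hprime v, hle v⟩ hv)⟩
  · rintro ⟨v, rfl⟩
    refine ⟨⟨hprime v, hle v⟩, ?_⟩
    rintro Q ⟨hQ, hIQ⟩ hQv
    obtain ⟨w, hw⟩ := hinf Q hQ hIQ
    obtain rfl := mem_of_vanishingIdeal_le hrank hinj (hw.trans hQv)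
    exact hw

/-- The tangent cone at a point that lies on at most two of the lines. -/
theorem exists_tangent_lines (hrank : ∀ v, Module.finrank ℂ (L v) = 2)
    (hinj : Function.Injective L) {p : σ → ℂ} {k : σ} (hk : p k ≠ 0)
    {Y : Set (σ → ℂ)} {q : MvPolynomial σ ℂ}
    (hq : ∀ y ∈ Y, eval y q = 0) (hqp : eval ((p k)⁻¹ • p) q ≠ 0)
    (htwo : ∀ u v w, p ∈ L u → p ∈ L v → p ∈ L w → u = v ∨ v = w ∨ u = w) :
    ∃ (n : ℕ) (f : Fin n → V), n ≤ 2 ∧ Function.Injective f ∧ Set.range f = {v | p ∈ L v} ∧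
      ∃ v : Fin n → σ → ℂ, LinearIndependent ℂ v ∧
      tangentConeIdeal (vanishingIdeal ℂ ((⋃ j, (L j : Set (σ → ℂ))) ∪ Y) ⊔
        Ideal.span {X k - 1}) ((p k)⁻¹ • p) =
      vanishingIdeal ℂ (⋃ i, (Submodule.span ℂ {v i} : Set (σ → ℂ))) := by
  have hk' : ((p k)⁻¹ • p) k = 1 := by simp [hk]
  have hmem : ∀ v, (p k)⁻¹ • p ∈ L v ↔ p ∈ L v := fun v => (L v).smul_mem_iff (inv_ne_zero hk)
  set a := (p k)⁻¹ • p with ha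
  have ha0 : a ≠ 0 := by
    intro h
    rw [h] at hk'
    exact zero_ne_one hk'
  have key : ∀ (n : ℕ) (f : Fin n → V) (u : Fin n → σ → ℂ), n ≤ 2 → Function.Injective f →
      (∀ i, L (f i) = Submodule.span ℂ {a, u i}) → (∀ j, p ∈ L j → ∃ i, f i = j) →
      LinearIndependent ℂ (Fin.cons a u : Fin (n + 1) → σ → ℂ) →
      ∃ (n : ℕ) (f : Fin n → V), n ≤ 2 ∧ Function.Injective f ∧ Set.range f = {v | p ∈ L v} ∧
      ∃ v : Fin n → σ → ℂ, LinearIndependent ℂ v ∧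
      tangentConeIdeal (vanishingIdeal ℂ ((⋃ j, (L j : Set (σ → ℂ))) ∪ Y) ⊔
        Ideal.span {X k - 1}) a =
      vanishingIdeal ℂ (⋃ i, (Submodule.span ℂ {v i} : Set (σ → ℂ))) := by
    intro n f u hn hf hL hfp hli
    refine ⟨n, f, hn, hf, ?_, ?_⟩
    · ext j
      constructor
      · rintro ⟨i, rfl⟩
        change p ∈ L (f i)
        rw [← hmem, hL]
        exact Submodule.subset_span (Or.inl rfl)
      · exact hfp j
    · exact tangentConeIdeal_lines L Y hk' f u hL (fun j hj => hfp j ((hmem j).1 hj)) hli q hq hqp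
  by_cases h0 : ∃ i, p ∈ L i
  · obtain ⟨i, hi⟩ := h0
    obtain ⟨u, hu, hLu⟩ := exists_span_pair_eq (hrank i) ha0 ((hmem i).2 hi)
    by_cases h1 : ∃ j, j ≠ i ∧ p ∈ L j
    · obtain ⟨j, hji, hj⟩ := h1
      obtain ⟨w, hw, hLw⟩ := exists_span_pair_eq (hrank j) ha0 ((hmem j).2 hj)
      refine key 2 ![i, j] ![u, w] le_rfl ?_ ?_ ?_ ?_
      · intro x y hxy
        fin_cases x <;> fin_cases y <;> first | rfl | exact absurd hxy hji.symm | exact absurd hxy hji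
      · intro x
        fin_cases x
        exacts [hLu, hLw]
      · intro l hl
        rcases htwo i j l hi hj hl with h | h | h
        · exact absurd h.symm hji
        · exact ⟨1, h⟩
        · exact ⟨0, h⟩
      · refine linearIndependent_cons_pair hu fun hwu => hji (hinj ?_)
        refine Submodule.eq_of_le_of_finrank_eq ?_ ((hrank j).trans (hrank i).symm)
        rw [hLw, Submodule.span_le]
        rintro x (rfl | rfl)
        · exact (hmem i).2 hi
        · rw [hLu]
          exact hwu
    · push Not at h1
      refine key 1 ![i] ![u] (by norm_num) ?_ ?_ ?_ hu
      · exact Function.injective_of_subsingleton _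
      · intro x
        fin_cases x
        exact hLu
      · intro l hl
        refine ⟨0, ?_⟩
        by_contra hli
        exact h1 l (fun h => hli h.symm) hl
  · push Not at h0
    refine key 0 Fin.elim0 Fin.elim0 (by norm_num) (fun x => x.elim0) (fun x => x.elim0)
      (fun j hj => absurd hj (h0 j)) ?_
    rw [linearIndependent_finCons]
    refine ⟨linearIndependent_empty_type, ?_⟩
    rw [Set.range_eq_empty, Submodule.span_empty]
    exact ha0

theorem exists_mem_of_mem_zeroLocus {p : σ → ℂ} {Y : Set (σ → ℂ)} {q : MvPolynomial σ ℂ}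
    (hq : ∀ y ∈ Y, eval y q = 0) (hqp : eval p q ≠ 0)
    (hp : p ∈ zeroLocus ℂ (vanishingIdeal ℂ ((⋃ v, (L v : Set (σ → ℂ))) ∪ Y))) :
    ∃ v, p ∈ L v := by
  by_contra! h
  obtain ⟨g, hg, hgL⟩ := exists_polynomial_separating L p
  have : eval p (g * q) = 0 := by
    refine hp _ ?_
    rintro x (hx | hx)
    · obtain ⟨v, hv⟩ := Set.mem_iUnion.1 hx
      change eval x _ = 0
      rw [map_mul, hgL v (h v) x hv, zero_mul]
    · change eval x _ = 0
      rw [map_mul, hq x hx, mul_zero]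
  rw [map_mul] at this
  exact mul_ne_zero hg hqp this

/-- Lines that meet as prescribed by a triangle-free graph form a graph curve. -/
theorem isGraphCurve_of_lines {G : SimpleGraph V} (hrank : ∀ v, Module.finrank ℂ (L v) = 2)
    (hinj : Function.Injective L)
    (hG : ∀ v w, v ≠ w → (G.Adj v w ↔ ∃ p, p ≠ 0 ∧ p ∈ L v ∧ p ∈ L w))
    (htri : ∀ u v w, G.Adj u v → G.Adj v w → ¬G.Adj u w) :
    IsGraphCurve (vanishingIdeal ℂ (⋃ v, (L v : Set (σ → ℂ)))) G L := by
  -- Three distinct lines through one point would be pairwise adjacent, forming a triangle.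
  have htwo : ∀ p : σ → ℂ, p ≠ 0 → ∀ u v w, p ∈ L u → p ∈ L v → p ∈ L w →
      u = v ∨ v = w ∨ u = w := by
    intro p hp u v w hu hv hw
    by_contra! h
    exact htri u v w ((hG u v h.1).2 ⟨p, hp, hu, hv⟩) ((hG v w h.2.1).2 ⟨p, hp, hv, hw⟩)
      ((hG u w h.2.2).2 ⟨p, hp, hu, hw⟩)
  have htan := fun (p : σ → ℂ) (k : σ) (hk : p k ≠ 0) htwo =>
    exists_tangent_lines hrank hinj hk (Y := ∅) (q := 1) (by simp) (by simp) htwo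
  simp only [Set.union_empty] at htan
  have hnode : ∀ p, IsNode (vanishingIdeal ℂ (⋃ v, (L v : Set (σ → ℂ)))) p →
      ∃ v w, v ≠ w ∧ {u | p ∈ L u} = {v, w} := by
    rintro p ⟨k, hk, v, hv, hcone⟩
    have hp : p ≠ 0 := fun h => hk (by rw [h]; rfl)
    obtain ⟨n, f, -, hf, hrange, w, hw, hcone'⟩ := htan p k hk (htwo p hp)
    obtain rfl := card_eq_of_vanishingIdeal_eq hv hw (hcone.symm.trans hcone')
    refine ⟨f 0, f 1, fun h => absurd (hf h) (by decide), ?_⟩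
    rw [← hrange]
    ext u
    simp [Fin.exists_fin_two, eq_comm]
  refine ⟨hrank, hinj, minimalPrimes_vanishingIdeal_iUnion hrank hinj, ?_, hnode, ?_⟩
  · intro p hpI hp
    obtain ⟨k, hk⟩ := Function.ne_iff.1 hp
    obtain ⟨n, f, hn, hf, hrange, w, hw, hcone⟩ := htan p k hk (htwo p hp)
    obtain ⟨v, hv⟩ := exists_mem_of_mem_zeroLocus (L := L) (Y := ∅) (q := 1) (p := p) (by simp)
      (by simp) (by rwa [Set.union_empty])
    have hvr : v ∈ Set.range f := by rw [hrange]; exact hv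
    obtain ⟨i, -⟩ := hvr
    have hi := i.is_lt
    obtain rfl | rfl : n = 1 ∨ n = 2 := by omega
    · exact Or.inl ⟨k, hk, w, hw, hcone⟩
    · exact Or.inr ⟨k, hk, w, hw, hcone⟩
  · intro v w hvw
    constructor
    · intro h
      obtain ⟨p, hp, hpv, hpw⟩ := (hG v w hvw).1 h
      refine ⟨p, hpv, hpw, ?_⟩
      obtain ⟨k, hk⟩ := Function.ne_iff.1 hp
      obtain ⟨n, f, hn, hf, hrange, u, hu, hcone⟩ := htan p k hk (htwo p hp)
      have hvr : v ∈ Set.range f := by rw [hrange]; exact hpv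
      have hwr : w ∈ Set.range f := by rw [hrange]; exact hpw
      obtain ⟨i, rfl⟩ := hvr
      obtain ⟨j, rfl⟩ := hwr
      obtain rfl : n = 2 := by
        have hi := i.is_lt
        have hj := j.is_lt
        have hij : (i : ℕ) ≠ j := fun h => hvw (by rw [Fin.ext h])
        omega
      exact ⟨k, hk, u, hu, hcone⟩
    · rintro ⟨p, hpv, hpw, hnp⟩
      obtain ⟨k, hk, -⟩ := hnp
      exact (hG v w hvw).2 ⟨p, fun h => hk (by rw [h]; rfl), hpv, hpw⟩

end GraphCurve

/-! ### `X_1` is a graph curve -/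

theorem spinVec_injective {t₀ t₁ α β : ℂ} (h : α * (t₁ - t₀) - β * t₀ = 1) :
    Function.Injective (spinVec t₀ t₁ : (Fin 7 → ℂ) → SpinIdx → ℂ) :=
  Function.LeftInverse.injective (spinRetract_spinVec h)

theorem spinVec_injective_one :
    Function.Injective (spinVec 1 1 : (Fin 7 → ℂ) → SpinIdx → ℂ) :=
  spinVec_injective (α := 0) (β := -1) (by ring)

theorem spinVec_injective_infty :
    Function.Injective (spinVec 1 0 : (Fin 7 → ℂ) → SpinIdx → ℂ) :=
  spinVec_injective (α := 0) (β := -1) (by ring)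

theorem spinVec_zero (t₀ t₁ : ℂ) : spinVec t₀ t₁ (0 : Fin 7 → ℂ) = 0 := by
  have := spinVec_smul t₀ t₁ 0 (0 : Fin 7 → ℂ)
  rwa [zero_smul, zero_smul] at this

theorem linearIndependent_spinVec {t₀ t₁ : ℂ}
    (hinj : Function.Injective (spinVec t₀ t₁ : (Fin 7 → ℂ) → SpinIdx → ℂ)) {n : ℕ}
    {u : Fin n → Fin 7 → ℂ} (hu : LinearIndependent ℂ u) :
    LinearIndependent ℂ fun i => spinVec t₀ t₁ (u i) := by
  let T : (Fin 7 → ℂ) →ₗ[ℂ] SpinIdx → ℂ :=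
    { toFun := spinVec t₀ t₁
      map_add' := spinVec_add t₀ t₁
      map_smul' := spinVec_smul t₀ t₁ }
  exact hu.map' T (LinearMap.ker_eq_bot.2 hinj)

theorem finrank_spinSpan {t₀ t₁ : ℂ}
    (hinj : Function.Injective (spinVec t₀ t₁ : (Fin 7 → ℂ) → SpinIdx → ℂ))
    {u w : Fin 7 → ℂ} (hli : LinearIndependent ℂ ![u, w]) :
    Module.finrank ℂ (spinSpan t₀ t₁ u w) = 2 := by
  have h := finrank_span_eq_card (linearIndependent_spinVec hinj hli)
  have hr : (Set.range fun i => spinVec t₀ t₁ (![u, w] i)) =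
      {spinVec t₀ t₁ u, spinVec t₀ t₁ w} := by
    ext x
    simp [Fin.exists_fin_two, eq_comm]
  rw [hr] at h
  exact h

theorem lineOne_pivots (a b : ℂ) (i : Fin 12) :
    lineOne a b i (pivotsOne i).1 = a ∧ lineOne a b i (pivotsOne i).2 = b := by
  fin_cases i <;> exact ⟨rfl, rfl⟩

theorem finrank_spinLineOne (i : Fin 12) : Module.finrank ℂ (spinLineOne i) = 2 := by
  refine finrank_spinSpan spinVec_injective_one
    (linearIndependent_pair_of_coord (pivotsOne i).1 (pivotsOne i).2 ?_ ?_ ?_)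
  · rw [(lineOne_pivots 1 0 i).1]
    exact one_ne_zero
  · exact (lineOne_pivots 0 1 i).1
  · rw [(lineOne_pivots 0 1 i).2]
    exact one_ne_zero

/-- The neighbours of the vertices of `G_1`. -/
def neighborsOne : Fin 12 → List (Fin 12) :=
  ![[1, 8, 9], [0, 2, 10], [1, 11, 4], [4, 9, 10], [2, 5, 3], [4, 6, 11], [5, 7, 9], [6, 8, 10],
    [0, 7, 11], [0, 3, 6], [1, 3, 7], [2, 5, 8]]

theorem graphOne_adj (v w : Fin 12) : graphOne.Adj v w ↔ w ∈ neighborsOne v := by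
  simp only [graphOne, SimpleGraph.fromEdgeSet_adj, Set.mem_insert_iff, Set.mem_singleton_iff]
  revert v w
  decide

theorem neighborsOne_triangle_free : ∀ u, ∀ v ∈ neighborsOne u, ∀ w ∈ neighborsOne v,
    w ∉ neighborsOne u := by
  decide

/-- This gives injectivity of the family of lines: were two lines equal, the point where one meets
`u` would make `u` adjacent to the other as well. -/
theorem exists_neighborsOne_separating : ∀ v w, v ≠ w →
    ∃ u ∈ neighborsOne v, u ∉ neighborsOne w ∧ u ≠ w ∧ u ≠ v := by
  decide

/-- All intersection points have parameters in $\{-1,0,1\}$, so they are found by a finite search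
over the integers. -/
theorem exists_lineOne_int_eq : ∀ v, ∀ w ∈ neighborsOne v, ∃ a ∈ [-1, 0, (1 : ℤ)],
    ∃ b ∈ [-1, 0, (1 : ℤ)], ∃ c ∈ [-1, 0, (1 : ℤ)], ∃ d ∈ [-1, 0, (1 : ℤ)],
      lineOne a b v = lineOne c d w ∧ (a ≠ 0 ∨ b ≠ 0) := by
  decide +kernel

theorem lineOne_eq_zero_iff {a b : ℂ} {v : Fin 12} : lineOne a b v = 0 ↔ a = 0 ∧ b = 0 := by
  constructor
  · intro h
    obtain ⟨h1, h2⟩ := lineOne_pivots a b v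
    rw [h] at h1 h2
    exact ⟨h1.symm, h2.symm⟩
  · rintro ⟨rfl, rfl⟩
    rw [lineOne_eq, zero_smul, zero_smul, add_zero]

theorem lineOne_disjoint_of_lt {a b c d : ℂ} {v w : Fin 12} (hvw : v < w)
    (hw : w ∉ neighborsOne v) (h : lineOne a b v = lineOne c d w) : a = 0 ∧ b = 0 := by
  have h0 := congrFun h 0
  have h1 := congrFun h 1
  have h2 := congrFun h 2
  have h3 := congrFun h 3
  have h4 := congrFun h 4
  have h5 := congrFun h 5
  have h6 := congrFun h 6
  clear h
  fin_cases v <;> simp only [lineOne, Fin.reduceFinMk, Fin.zero_eta, Fin.mk_one, Matrix.cons_val]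
    at h0 h1 h2 h3 h4 h5 h6 <;> fin_cases w <;>
    first
    | exact absurd hvw (by decide)
    | exact absurd hw (by decide)
    | (simp only [Fin.reduceFinMk, Fin.zero_eta, Fin.mk_one, Matrix.cons_val]
        at h0 h1 h2 h3 h4 h5 h6
       clear hvw hw
       constructor <;> grind)

theorem graphOne_adj_iff (v w : Fin 12) (hvw : v ≠ w) :
    graphOne.Adj v w ↔ ∃ p, p ≠ 0 ∧ p ∈ spinLineOne v ∧ p ∈ spinLineOne w := by
  constructor
  · intro h
    obtain ⟨a, -, b, -, c, -, d, -, h1, h2⟩ := exists_lineOne_int_eq v w ((graphOne_adj v w).1 h)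
    have hcast : lineOne (a : ℂ) b v = lineOne (c : ℂ) d w := by
      funext j
      have := congrArg (Int.castRingHom ℂ) (congrFun h1 j)
      rwa [map_lineOne, map_lineOne] at this
    refine ⟨spinVec 1 1 (lineOne (a : ℂ) b v), fun h0 => ?_, mem_spinLineOne.2 ⟨a, b, rfl⟩,
      mem_spinLineOne.2 ⟨c, d, by rw [hcast]⟩⟩
    have := lineOne_eq_zero_iff.1 (spinVec_injective_one (h0.trans (spinVec_zero 1 1).symm))
    rw [Int.cast_eq_zero, Int.cast_eq_zero] at this
    omega
  · rintro ⟨p, hp, hv, hw⟩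
    have key : ∀ v w : Fin 12, v < w → p ∈ spinLineOne v → p ∈ spinLineOne w →
        w ∈ neighborsOne v := by
      intro v w hlt hv hw
      obtain ⟨a, b, rfl⟩ := mem_spinLineOne.1 hv
      obtain ⟨c, d, h⟩ := mem_spinLineOne.1 hw
      by_contra hn
      obtain ⟨rfl, rfl⟩ := lineOne_disjoint_of_lt hlt hn (spinVec_injective_one h)
      exact hp (by rw [lineOne_eq_zero_iff.2 ⟨rfl, rfl⟩, spinVec_zero])
    rcases lt_or_gt_of_ne hvw with hlt | hlt
    · exact (graphOne_adj v w).2 (key v w hlt hv hw)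
    · exact ((graphOne_adj w v).2 (key w v hlt hw hv)).symm

theorem isGraphCurve_limitOne : IsGraphCurve limitOne graphOne spinLineOne := by
  rw [limitOne_eq]
  refine isGraphCurve_of_lines finrank_spinLineOne ?_ graphOne_adj_iff ?_
  · intro v w h
    by_contra hvw
    obtain ⟨u, huv, huw, huw', huv'⟩ := exists_neighborsOne_separating v w hvw
    obtain ⟨p, hp, hpv, hpu⟩ := (graphOne_adj_iff v u huv'.symm).1 ((graphOne_adj v u).2 huv)
    rw [h] at hpv
    exact huw ((graphOne_adj w u).1 ((graphOne_adj_iff w u huw'.symm).2 ⟨p, hp, hpv, hpu⟩))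
  · intro u v w huv hvw huw
    exact neighborsOne_triangle_free u v ((graphOne_adj u v).1 huv) w ((graphOne_adj v w).1 hvw)
      ((graphOne_adj u w).1 huw)

/-! ### Points of a union of lines and a conic -/

section Points

variable {σ : Type}

theorem conicCone_smul {c : ℂ} (hc : c ≠ 0) (p v r : σ → ℂ) :
    conicCone (c • p) (c • v) (c • r) = conicCone p v r := by
  have key : ∀ (c : ℂ) (p v r : σ → ℂ), conicCone (c • p) (c • v) (c • r) ⊆ conicCone p v r := by
    rintro c p v r _ ⟨s, t, rfl⟩
    have := smul_mem_conicCone c (⟨s, t, rfl⟩ : _ ∈ conicCone p v r)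
    simpa only [smul_add, smul_comm c] using this
  refine (key c p v r).antisymm ?_
  have := key c⁻¹ (c • p) (c • v) (c • r)
  simpa only [inv_smul_smul₀ hc] using this

theorem TangentConeIsLines.smul {n : ℕ} {I : Ideal (MvPolynomial σ ℂ)} {p : σ → ℂ}
    (h : TangentConeIsLines n I p) {c : ℂ} (hc : c ≠ 0) : TangentConeIsLines n I (c • p) := by
  obtain ⟨k, hk, v, hv, hcone⟩ := h
  refine ⟨k, mul_ne_zero hc hk, v, hv, ?_⟩
  have : ((c • p) k)⁻¹ • c • p = (p k)⁻¹ • p := by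
    rw [Pi.smul_apply, smul_eq_mul, mul_inv, smul_smul, mul_right_comm, inv_mul_cancel₀ hc, one_mul]
  rw [this]
  exact hcone

theorem span_smul_pair {c : ℂ} (hc : c ≠ 0) (p u : σ → ℂ) :
    Submodule.span ℂ {c • p, u} = Submodule.span ℂ {p, u} := by
  rw [Submodule.span_insert, Submodule.span_insert, Submodule.span_singleton_smul_eq hc.isUnit]

variable [Fintype σ] {ι : Type} [Fintype ι] {L : ι → Submodule ℂ (σ → ℂ)}

theorem tangentConeIsLines_of_lines {Y : Set (σ → ℂ)} {p : σ → ℂ} {n : ℕ} (f : Fin n → ι)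
    (u : Fin n → σ → ℂ) (hL : ∀ i, L (f i) = Submodule.span ℂ {p, u i})
    (hf : ∀ j, p ∈ L j → ∃ i, f i = j)
    (hli : LinearIndependent ℂ (Fin.cons p u : Fin (n + 1) → σ → ℂ)) {q : MvPolynomial σ ℂ}
    (hY : ∀ y ∈ Y, ∀ c : ℂ, c • y ∈ Y) (hq : ∀ y ∈ Y, eval y q = 0) (hqp : eval p q ≠ 0) :
    TangentConeIsLines n (vanishingIdeal ℂ ((⋃ j, (L j : Set (σ → ℂ))) ∪ Y)) p := by
  obtain ⟨k, hk⟩ := Function.ne_iff.1 (hli.ne_zero 0)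
  replace hk : p k ≠ 0 := hk
  have hc := inv_ne_zero hk
  have hp : p = p k • (p k)⁻¹ • p := by rw [smul_smul, mul_inv_cancel₀ hk, one_smul]
  refine ⟨k, hk, tangentConeIdeal_lines L Y (inv_mul_cancel₀ hk) f u (fun i => ?_)
    (fun j hj => hf j (((L j).smul_mem_iff hc).1 hj)) ?_
    (aeval (fun i => C (p k) * X i) q) (fun y hy => ?_) ?_⟩
  · rw [hL, span_smul_pair hc]
  · convert hli.units_smul (Fin.cons (Units.mk0 _ hc) 1) using 1
    funext i
    refine Fin.cases ?_ (fun i => ?_) i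
    · rfl
    · simp
  · rw [eval_aeval_eq]
    simpa [Pi.smul_def] using hq _ (hY y hy (p k))
  · rw [eval_aeval_eq]
    have : (fun i => eval ((p k)⁻¹ • p) (C (p k) * X i)) = p := by
      conv_rhs => rw [hp]
      funext i
      simp
    rwa [this]

theorem tangentConeIsLines_of_conic {p v₀ r : σ → ℂ} {n : ℕ} (f : Fin n → ι)
    (u : Fin n → σ → ℂ) (hL : ∀ i, L (f i) = Submodule.span ℂ {p, u i})
    (hf : ∀ j, p ∈ L j → ∃ i, f i = j)
    (hli : LinearIndependent ℂ
      (Fin.cons r (Fin.cons p (Fin.cons v₀ u)) : Fin (n + 3) → σ → ℂ)) :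
    TangentConeIsLines (n + 1)
      (vanishingIdeal ℂ ((⋃ j, (L j : Set (σ → ℂ))) ∪ conicCone p v₀ r)) p := by
  obtain ⟨k, hk⟩ := Function.ne_iff.1 (hli.ne_zero 1)
  replace hk : p k ≠ 0 := hk
  have hc := inv_ne_zero hk
  rw [← conicCone_smul hc]
  refine ⟨k, hk, tangentConeIdeal_conic L (inv_mul_cancel₀ hk) f u (fun i => ?_)
    (fun j hj => hf j (((L j).smul_mem_iff hc).1 hj)) ?_⟩
  · rw [hL, span_smul_pair hc]
  · convert hli.units_smul
      (Fin.cons (Units.mk0 _ hc) (Fin.cons (Units.mk0 _ hc) (Fin.cons (Units.mk0 _ hc) 1))) using 1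
    funext i
    refine Fin.cases rfl (fun i => Fin.cases rfl (fun i => Fin.cases rfl (fun i => ?_) i) i) i
    simp

end Points

/-! ### The lines and the conic in `X_∞` -/

theorem lineInfty_pivots (a b : ℂ) (i : Fin 10) :
    lineInfty a b i (pivotsInfty i).1 = a ∧ lineInfty a b i (pivotsInfty i).2 = b := by
  fin_cases i <;> exact ⟨rfl, rfl⟩

theorem finrank_spinLineInfty (i : Fin 10) : Module.finrank ℂ (spinLineInfty i) = 2 := by
  refine finrank_spinSpan spinVec_injective_infty
    (linearIndependent_pair_of_coord (pivotsInfty i).1 (pivotsInfty i).2 ?_ ?_ ?_)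
  · rw [(lineInfty_pivots 1 0 i).1]
    exact one_ne_zero
  · exact (lineInfty_pivots 0 1 i).1
  · rw [(lineInfty_pivots 0 1 i).2]
    exact one_ne_zero

theorem spinVec_mem_spinLineInfty {z : Fin 7 → ℂ} {i : Fin 10} :
    spinVec 1 0 z ∈ spinLineInfty i ↔
      ∀ j, z j = lineInfty (z (pivotsInfty i).1) (z (pivotsInfty i).2) i j := by
  rw [mem_spinLineInfty]
  constructor
  · rintro ⟨a, b, h⟩ j
    rw [spinVec_injective_infty h, (lineInfty_pivots a b i).1, (lineInfty_pivots a b i).2]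
  · exact fun h => ⟨_, _, congrArg _ (funext h)⟩

theorem spinLineInfty_injective : Function.Injective spinLineInfty := by
  -- Equal lines would place both spanning vectors of one on the other. The vectors are integral, so
  -- this is refuted by evaluation.
  have key : ∀ i j : Fin 10, i < j → (∀ k, lineInfty (1 : ℤ) 0 i k =
      lineInfty (lineInfty 1 0 i (pivotsInfty j).1) (lineInfty 1 0 i (pivotsInfty j).2) j k) →
      (∀ k, lineInfty (0 : ℤ) 1 i k =
      lineInfty (lineInfty 0 1 i (pivotsInfty j).1) (lineInfty 0 1 i (pivotsInfty j).2) j k) →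
      False := by
    decide +kernel
  have hlt : ∀ i j : Fin 10, i < j → spinLineInfty i ≠ spinLineInfty j := by
    intro i j hij h
    have hcast : ∀ (a b : ℤ) k, lineInfty a b i k =
        lineInfty (lineInfty a b i (pivotsInfty j).1) (lineInfty a b i (pivotsInfty j).2) j k := by
      intro a b k
      have : spinVec 1 0 (lineInfty (a : ℂ) b i) ∈ spinLineInfty j := by
        rw [← h]
        exact mem_spinLineInfty.2 ⟨_, _, rfl⟩
      have := spinVec_mem_spinLineInfty.1 this k
      refine Int.cast_injective (α := ℂ) ?_
      have hm := map_lineInfty (Int.castRingHom ℂ)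
      simp only [Int.coe_castRingHom] at hm
      rw [hm, hm, hm, hm]
      exact this
    exact key i j hij (hcast 1 0) (hcast 0 1)
  intro i j h
  rcases lt_trichotomy i j with hij | hij | hij
  · exact absurd h (hlt i j hij)
  · exact hij
  · exact absurd h.symm (hlt j i hij)

/-- The points that can lie on three of the lines in `X_∞`. -/
def IsTripleInfty (z : Fin 7 → ℂ) : Prop :=
  z 0 = 0 ∧ z 1 = 0 ∧ z 2 = 0 ∧ z 3 = 0 ∧ z 4 = 0 ∧ (z 5 = 0 ∨ z 6 = 0 ∨ z 5 = z 6)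

theorem isTripleInfty_of_lt {z : Fin 7 → ℂ} {u v w : Fin 10} (huv : u < v) (hvw : v < w)
    (hu : spinVec 1 0 z ∈ spinLineInfty u) (hv : spinVec 1 0 z ∈ spinLineInfty v)
    (hw : spinVec 1 0 z ∈ spinLineInfty w) : IsTripleInfty z := by
  rw [spinVec_mem_spinLineInfty] at hu hv hw
  have key : ∀ i, (∀ j, z j = lineInfty (z (pivotsInfty i).1) (z (pivotsInfty i).2) i j) →
      (z 0 = lineInfty (z (pivotsInfty i).1) (z (pivotsInfty i).2) i 0 ∧
      z 1 = lineInfty (z (pivotsInfty i).1) (z (pivotsInfty i).2) i 1 ∧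
      z 2 = lineInfty (z (pivotsInfty i).1) (z (pivotsInfty i).2) i 2 ∧
      z 3 = lineInfty (z (pivotsInfty i).1) (z (pivotsInfty i).2) i 3 ∧
      z 4 = lineInfty (z (pivotsInfty i).1) (z (pivotsInfty i).2) i 4 ∧
      z 5 = lineInfty (z (pivotsInfty i).1) (z (pivotsInfty i).2) i 5 ∧
      z 6 = lineInfty (z (pivotsInfty i).1) (z (pivotsInfty i).2) i 6) :=
    fun i h => ⟨h 0, h 1, h 2, h 3, h 4, h 5, h 6⟩
  replace hu := key u hu
  replace hv := key v hv
  replace hw := key w hw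
  clear key
  unfold IsTripleInfty
  fin_cases u <;> simp only [lineInfty, pivotsInfty, Fin.reduceFinMk, Fin.zero_eta, Fin.mk_one,
    Matrix.cons_val] at hu <;> fin_cases v <;> first
    | exact absurd huv (by decide)
    | (simp only [lineInfty, pivotsInfty, Fin.reduceFinMk, Fin.mk_one, Matrix.cons_val] at hv
       clear huv
       fin_cases w <;> first
        | exact absurd hvw (by decide)
        | (simp only [lineInfty, pivotsInfty, Fin.reduceFinMk, Matrix.cons_val] at hw
           clear hvw
           grind))

/-! ### The points of `X_∞` -/

theorem spinLineInfty_eq {u w : Fin 7 → ℂ} {i : Fin 10} (hu : spinVec 1 0 u ∈ spinLineInfty i)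
    (hw : spinVec 1 0 w ∈ spinLineInfty i) (hli : LinearIndependent ℂ ![u, w]) :
    spinLineInfty i = Submodule.span ℂ {spinVec 1 0 u, spinVec 1 0 w} := by
  refine (Submodule.eq_of_le_of_finrank_eq ?_ ?_).symm
  · rw [Submodule.span_le]
    rintro x (rfl | rfl)
    exacts [hu, hw]
  · exact (finrank_spinSpan spinVec_injective_infty hli).trans (finrank_spinLineInfty i).symm

/-- Equations of the conic in `X_∞`. -/
def conicInftyEquations {R : Type*} [CommRing R] (z : Fin 7 → R) : Fin 5 → R :=
  ![z 5, z 6, z 1 - z 2 + z 4, z 0 - z 2, (z 2 - z 4) * (z 3 - z 4) - z 4 ^ 2]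

theorem map_conicInftyEquations {R S : Type*} [CommRing R] [CommRing S] (f : R →+* S)
    (z : Fin 7 → R) (j : Fin 5) :
    f (conicInftyEquations z j) = conicInftyEquations (fun i => f (z i)) j := by
  fin_cases j <;> simp [conicInftyEquations]

theorem conicInftyEquations_conicInfty (b c : ℂ) (j : Fin 5) :
    conicInftyEquations (conicInfty b c) j = 0 := by
  simp only [conicInftyEquations, conicInfty, Matrix.cons_val]
  fin_cases j <;> simp only [Fin.reduceFinMk, Fin.zero_eta, Fin.mk_one, Matrix.cons_val] <;> ring

theorem exists_eq_conicInfty {z : Fin 7 → ℂ} (hz : ∀ j, conicInftyEquations z j = 0) :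
    ∃ b c, z = conicInfty b c := by
  have h0 : z 5 = 0 := hz 0
  have h1 : z 6 = 0 := hz 1
  have h2 : z 1 - z 2 + z 4 = 0 := hz 2
  have h3 : z 0 - z 2 = 0 := hz 3
  have h4 : (z 2 - z 4) * (z 3 - z 4) - z 4 ^ 2 = 0 := hz 4
  obtain ⟨b, hb⟩ := IsAlgClosed.exists_pow_nat_eq (z 1) (n := 2) (by norm_num)
  obtain ⟨c, hc, hbc⟩ : ∃ c, c ^ 2 = z 3 - z 4 ∧ b * c = z 4 := by
    obtain ⟨c, hc⟩ := IsAlgClosed.exists_pow_nat_eq (z 3 - z 4) (n := 2) (by norm_num)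
    -- With $b^2=z_1=z_2-z_4$ and $c^2=z_3-z_4$ the equation of the conic reads $(bc)^2=z_4^2$; the
    -- sign is absorbed into $c$.
    have : (b * c - z 4) * (b * c + z 4) = 0 := by grind
    rcases mul_eq_zero.1 this with h | h
    · exact ⟨c, hc, sub_eq_zero.1 h⟩
    · exact ⟨-c, by rw [neg_sq, hc], by linear_combination -h⟩
  refine ⟨b, c, funext fun j => ?_⟩
  fin_cases j <;> simp only [conicInfty, Fin.reduceFinMk, Fin.zero_eta, Fin.mk_one,
    Matrix.cons_val] <;> grind

theorem exists_polynomial_separating_conicInfty {p : SpinIdx → ℂ} (hp : p ∉ spinConicInfty) :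
    ∃ q : MvPolynomial SpinIdx ℂ, (∀ y ∈ spinConicInfty, eval y q = 0) ∧ eval p q ≠ 0 := by
  have hR : ∀ (x : SpinIdx → ℂ) j, eval x (spinRetract 0 0 (-1) X j) = spinRetract 0 0 (-1) x j := by
    intro x j
    rw [map_spinRetract]
    simp
  have hRS : ∀ z : Fin 7 → ℂ, spinRetract 0 0 (-1) (spinVec 1 0 z) = z :=
    spinRetract_spinVec (by ring)
  -- A point of the linear span $\operatorname{im} T$ is separated by an equation of the conic, any
  -- other point by a linear equation of the span.
  by_cases h : p = spinVec 1 0 (spinRetract 0 0 (-1) p)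
  · obtain ⟨j, hj⟩ : ∃ j, conicInftyEquations (spinRetract 0 0 (-1) p) j ≠ 0 := by
      by_contra! hall
      obtain ⟨b, c, hbc⟩ := exists_eq_conicInfty hall
      exact hp ⟨b, c, by rw [← hbc, ← h]⟩
    have hev : ∀ x : SpinIdx → ℂ, eval x (conicInftyEquations (spinRetract 0 0 (-1) X) j) =
        conicInftyEquations (spinRetract 0 0 (-1) x) j := by
      intro x
      rw [map_conicInftyEquations]
      simp only [hR]
    refine ⟨conicInftyEquations (spinRetract 0 0 (-1) X) j, ?_, by rwa [hev]⟩
    rintro _ ⟨b, c, rfl⟩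
    rw [hev, hRS, conicInftyEquations_conicInfty]
  · obtain ⟨I, hI⟩ := Function.ne_iff.1 h
    have hev : ∀ x : SpinIdx → ℂ, eval x (X I - spinVec 1 0 (spinRetract 0 0 (-1) X) I) =
        x I - spinVec 1 0 (spinRetract 0 0 (-1) x) I := by
      intro x
      rw [map_sub, map_spinVec, eval_X, map_one, map_zero]
      simp only [hR]
    refine ⟨X I - spinVec 1 0 (spinRetract 0 0 (-1) X) I, ?_, ?_⟩
    · rintro _ ⟨b, c, rfl⟩
      rw [hev, hRS, sub_self]
    · rw [hev]
      exact sub_ne_zero.2 hI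

theorem smul_mem_spinConicInfty {y : SpinIdx → ℂ} (hy : y ∈ spinConicInfty) (c : ℂ) :
    c • y ∈ spinConicInfty := by
  obtain ⟨b, d, rfl⟩ := hy
  obtain ⟨e, rfl⟩ := IsAlgClosed.exists_pow_nat_eq c (n := 2) (by norm_num)
  refine ⟨e * b, e * d, ?_⟩
  rw [← spinVec_smul]
  congr 1
  funext j
  fin_cases j <;> simp only [conicInfty, Fin.reduceFinMk, Fin.zero_eta, Fin.mk_one,
    Pi.smul_apply, smul_eq_mul, Matrix.cons_val] <;> ring

theorem tangentConeIsLines_lineInfty {n : ℕ} {z : Fin 7 → ℂ} (f : Fin n → Fin 10)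
    (u : Fin n → Fin 7 → ℂ) (hz : spinVec 1 0 z ∉ spinConicInfty)
    (hzf : ∀ j, spinVec 1 0 z ∈ spinLineInfty j ↔ ∃ i, f i = j)
    (hu : ∀ i, spinVec 1 0 (u i) ∈ spinLineInfty (f i))
    (hli : LinearIndependent ℂ (Fin.cons z u : Fin (n + 1) → Fin 7 → ℂ)) :
    TangentConeIsLines n limitInfty (spinVec 1 0 z) := by
  obtain ⟨q, hq, hqp⟩ := exists_polynomial_separating_conicInfty hz
  rw [limitInfty_eq]
  refine tangentConeIsLines_of_lines f (fun i => spinVec 1 0 (u i)) (fun i => ?_)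
    (fun j hj => (hzf j).1 hj) ?_ (fun y hy c => smul_mem_spinConicInfty hy c) hq hqp
  · refine spinLineInfty_eq ((hzf _).2 ⟨i, rfl⟩) (hu i) ?_
    convert hli.comp ![0, i.succ] ?_ using 1
    · funext j
      fin_cases j <;> rfl
    · intro a b hab
      fin_cases a <;> fin_cases b <;> first | rfl | cases hab
  · convert linearIndependent_spinVec spinVec_injective_infty hli using 1
    funext i
    exact Fin.cases rfl (fun _ => rfl) i

theorem tangentConeIsLines_conicInfty {n : ℕ} {p v r : Fin 7 → ℂ}
    (hconic : spinConicInfty = conicCone (spinVec 1 0 p) (spinVec 1 0 v) (spinVec 1 0 r))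
    (f : Fin n → Fin 10) (u : Fin n → Fin 7 → ℂ)
    (hzf : ∀ j, spinVec 1 0 p ∈ spinLineInfty j ↔ ∃ i, f i = j)
    (hu : ∀ i, spinVec 1 0 (u i) ∈ spinLineInfty (f i))
    (hli : LinearIndependent ℂ
      (Fin.cons r (Fin.cons p (Fin.cons v u)) : Fin (n + 3) → Fin 7 → ℂ)) :
    TangentConeIsLines (n + 1) limitInfty (spinVec 1 0 p) := by
  rw [limitInfty_eq, hconic]
  refine tangentConeIsLines_of_conic f (fun i => spinVec 1 0 (u i)) (fun i => ?_)
    (fun j hj => (hzf j).1 hj) ?_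
  · refine spinLineInfty_eq ((hzf _).2 ⟨i, rfl⟩) (hu i) ?_
    convert hli.comp ![1, i.succ.succ.succ] ?_ using 1
    · funext j
      fin_cases j <;> rfl
    · intro a b hab
      fin_cases a <;> fin_cases b <;> first | rfl | skip
      · exact absurd (congrArg Fin.val (hab : (1 : Fin (n + 3)) = i.succ.succ.succ)) (by simp)
      · exact absurd (congrArg Fin.val (hab : i.succ.succ.succ = (1 : Fin (n + 3)))) (by simp)
  · convert linearIndependent_spinVec spinVec_injective_infty hli using 1
    funext i
    exact Fin.cases rfl (fun i => Fin.cases rfl (fun i => Fin.cases rfl (fun _ => rfl) i) i) i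

theorem spinConicInfty_eq_conicCone {p v r : Fin 7 → ℂ} (T : ℂ → ℂ → ℂ × ℂ)
    (hT : ∀ s t, conicInfty (T s t).1 (T s t).2 = s ^ 2 • p + (s * t) • v + t ^ 2 • r)
    (hs : ∀ b c, ∃ s t, T s t = (b, c)) :
    spinConicInfty = conicCone (spinVec 1 0 p) (spinVec 1 0 v) (spinVec 1 0 r) := by
  have hS : ∀ s t : ℂ, spinVec 1 0 (conicInfty (T s t).1 (T s t).2) =
      s ^ 2 • spinVec 1 0 p + (s * t) • spinVec 1 0 v + t ^ 2 • spinVec 1 0 r := by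
    intro s t
    rw [hT, spinVec_add, spinVec_add, spinVec_smul, spinVec_smul, spinVec_smul]
  ext x
  constructor
  · rintro ⟨b, c, rfl⟩
    obtain ⟨s, t, hst⟩ := hs b c
    refine ⟨s, t, ?_⟩
    rw [← hS, hst]
  · rintro ⟨s, t, rfl⟩
    exact ⟨_, _, (hS s t).symm⟩

/-- The condition for a point to lie on one of the lines, for integral points. -/
abbrev OnLineInfty (z : Fin 7 → ℤ) (i : Fin 10) : Prop :=
  ∀ j, z j = lineInfty (z (pivotsInfty i).1) (z (pivotsInfty i).2) i j

/-- The point with given integral coordinates. -/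
def intPoint (z : Fin 7 → ℤ) : Fin 7 → ℂ := fun j => z j

theorem intPoint_mem_spinLineInfty {z : Fin 7 → ℤ} {i : Fin 10} :
    spinVec 1 0 (intPoint z) ∈ spinLineInfty i ↔ OnLineInfty z i := by
  rw [spinVec_mem_spinLineInfty]
  refine forall_congr' fun j => ?_
  have hm := map_lineInfty (Int.castRingHom ℂ) (z (pivotsInfty i).1) (z (pivotsInfty i).2) i j
  simp only [Int.coe_castRingHom] at hm
  rw [intPoint, intPoint, intPoint, ← hm, Int.cast_inj]

/-- The rows of `A` form a dual family, which turns independence over $\mathbb C$ into an integer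
computation. -/
theorem linearIndependent_intPoint {n : ℕ} {u : Fin n → Fin 7 → ℤ} (A : Fin n → Fin 7 → ℤ)
    (h : ∀ i k, ∑ j, A i j * u k j = if i = k then 1 else 0) :
    LinearIndependent ℂ fun i => intPoint (u i) := by
  rw [Fintype.linearIndependent_iff]
  intro g hg i
  have h1 : ∑ j, (A i j : ℂ) * (∑ k, g k • intPoint (u k)) j = 0 := by
    rw [hg]
    simp
  have h2 : ∀ k, ∑ j, (A i j : ℂ) * u k j = if i = k then 1 else 0 := fun k => by
    have := congrArg (Int.cast : ℤ → ℂ) (h i k)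
    push_cast at this
    exact this
  simp only [Finset.sum_apply, Pi.smul_apply, smul_eq_mul, Finset.mul_sum, intPoint] at h1
  rw [Finset.sum_comm] at h1
  simp only [mul_left_comm _ (g _), ← Finset.mul_sum, h2] at h1
  simpa using h1

/-- The substitution $(b,c')=(s,sc+t)$ moves the chosen point of the conic to $(s,t)=(1,0)$, the
form required for its tangent cone. -/
theorem spinConicInfty_eq_one (c : ℂ) :
    spinConicInfty = conicCone (spinVec 1 0 (conicInfty 1 c))
      (spinVec 1 0 ![1, 0, 1, 2 * c + 1, 1, 0, 0]) (spinVec 1 0 ![0, 0, 0, 1, 0, 0, 0]) := by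
  refine spinConicInfty_eq_conicCone (fun s t => (s, s * c + t)) (fun s t => funext fun j => ?_)
    fun b d => ⟨b, d - b * c, Prod.ext rfl (by simp)⟩
  fin_cases j <;> simp only [conicInfty, Fin.reduceFinMk, Fin.zero_eta, Fin.mk_one, Pi.add_apply,
    Pi.smul_apply, smul_eq_mul, Matrix.cons_val] <;> ring

theorem spinConicInfty_eq_zero :
    spinConicInfty = conicCone (spinVec 1 0 ![0, 0, 0, 1, 0, 0, 0])
      (spinVec 1 0 ![1, 0, 1, 1, 1, 0, 0]) (spinVec 1 0 ![1, 1, 1, 0, 0, 0, 0]) := by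
  refine spinConicInfty_eq_conicCone (fun s t => (t, s)) (fun s t => funext fun j => ?_)
    fun b d => ⟨d, b, rfl⟩
  fin_cases j <;> simp only [conicInfty, Fin.reduceFinMk, Fin.zero_eta, Fin.mk_one, Pi.add_apply,
    Pi.smul_apply, smul_eq_mul, Matrix.cons_val] <;> ring

theorem tangentConeIsLines_intPoint {n : ℕ} {z : Fin 7 → ℤ} (f : Fin n → Fin 10)
    (u : Fin n → Fin 7 → ℤ) (A : Fin (n + 1) → Fin 7 → ℤ) (hz : z 5 ≠ 0 ∨ z 6 ≠ 0)
    (hzf : ∀ j, OnLineInfty z j ↔ ∃ i, f i = j) (hu : ∀ i, OnLineInfty (u i) (f i))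
    (hA : ∀ i k, ∑ j, A i j * (Fin.cons z u : Fin (n + 1) → Fin 7 → ℤ) k j =
      if i = k then 1 else 0) :
    TangentConeIsLines n limitInfty (spinVec 1 0 (intPoint z)) := by
  refine tangentConeIsLines_lineInfty f (fun i => intPoint (u i)) ?_ (fun j => ?_) (fun i => ?_) ?_
  · rintro ⟨b, c, h⟩
    have h := spinVec_injective_infty h
    rcases hz with hz | hz
    · exact hz (Int.cast_eq_zero.1 (congrFun h 5))
    · exact hz (Int.cast_eq_zero.1 (congrFun h 6))
  · rw [intPoint_mem_spinLineInfty, hzf]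
  · exact intPoint_mem_spinLineInfty.2 (hu i)
  · convert linearIndependent_intPoint A hA using 1
    funext i
    exact Fin.cases rfl (fun _ => rfl) i

theorem tangentConeIsLines_conic_intPoint {n : ℕ} {p v r : Fin 7 → ℤ}
    (hconic : spinConicInfty = conicCone (spinVec 1 0 (intPoint p)) (spinVec 1 0 (intPoint v))
      (spinVec 1 0 (intPoint r)))
    (f : Fin n → Fin 10) (u : Fin n → Fin 7 → ℤ) (A : Fin (n + 3) → Fin 7 → ℤ)
    (hzf : ∀ j, OnLineInfty p j ↔ ∃ i, f i = j) (hu : ∀ i, OnLineInfty (u i) (f i))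
    (hA : ∀ i k, ∑ j, A i j *
      (Fin.cons r (Fin.cons p (Fin.cons v u)) : Fin (n + 3) → Fin 7 → ℤ) k j =
      if i = k then 1 else 0) :
    TangentConeIsLines (n + 1) limitInfty (spinVec 1 0 (intPoint p)) := by
  refine tangentConeIsLines_conicInfty hconic f (fun i => intPoint (u i)) (fun j => ?_)
    (fun i => ?_) ?_
  · rw [intPoint_mem_spinLineInfty, hzf]
  · exact intPoint_mem_spinLineInfty.2 (hu i)
  · convert linearIndependent_intPoint A hA using 1
    funext i
    exact Fin.cases rfl (fun i => Fin.cases rfl (fun i => Fin.cases rfl (fun _ => rfl) i) i) i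

/-- The data are the lines through the point, a second point on each, and a dual family that
certifies independence. -/
theorem isSpatialTriplePoint_fst :
    IsSpatialTriplePoint limitInfty (spinVec 1 0 (intPoint ![0, 0, 0, 0, 0, 0, 1])) := by
  refine tangentConeIsLines_intPoint ![0, 8, 9]
    ![![1, 0, 0, 0, 0, 0, 0], ![0, 0, 0, 0, 0, 1, 0], ![0, 0, 0, 1, 0, 0, 0]]
    ![![0, 0, 0, 0, 0, 0, 1], ![1, 0, 0, 0, 0, 0, 0], ![0, 0, 0, 0, 0, 1, 0],
      ![0, 0, 0, 1, 0, 0, 0]] ?_ ?_ ?_ ?_ <;> decide +kernel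

theorem isSpatialTriplePoint_snd :
    IsSpatialTriplePoint limitInfty (spinVec 1 0 (intPoint ![0, 0, 0, 0, 0, 1, 0])) := by
  refine tangentConeIsLines_intPoint ![4, 6, 8]
    ![![0, 0, 1, 0, 0, 0, 0], ![0, 0, 0, 1, 0, 0, 0], ![0, 0, 0, 0, 0, 0, 1]]
    ![![0, 0, 0, 0, 0, 1, 0], ![0, 0, 1, 0, 0, 0, 0], ![0, 0, 0, 1, 0, 0, 0],
      ![0, 0, 0, 0, 0, 0, 1]] ?_ ?_ ?_ ?_ <;> decide +kernel

theorem isSpatialTriplePoint_add :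
    IsSpatialTriplePoint limitInfty (spinVec 1 0 (intPoint ![0, 0, 0, 0, 0, 1, 1])) := by
  refine tangentConeIsLines_intPoint ![3, 7, 8]
    ![![0, 0, 0, 0, 1, 0, 0], ![0, 0, 0, 1, 0, 1, 0], ![0, 0, 0, 0, 0, 1, 0]]
    ![![0, 0, 0, 0, 0, 0, 1], ![0, 0, 0, 0, 1, 0, 0], ![0, 0, 0, 1, 0, 0, 0],
      ![0, 0, 0, -1, 0, 1, -1]] ?_ ?_ ?_ ?_ <;> decide +kernel

/-- Two lines of the plane meet here, and the conic is the third branch. -/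
theorem isSpatialTriplePoint_conic :
    IsSpatialTriplePoint limitInfty (spinVec 1 0 (intPoint ![0, 0, 0, 1, 0, 0, 0])) := by
  refine tangentConeIsLines_conic_intPoint (v := ![1, 0, 1, 1, 1, 0, 0])
    (r := ![1, 1, 1, 0, 0, 0, 0]) ?_ ![6, 9] ![![0, 0, 0, 0, 0, 1, 0], ![0, 0, 0, 0, 0, 0, 1]]
    ![![0, 1, 0, 0, 0, 0, 0], ![0, 0, 0, 1, -1, 0, 0], ![0, 0, 0, 0, 1, 0, 0],
      ![0, 0, 0, 0, 0, 1, 0], ![0, 0, 0, 0, 0, 0, 1]] ?_ ?_ ?_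
  · convert spinConicInfty_eq_zero using 3 <;> funext j <;> fin_cases j <;> simp [intPoint]
  all_goals decide +kernel

theorem isNode_conic_zero :
    IsNode limitInfty (spinVec 1 0 (intPoint ![1, 1, 1, 0, 0, 0, 0])) := by
  refine tangentConeIsLines_conic_intPoint (v := ![1, 0, 1, 1, 1, 0, 0])
    (r := ![0, 0, 0, 1, 0, 0, 0]) ?_ ![5] ![![0, 0, 1, 0, 0, 0, 0]]
    ![![0, 0, 0, 1, -1, 0, 0], ![0, 1, 0, 0, 0, 0, 0], ![1, -1, 0, 0, 0, 0, 0],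
      ![-1, 0, 1, 0, 0, 0, 0]] ?_ ?_ ?_
  · convert spinConicInfty_eq_one 0 using 3 <;> funext j <;> fin_cases j <;>
      simp [intPoint, conicInfty]
  all_goals decide +kernel

theorem isNode_conic_neg_one :
    IsNode limitInfty (spinVec 1 0 (intPoint ![0, 1, 0, 0, -1, 0, 0])) := by
  refine tangentConeIsLines_conic_intPoint (v := ![1, 0, 1, -1, 1, 0, 0])
    (r := ![0, 0, 0, 1, 0, 0, 0]) ?_ ![2] ![![0, 0, 0, 0, 1, 0, 0]]
    ![![1, 0, 0, 1, 0, 0, 0], ![0, 1, 0, 0, 0, 0, 0], ![1, 0, 0, 0, 0, 0, 0],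
      ![-1, 1, 0, 0, 1, 0, 0]] ?_ ?_ ?_
  · convert spinConicInfty_eq_one (-1) using 3 <;> funext j <;> fin_cases j <;>
      norm_num [intPoint, conicInfty]
  all_goals decide +kernel

theorem isSmoothPoint_conicInfty {c : ℂ} (h0 : c ≠ 0) (h1 : c ≠ -1) :
    IsSmoothPoint limitInfty (spinVec 1 0 (conicInfty 1 c)) := by
  refine tangentConeIsLines_conicInfty (spinConicInfty_eq_one c) ![] ![]
    (fun j => ⟨fun h => ?_, fun ⟨i, _⟩ => i.elim0⟩) (fun i => i.elim0) ?_
  · rw [spinVec_mem_spinLineInfty] at h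
    have e0 := h 0
    have e1 := h 1
    have e2 := h 2
    have e3 := h 3
    have e4 := h 4
    clear h
    fin_cases j <;> simp only [conicInfty, lineInfty, pivotsInfty, Fin.reduceFinMk, Fin.zero_eta,
      Fin.mk_one, Matrix.cons_val] at e0 e1 e2 e3 e4 <;> grind
  · rw [Fintype.linearIndependent_iff]
    intro g hg
    replace hg : g 0 • ![0, 0, 0, 1, 0, 0, 0] + g 1 • conicInfty 1 c +
        g 2 • ![1, 0, 1, 2 * c + 1, 1, 0, 0] = 0 := (Fin.sum_univ_three _).symm.trans hg
    have e0 := congrFun hg 0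
    have e1 := congrFun hg 1
    have e3 := congrFun hg 3
    simp only [conicInfty, Pi.add_apply, Pi.smul_apply, smul_eq_mul, Matrix.cons_val,
      Pi.zero_apply] at e0 e1 e3
    clear hg
    have h0 : g 0 = 0 ∧ g 1 = 0 ∧ g 2 = 0 := by grind
    intro i
    fin_cases i
    exacts [h0.1, h0.2.1, h0.2.2]

/-- The conic meets the lines only at $b=0$, a triple point, and at $c/b=0$ and $c/b=-1$, where a
single line crosses it. -/
theorem conicInfty_point {p : SpinIdx → ℂ} (hp : p ∈ spinConicInfty) (hp0 : p ≠ 0) :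
    IsSmoothPoint limitInfty p ∨ IsNode limitInfty p ∨ IsSpatialTriplePoint limitInfty p := by
  obtain ⟨b, c, rfl⟩ := hp
  by_cases hb : b = 0
  · subst hb
    have hz : conicInfty 0 c = c ^ 2 • intPoint ![0, 0, 0, 1, 0, 0, 0] := by
      funext j
      fin_cases j <;> simp [conicInfty, intPoint]
    have hc : c ≠ 0 := by
      rintro rfl
      refine hp0 ?_
      rw [hz, zero_pow two_ne_zero, zero_smul, spinVec_zero]
    rw [hz, spinVec_smul]
    exact Or.inr (Or.inr (isSpatialTriplePoint_conic.smul (pow_ne_zero 2 hc)))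
  · have hz : conicInfty b c = b ^ 2 • conicInfty 1 (c / b) := by
      funext j
      fin_cases j <;> simp [conicInfty] <;> field_simp
    have hb2 := pow_ne_zero 2 hb
    rw [hz, spinVec_smul]
    by_cases h0 : c / b = 0
    · refine Or.inr (Or.inl (TangentConeIsLines.smul ?_ hb2))
      have hp : conicInfty 1 0 = intPoint ![1, 1, 1, 0, 0, 0, 0] := by
        funext j
        fin_cases j <;> simp [conicInfty, intPoint]
      rw [h0, hp]
      exact isNode_conic_zero
    by_cases h1 : c / b = -1
    · refine Or.inr (Or.inl (TangentConeIsLines.smul ?_ hb2))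
      have hp : conicInfty 1 (-1) = intPoint ![0, 1, 0, 0, -1, 0, 0] := by
        funext j
        fin_cases j <;> norm_num [conicInfty, intPoint]
      rw [h1, hp]
      exact isNode_conic_neg_one
    · exact Or.inl ((isSmoothPoint_conicInfty h0 h1).smul hb2)

theorem isSpatialTriplePoint_of_isTripleInfty {z : Fin 7 → ℂ} (hz : IsTripleInfty z)
    (hz0 : spinVec 1 0 z ≠ 0) : IsSpatialTriplePoint limitInfty (spinVec 1 0 z) := by
  have key : ∀ (w : Fin 7 → ℤ) (c : ℂ), IsSpatialTriplePoint limitInfty (spinVec 1 0 (intPoint w)) →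
      z = c • intPoint w → IsSpatialTriplePoint limitInfty (spinVec 1 0 z) := by
    rintro w c hw rfl
    have hc : c ≠ 0 := by
      rintro rfl
      exact hz0 (by rw [zero_smul, spinVec_zero])
    rw [spinVec_smul]
    exact hw.smul hc
  obtain ⟨h0, h1, h2, h3, h4, h5 | h6 | h56⟩ := hz
  · refine key _ (z 6) isSpatialTriplePoint_fst (funext fun j => ?_)
    fin_cases j <;> simp [intPoint, h0, h1, h2, h3, h4, h5]
  · refine key _ (z 5) isSpatialTriplePoint_snd (funext fun j => ?_)
    fin_cases j <;> simp [intPoint, h0, h1, h2, h3, h4, h6]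
  · refine key _ (z 6) isSpatialTriplePoint_add (funext fun j => ?_)
    fin_cases j <;> simp [intPoint, h0, h1, h2, h3, h4, h56]

theorem limitInfty_point {p : SpinIdx → ℂ} (hp : p ∈ zeroLocus ℂ limitInfty) (hp0 : p ≠ 0) :
    IsSmoothPoint limitInfty p ∨ IsNode limitInfty p ∨ IsSpatialTriplePoint limitInfty p := by
  by_cases hc : p ∈ spinConicInfty
  · exact conicInfty_point hc hp0
  obtain ⟨v, hv⟩ : ∃ v, p ∈ spinLineInfty v := by
    obtain ⟨q, hq, hqp⟩ := exists_polynomial_separating_conicInfty hc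
    rw [limitInfty_eq] at hp
    exact exists_mem_of_mem_zeroLocus hq hqp hp
  obtain ⟨a, b, hab⟩ := mem_spinLineInfty.1 hv
  by_cases hT : IsTripleInfty (lineInfty a b v)
  · subst hab
    exact Or.inr (Or.inr (isSpatialTriplePoint_of_isTripleInfty hT hp0))
  have hlt : ∀ u v w, u < v → v < w → p ∈ spinLineInfty u → p ∈ spinLineInfty v →
      p ∉ spinLineInfty w := by
    intro u v w huv hvw hu hv hw
    rw [hab] at hu hv hw
    exact hT (isTripleInfty_of_lt huv hvw hu hv hw)
  have htwo : ∀ u v w, p ∈ spinLineInfty u → p ∈ spinLineInfty v → p ∈ spinLineInfty w →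
      u = v ∨ v = w ∨ u = w := by
    intro u v w hu hv hw
    by_contra! h
    rcases lt_or_gt_of_ne h.1 with huv | huv <;> rcases lt_or_gt_of_ne h.2.1 with hvw | hvw <;>
      rcases lt_or_gt_of_ne h.2.2 with huw | huw
    exacts [hlt u v w huv hvw hu hv hw, hlt u v w huv hvw hu hv hw, hlt u w v huw hvw hu hw hv,
      hlt w u v huw huv hw hu hv, hlt v u w huv huw hv hu hw, hlt v w u hvw huw hv hw hu,
      hlt w v u hvw huv hw hv hu, hlt w v u hvw huv hw hv hu]
  obtain ⟨k, hk⟩ := Function.ne_iff.1 hp0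
  have hc' : (p k)⁻¹ • p ∉ spinConicInfty := fun h => hc (by
    have := smul_mem_spinConicInfty h (p k)
    rwa [smul_smul, mul_inv_cancel₀ hk, one_smul] at this)
  obtain ⟨q, hq, hqp⟩ := exists_polynomial_separating_conicInfty hc'
  obtain ⟨n, f, hn, -, hrange, w, hw, hcone⟩ := exists_tangent_lines finrank_spinLineInfty
    spinLineInfty_injective hk hq hqp htwo
  rw [← limitInfty_eq] at hcone
  have hvr : v ∈ Set.range f := by rw [hrange]; exact hv
  obtain ⟨i, -⟩ := hvr
  have hi := i.is_lt
  obtain rfl | rfl : n = 1 ∨ n = 2 := by omega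
  · exact Or.inl ⟨k, hk, w, hw, hcone⟩
  · exact Or.inr (Or.inl ⟨k, hk, w, hw, hcone⟩)

theorem spinVec_intPoint_mem {z : Fin 7 → ℤ} {i : Fin 10} (hz : OnLineInfty z i) :
    spinVec 1 0 (intPoint z) ∈ ((⋃ i, (spinLineInfty i : Set (SpinIdx → ℂ))) ∪ spinConicInfty) :=
  Or.inl (Set.mem_iUnion_of_mem i (intPoint_mem_spinLineInfty.2 hz))

theorem minimalPrimes_limitInfty_nontrivial : limitInfty.minimalPrimes.Nontrivial := by
  set Z := (⋃ i, (spinLineInfty i : Set (SpinIdx → ℂ))) ∪ spinConicInfty with hZ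
  have hI : limitInfty = vanishingIdeal ℂ Z := limitInfty_eq
  have h2 : ∀ z : Fin 7 → ℂ, spinVec 1 0 z ⟨{0, 1}, by decide⟩ = z 2 := fun _ => rfl
  have h6 : ∀ z : Fin 7 → ℂ, spinVec 1 0 z ⟨{0, 2, 3, 4}, by decide⟩ = z 6 := fun _ => rfl
  set f : MvPolynomial SpinIdx ℂ := X ⟨{0, 1}, by decide⟩ with hf
  set g : MvPolynomial SpinIdx ℂ := X ⟨{0, 2, 3, 4}, by decide⟩ with hg
  have hfg : f * g ∈ limitInfty := by
    rw [hI]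
    rintro x (hx | hx)
    · obtain ⟨i, hi⟩ := Set.mem_iUnion.1 hx
      obtain ⟨a, b, rfl⟩ := mem_spinLineInfty.1 hi
      change eval _ _ = 0
      rw [map_mul, hf, hg, eval_X, eval_X, h2, h6]
      exact equations_lineInfty a b i 5
    · obtain ⟨b, c, rfl⟩ := hx
      change eval _ _ = 0
      rw [map_mul, hf, hg, eval_X, eval_X, h2, h6]
      exact equations_conicInfty b c 5
  have hfI : f ∉ limitInfty := by
    intro h
    rw [hI] at h
    have h := h _ (spinVec_intPoint_mem (z := ![0, 0, 1, 0, 0, 0, 0]) (i := 4) (by decide +kernel))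
    change eval _ _ = 0 at h
    rw [hf, eval_X, h2] at h
    simp [intPoint] at h
  have hgI : g ∉ limitInfty := by
    intro h
    rw [hI] at h
    have h := h _ (spinVec_intPoint_mem (z := ![0, 0, 0, 0, 0, 0, 1]) (i := 0) (by decide +kernel))
    change eval _ _ = 0 at h
    rw [hg, eval_X, h6] at h
    simp [intPoint] at h
  have hrad : sInf limitInfty.minimalPrimes = limitInfty := by
    rw [Ideal.sInf_minimalPrimes, hI]
    refine le_antisymm (fun q ⟨n, hq⟩ x hx => ?_) Ideal.le_radical
    have := hq x hx
    rw [map_pow] at this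
    exact eq_zero_of_pow_eq_zero this
  by_contra hnt
  rw [Set.not_nontrivial_iff] at hnt
  obtain ⟨Q, hQ⟩ : limitInfty.minimalPrimes.Nonempty := by
    by_contra hempty
    rw [Set.not_nonempty_iff_eq_empty.1 hempty, sInf_empty] at hrad
    exact hfI (hrad ▸ Submodule.mem_top)
  rw [hnt.eq_singleton_of_mem hQ, sInf_singleton] at hrad
  have := hQ.1.1
  rw [hrad] at this
  exact (this.mem_or_mem hfg).elim hfI hgI

/-! ### Points of `P_t ∩ OG(5,10)` outside the limits -/

theorem mem_orthogonalGrassmannian_of_linearMap {x : SpinIdx → ℂ}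
    (T : (Fin 5 → ℂ) →ₗ[ℂ] QuadSpace) (hT : ∀ c, T c = 0 → c = 0)
    (hq : ∀ c, quadForm (T c) = 0) (hx : ∀ c J, spinCoord (T c) x J = 0) :
    x ∈ orthogonalGrassmannian := by
  refine ⟨LinearMap.range T, ⟨?_, ?_⟩, ?_⟩
  · rw [LinearMap.finrank_range_of_inj ((injective_iff_map_eq_zero T).2 hT)]
    simp
  · rintro _ ⟨c, rfl⟩
    exact hq c
  · rintro _ ⟨c, rfl⟩
    exact (spinAction_eq_zero_iff _ _).2 (hx c)

theorem spinVec_mem_linearSpace (t₀ t₁ : ℂ) (z : Fin 7 → ℂ) :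
    spinVec t₀ t₁ z ∈ linearSpace t₀ t₁ := by
  have h0 : spinVec t₀ t₁ z ⟨∅, by decide⟩ = -(t₀ - t₁) * t₁ * z 3 := rfl
  have h1 : spinVec t₀ t₁ z ⟨{1, 4}, by decide⟩ = -z 4 := rfl
  have h2 : spinVec t₀ t₁ z ⟨{2, 4}, by decide⟩ = -t₀ * z 3 := rfl
  have h3 : spinVec t₀ t₁ z ⟨{3, 4}, by decide⟩ = t₁ * z 3 - z 4 := rfl
  have h4 : spinVec t₀ t₁ z ⟨{0, 4}, by decide⟩ = -(t₀ - t₁) * z 3 := rfl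
  refine ⟨rfl, rfl, rfl, ?_, sub_self _, ?_, rfl, sub_self _, ?_⟩
  · rw [h1, h2, h3]
    ring
  · rw [h1, h2, h3, h4]
    ring
  · rw [h0, h1, h2, h3]
    ring

/-- A Lagrangian whose half spinor lies in `P_1` but not on `X_1`. -/
def lagrangianOne : (Fin 5 → ℂ) →ₗ[ℂ] QuadSpace where
  toFun c := (![c 0, c 1, -c 2, -c 2, c 2], ![0, 0, -c 3 + c 4, c 3, c 4])
  map_add' c d := by
    refine Prod.ext (funext fun j => ?_) (funext fun j => ?_) <;> fin_cases j <;> simp <;> ring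
  map_smul' r c := by
    refine Prod.ext (funext fun j => ?_) (funext fun j => ?_) <;> fin_cases j <;> simp
    ring

theorem spinVec_one_mem_orthogonalGrassmannian :
    spinVec 1 1 ![0, 0, 0, 1, 0, 0, 0] ∈ orthogonalGrassmannian := by
  refine mem_orthogonalGrassmannian_of_linearMap lagrangianOne (fun c hc => ?_) (fun c => ?_)
    fun c => spinCoord_eq_zero_of_odd ?_
  · have h1 := congrArg Prod.fst hc
    have h2 := congrArg Prod.snd hc
    funext j
    fin_cases j
    exacts [congrFun h1 0, congrFun h1 1, congrFun h1 4, congrFun h2 3, congrFun h2 4]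
  · simp only [quadForm, lagrangianOne, LinearMap.coe_mk, AddHom.coe_mk, Fin.sum_univ_five,
      Matrix.cons_val]
    ring
  · obtain ⟨e0, e1, e2, e3, e4, e5, e6, e7, e8, e9, e10, e11, e12, e13, e14, e15⟩ :=
      extendSpin_spinVec 1 1 ![0, 0, 0, 1, 0, 0, 0]
    simp only [List.forall_mem_cons, List.not_mem_nil, false_imp_iff, implies_true, and_true,
      spinCoord_0, spinCoord_1, spinCoord_2, spinCoord_3, spinCoord_4, spinCoord_012,
      spinCoord_013, spinCoord_014, spinCoord_023, spinCoord_024, spinCoord_034, spinCoord_123,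
      spinCoord_124, spinCoord_134, spinCoord_234, spinCoord_01234, e0, e1, e2, e3, e4, e5, e6,
      e7, e8, e9, e10, e11, e12, e13, e14, e15]
    simp only [lagrangianOne, LinearMap.coe_mk, AddHom.coe_mk, Matrix.cons_val]
    refine ⟨?_, ?_, ?_, ?_, ?_, ?_, ?_, ?_, ?_, ?_, ?_, ?_, ?_, ?_, ?_, ?_⟩ <;> ring

/-- A Lagrangian whose half spinor lies in `P_∞` but not on `X_∞`. -/
def lagrangianInfty : (Fin 5 → ℂ) →ₗ[ℂ] QuadSpace where
  toFun c := (![-c 3, -c 0 + c 1 - c 2, c 3, c 0, 0], ![c 1, c 3, c 2, c 3, c 4])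
  map_add' c d := by
    refine Prod.ext (funext fun j => ?_) (funext fun j => ?_) <;> fin_cases j <;> simp <;> ring
  map_smul' r c := by
    refine Prod.ext (funext fun j => ?_) (funext fun j => ?_) <;> fin_cases j <;> simp
    ring

theorem spinVec_infty_mem_orthogonalGrassmannian :
    spinVec 1 0 ![0, 0, 0, 1, 0, 1, 1] ∈ orthogonalGrassmannian := by
  refine mem_orthogonalGrassmannian_of_linearMap lagrangianInfty (fun c hc => ?_) (fun c => ?_)
    fun c => spinCoord_eq_zero_of_odd ?_
  · have h1 := congrArg Prod.fst hc
    have h2 := congrArg Prod.snd hc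
    funext j
    fin_cases j
    exacts [congrFun h1 3, congrFun h2 0, congrFun h2 2, congrFun h2 3, congrFun h2 4]
  · simp only [quadForm, lagrangianInfty, LinearMap.coe_mk, AddHom.coe_mk, Fin.sum_univ_five,
      Matrix.cons_val]
    ring
  · obtain ⟨e0, e1, e2, e3, e4, e5, e6, e7, e8, e9, e10, e11, e12, e13, e14, e15⟩ :=
      extendSpin_spinVec 1 0 ![0, 0, 0, 1, 0, 1, 1]
    simp only [List.forall_mem_cons, List.not_mem_nil, false_imp_iff, implies_true, and_true,
      spinCoord_0, spinCoord_1, spinCoord_2, spinCoord_3, spinCoord_4, spinCoord_012,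
      spinCoord_013, spinCoord_014, spinCoord_023, spinCoord_024, spinCoord_034, spinCoord_123,
      spinCoord_124, spinCoord_134, spinCoord_234, spinCoord_01234, e0, e1, e2, e3, e4, e5, e6,
      e7, e8, e9, e10, e11, e12, e13, e14, e15]
    simp only [lagrangianInfty, LinearMap.coe_mk, AddHom.coe_mk, Matrix.cons_val]
    refine ⟨?_, ?_, ?_, ?_, ?_, ?_, ?_, ?_, ?_, ?_, ?_, ?_, ?_, ?_, ?_, ?_⟩ <;> ring

/-- Pulled back along the retraction, the equations become polynomials on $\mathbb P(S^+)$ that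
vanish on `S`, hence on its closure. -/
theorem equations_eq_zero_of_mem_zeroLocus {t₀ t₁ : ℂ} (ht : t₀ = 1) {S : Set (SpinIdx → ℂ)}
    (hS : ∀ x ∈ S, ∃ w, x = spinVec t₀ t₁ w ∧ ∀ j, equations t₀ t₁ w j = 0) {z : Fin 7 → ℂ}
    (hz : spinVec t₀ t₁ z ∈ zeroLocus ℂ (vanishingIdeal ℂ S)) (j : Fin 11) :
    equations t₀ t₁ z j = 0 := by
  have hev : ∀ w : Fin 7 → ℂ, eval (spinVec t₀ t₁ w)
      (equations (C t₀) (C t₁) (spinRetract (C t₁) 0 (-1) X) j) = equations t₀ t₁ w j := by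
    intro w
    rw [map_equations, eval_C, eval_C]
    congr 1
    conv_rhs => rw [← spinRetract_spinVec (t₀ := t₀) (t₁ := t₁) (α := 0) (β := -1)
      (by rw [ht]; ring) w]
    funext i
    rw [map_spinRetract]
    simp
  rw [← hev]
  refine hz _ fun x hx => ?_
  obtain ⟨w, rfl, hw⟩ := hS x hx
  exact (hev w).trans (hw j)

theorem linearSpace_inter_orthogonalGrassmannian_ne_limitOne :
    linearSpace 1 1 ∩ orthogonalGrassmannian ≠ zeroLocus ℂ limitOne := by
  intro h
  have hmem : spinVec 1 1 ![0, 0, 0, 1, 0, 0, 0] ∈ zeroLocus ℂ limitOne :=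
    h ▸ ⟨spinVec_mem_linearSpace 1 1 _, spinVec_one_mem_orthogonalGrassmannian⟩
  rw [limitOne_eq] at hmem
  -- At this point the quadric with index 1 takes the value $-z_3^2=-1$.
  have := equations_eq_zero_of_mem_zeroLocus rfl (fun x hx => ?_) hmem 1
  · simp [equations] at this
  · obtain ⟨i, hi⟩ := Set.mem_iUnion.1 hx
    obtain ⟨a, b, rfl⟩ := mem_spinLineOne.1 hi
    exact ⟨_, rfl, equations_lineOne a b i⟩

theorem linearSpace_inter_orthogonalGrassmannian_ne_limitInfty :
    linearSpace 1 0 ∩ orthogonalGrassmannian ≠ zeroLocus ℂ limitInfty := by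
  intro h
  have hmem : spinVec 1 0 ![0, 0, 0, 1, 0, 1, 1] ∈ zeroLocus ℂ limitInfty :=
    h ▸ ⟨spinVec_mem_linearSpace 1 0 _, spinVec_infty_mem_orthogonalGrassmannian⟩
  rw [limitInfty_eq] at hmem
  -- The point lies in the plane of the four lines but on none of them, and the quartic takes the
  -- value $-1$ there.
  have := equations_eq_zero_of_mem_zeroLocus rfl (fun x hx => ?_) hmem 10
  · simp [equations] at this
  · rcases hx with hx | ⟨b, c, rfl⟩
    · obtain ⟨i, hi⟩ := Set.mem_iUnion.1 hx
      obtain ⟨a, b, rfl⟩ := mem_spinLineInfty.1 hi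
      exact ⟨_, rfl, equations_lineInfty a b i⟩
    · exact ⟨_, rfl, equations_conicInfty b c⟩

theorem sameSubscheme_of_eq {σ : Type} {I J : Ideal (MvPolynomial σ ℂ)} (h : I = J) :
    SameSubscheme I J :=
  ⟨0, fun _ _ _ _ => by rw [h]⟩

end

end MukaiGenusSeven

theorem mainTheorem8 :
    -- the limit as `t → 1`
    (MukaiGenusSeven.SameSubscheme MukaiGenusSeven.limitOne
        (⨅ v, MukaiGenusSeven.limitOneComponent v) ∧
      (∃ L : Fin 12 → Submodule ℂ (MukaiGenusSeven.SpinIdx → ℂ),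
        MukaiGenusSeven.IsGraphCurve MukaiGenusSeven.limitOne MukaiGenusSeven.graphOne L ∧
        ∀ v, MukaiGenusSeven.SameSubscheme (MukaiGenusSeven.limitOneComponent v)
          (⨅ (i : Fin 12) (_ : MukaiGenusSeven.contractEdge i = v),
            MvPolynomial.vanishingIdeal ℂ (L i : Set (MukaiGenusSeven.SpinIdx → ℂ)))) ∧
      MukaiGenusSeven.linearSpace 1 1 ∩ MukaiGenusSeven.orthogonalGrassmannian ≠
        MvPolynomial.zeroLocus ℂ MukaiGenusSeven.limitOne) ∧
    -- the limit as `t → ∞`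
    (MukaiGenusSeven.SameSubscheme MukaiGenusSeven.limitInfty
        (⨅ v, MukaiGenusSeven.limitInftyComponent v) ∧
      MukaiGenusSeven.limitInfty.minimalPrimes.Nontrivial ∧
      (∀ p ∈ MvPolynomial.zeroLocus ℂ MukaiGenusSeven.limitInfty, p ≠ 0 →
        MukaiGenusSeven.IsSmoothPoint MukaiGenusSeven.limitInfty p ∨
        MukaiGenusSeven.IsNode MukaiGenusSeven.limitInfty p ∨
        MukaiGenusSeven.IsSpatialTriplePoint MukaiGenusSeven.limitInfty p) ∧
      (∃ p, MukaiGenusSeven.IsNode MukaiGenusSeven.limitInfty p) ∧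
      (∃ p, MukaiGenusSeven.IsSpatialTriplePoint MukaiGenusSeven.limitInfty p) ∧
      MukaiGenusSeven.linearSpace 1 0 ∩ MukaiGenusSeven.orthogonalGrassmannian ≠
        MvPolynomial.zeroLocus ℂ MukaiGenusSeven.limitInfty) := by
  exact ⟨⟨MukaiGenusSeven.sameSubscheme_of_eq MukaiGenusSeven.iInf_limitOneComponent.symm,
      ⟨MukaiGenusSeven.spinLineOne, MukaiGenusSeven.isGraphCurve_limitOne,
        fun v => MukaiGenusSeven.sameSubscheme_of_eq
          (MukaiGenusSeven.limitOneComponent_eq_iInf v)⟩,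
      MukaiGenusSeven.linearSpace_inter_orthogonalGrassmannian_ne_limitOne⟩,
    MukaiGenusSeven.sameSubscheme_of_eq MukaiGenusSeven.iInf_limitInftyComponent.symm,
    MukaiGenusSeven.minimalPrimes_limitInfty_nontrivial,
    fun _ hp hp0 => MukaiGenusSeven.limitInfty_point hp hp0,
    ⟨_, MukaiGenusSeven.isNode_conic_zero⟩,
    ⟨_, MukaiGenusSeven.isSpatialTriplePoint_fst⟩,
    MukaiGenusSeven.linearSpace_inter_orthogonalGrassmannian_ne_limitInfty⟩
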